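/- **Setting.** Let $A_0$ be a (possibly unbounded) self-adjoint operator in a complex Hilbert space $\mathfrak A_0$ with spectral measure $\mathsf E_0$. Assume that its spectrum is purely absolutely continuous and equals the closure of an interval $\Delta_0=(\mu_0^{(1)},\mu_0^{(2)})$, $-\infty\le\mu_0^{(1)}<\mu_0^{(2)}\le\infty$. Let $\mathfrak A_1$ be a finite-dimensional complex Hilbert space, $A_1$ a self-adjoint operator on $\mathfrak A_1$ with $\sigma_1:=\operatorname{spec}(A_1)\subset\Delta_0$, let $B:\mathfrak A_1\to\mathfrak A_0$ be a bounded operator, and put $K_B(\mu)=B^*\mathsf E_0((-\infty,\mu))B$. Assume that $K_B$ is differentiable on $\Delta_0$ in operator norm and that $K_B'$ continues analytically from $\Delta_0$ to a simply connected domain $D^-\subset\mathbb C^-$ and to its mirror image $D^+\subset\mathbb C^+$, where $\Delta_0$ lies in the boundary of $D^\pm$ and $D^-\cup\Delta_0\cup D^+$ is open. If an end point $\mu_0^{(k)}$ is finite, assume that $\|K_B'(\mu)\|\le C|\mu-\mu_0^{(k)}|^{\gamma}$ for $\mu\in D^\pm$ near $\mu_0^{(k)}$, with some $C>0$, $\gamma\in(-1,0]$.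 **Contours.** For $l=\pm1$ write $D^l$ for $D^\pm$. An *admissible contour* $\Gamma^l$ is a rectifiable (if unbounded: of finite length in every ball) Jordan curve in $D^l$ with $\mathcal V_0(B,\Gamma^l):=\int_{\Gamma^l}|d\mu|\,\|K_B'(\mu)\|<\infty$ that originates from a continuous deformation of $\Delta_0$ within $D^l\cup\Delta_0$ (inside $D^l$ except at its start), with the end points fixed (an infinite end point being the point $\infty$ of the Riemann sphere); if $\Delta_0$ is unbounded, the deformation is such that, on the set swept by it, $\|K_B'(\mu)\|$ grows at most polynomially as $|\mu|\to\infty$. Put $d(\Gamma^l)=\operatorname{dist}(\sigma_1,\Gamma^l)$, $$r_{\min}(\Gamma^l)=\tfrac12 d(\Gamma^l)-\sqrt{\tfrac14 d^2(\Gamma^l)-\mathcal V_0(B,\Gamma^l)},\qquad r_{\max}(\Gamma^l)=d(\Gamma^l)-\sqrt{\mathcal V_0(B,\Gamma^l)},$$ and let $r_0=r_0(B)$ be the infimum of $r_{\min}(\Gamma^l)$ over all admissible contours $\Gamma^l\subset D^l$ with $d^2(\Gamma^l)-4\mathcal V_0(B,\Gamma^l)>0$ (by symmetry it is the same for $l=1$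 and $l=-1$). **Lemma.** Let $l=\pm1$ and let $\Gamma^l\subset D^l$ be an admissible contour with $\mathcal V_0(B,\Gamma^l)<\frac14d^2(\Gamma^l)$. Assume that there is $c_0>0$ such that $$\langle K_B'(\mu)x,x\rangle\ge c_0\|x\|^2\quad\text{for all }x\in\mathfrak A_1\text{ and all }\mu\in\Delta_0\text{ with }\operatorname{dist}(\mu,\sigma_1)\le r_0 .$$ Let $X^{(l)}$ be the solution of $$X=-\int_{\Gamma^l}d\mu\,K_B'(\mu)\,(A_1+X-\mu)^{-1}$$ in the balls $\|X\|\le r$, $r_{\min}(\Gamma^l)\le r<r_{\max}(\Gamma^l)$, and put $Z^{(l)}=A_1+X^{(l)}$. Then the spectrum of $Z^{(l)}$ consists of a finite number of isolated eigenvalues of finite algebraic multiplicity, and none of these eigenvalues is real. -/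

import Mathlib

open Set Filter Topology MeasureTheory

namespace BlockOp

noncomputable section

/-! ### Self-adjoint operators: spectrum and spectral measure -/

section Spectral

variable {H : Type*} [NormedAddCommGroup H] [InnerProductSpace ℂ H]

/-- The spectrum of a (possibly unbounded) operator `T`: the set of all `z` for which
`T - z : Dom T → H` has no bounded everywhere defined two-sided inverse. -/
def opSpectrum (T : H →ₗ.[ℂ] H) : Set ℂ :=
  {z | ¬ ∃ R : H →L[ℂ] H,
      (∀ y : H, ∃ h : R y ∈ T.domain, T ⟨R y, h⟩ - z • R y = y) ∧
      ∀ x : T.domain, R (T x - z • (x : H)) = x}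

variable [CompleteSpace H]

variable (H) in
/-- A projection-valued measure on the Borel subsets of `ℝ`: its values on Borel sets are
orthogonal projections, the value at `ℝ` is the identity, and it is strongly
countably additive. (The values outside the Borel sets are irrelevant.) -/
structure ProjMeasure where
  toFun : Set ℝ → H →L[ℂ] H
  isStarProjection : ∀ s, MeasurableSet s → IsStarProjection (toFun s)
  map_univ : toFun univ = 1
  hasSum_iUnion : ∀ s : ℕ → Set ℝ, (∀ n, MeasurableSet (s n)) →
    Pairwise (fun i j => Disjoint (s i) (s j)) →
    ∀ x : H, HasSum (fun n => toFun (s n) x) (toFun (⋃ n, s n) x)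

namespace ProjMeasure

variable (E : ProjMeasure H)

theorem map_empty (x : H) : E.toFun ∅ x = 0 := by
  have h := E.hasSum_iUnion (fun _ => ∅) (fun _ => MeasurableSet.empty)
    (fun _ _ _ => disjoint_bot_left) x
  exact tendsto_nhds_unique tendsto_const_nhds h.summable.tendsto_atTop_zero

theorem norm_sq_eq {s : Set ℝ} (hs : MeasurableSet s) (x : H) :
    ‖E.toFun s x‖ ^ 2 = (inner ℂ x (E.toFun s x)).re := by
  have hP := E.isStarProjection s hs
  have h2 : E.toFun s (E.toFun s x) = E.toFun s x :=
    congrArg (fun T : H →L[ℂ] H => T x) hP.isIdempotentElem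
  have h3 : inner ℂ (E.toFun s x) (E.toFun s x) = inner ℂ x (E.toFun s x) := by
    have h4 : ContinuousLinearMap.adjoint (E.toFun s) = E.toFun s := hP.isSelfAdjoint
    conv_lhs => rw [← ContinuousLinearMap.adjoint_inner_right, h4, h2]
  rw [← h3]
  exact (inner_self_eq_norm_sq (𝕜 := ℂ) _).symm

/-- The scalar measure `Ω ↦ ⟨E(Ω)x, x⟩ = ‖E(Ω)x‖²`. -/
def scalar (x : H) : Measure ℝ :=
  Measure.ofMeasurable (fun s _ => ENNReal.ofReal (‖E.toFun s x‖ ^ 2))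
    (by simp [E.map_empty])
    (by
      intro f hf hd
      have h := E.hasSum_iUnion f hf hd x
      have h1 : HasSum (fun n => ‖E.toFun (f n) x‖ ^ 2) (‖E.toFun (⋃ n, f n) x‖ ^ 2) := by
        rw [E.norm_sq_eq (MeasurableSet.iUnion hf)]
        simp_rw [fun n => E.norm_sq_eq (hf n) x]
        exact Complex.reCLM.hasSum ((innerSL ℂ x).hasSum h)
      change ENNReal.ofReal (‖E.toFun (⋃ n, f n) x‖ ^ 2) = _
      rw [← h1.tsum_eq, ENNReal.ofReal_tsum_of_nonneg (fun n => by positivity) h1.summable])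

/-- `E` is the spectral measure of `A`, that is `A = ∫ μ dE(μ)`: the domain of `A` consists of all
`x` with `∫ μ² d⟨E(μ)x,x⟩ < ∞`, and `⟨Ax, x⟩ = ∫ μ d⟨E(μ)x,x⟩` for these `x`. -/
def IsSpectralMeasureOf (A : H →ₗ.[ℂ] H) : Prop :=
  (∀ x : H, x ∈ A.domain ↔ ∫⁻ t, ENNReal.ofReal (t ^ 2) ∂(E.scalar x) < ⊤) ∧
  ∀ x : A.domain, inner ℂ (A x) (x : H) = ((∫ t, t ∂(E.scalar (x : H)) : ℝ) : ℂ)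

/-- The spectral function `E⁰(μ) = E((-∞, μ))`. -/
def spectralFunction (μ : ℝ) : H →L[ℂ] H := E.toFun (Iio μ)

end ProjMeasure

end Spectral

/-! ### The interval, the continuation domains and the function `K_B'` -/

/-- The open interval `Δ₀ = (a, b)` with `-∞ ≤ a < b ≤ ∞`. -/
def interval (a b : EReal) : Set ℝ := {x | a < (x : EReal) ∧ (x : EReal) < b}

/-- `D^l`: the set `D⁻` itself for `l = -1`, its mirror image in the real axis for `l = +1`. -/
def side (Dm : Set ℂ) (l : ℤˣ) : Set ℂ :=
  if l = 1 then (starRingEnd ℂ) ⁻¹' Dm else Dm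

/-- The union `D⁻ ∪ Δ₀ ∪ D⁺`. -/
def fullDomain (a b : EReal) (Dm : Set ℂ) : Set ℂ :=
  side Dm (-1) ∪ Complex.ofReal '' interval a b ∪ side Dm 1

/-- The bound `‖K'(μ)‖ ≤ C |μ - e|^γ`, `γ ∈ (-1, 0]`, on `D^±` near the finite end point `e`. -/
def EndpointBound {V : Type*} [Norm V] (Dm : Set ℂ) (K' : ℂ → V) (e : ℝ) : Prop :=
  ∃ C > (0 : ℝ), ∃ γ ∈ Ioc (-1 : ℝ) 0, ∃ ρ > (0 : ℝ),
    ∀ l : ℤˣ, ∀ μ ∈ side Dm l, ‖μ - e‖ < ρ → ‖K' μ‖ ≤ C * ‖μ - e‖ ^ γ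

section Continuation

variable {H₁ : Type*} [NormedAddCommGroup H₁] [InnerProductSpace ℂ H₁]

/-- `K` is differentiable (in operator norm) on `Δ₀ = (a, b)`, and `K'` is the analytic
continuation of its derivative from `Δ₀` to the simply connected domain `D⁻ ⊆ ℂ⁻`, whose boundary
contains `Δ₀`, and to the mirror image `D⁺` of `D⁻`; near finite end points of `Δ₀`, the
continuation satisfies the bound `EndpointBound`. -/
structure IsContinuedDerivative (a b : EReal) (Dm : Set ℂ) (K : ℝ → H₁ →L[ℂ] H₁)
    (K' : ℂ → H₁ →L[ℂ] H₁) : Prop where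
  isOpen : IsOpen Dm
  simplyConnected : IsSimplyConnected Dm
  lower : ∀ z ∈ Dm, z.im < 0
  isOpen_full : IsOpen (fullDomain a b Dm)
  hasDerivAt : ∀ μ ∈ interval a b, HasDerivAt K (K' (μ : ℂ)) μ
  analytic : DifferentiableOn ℂ K' (fullDomain a b Dm)
  bound_left : ∀ e : ℝ, a = (e : EReal) → EndpointBound Dm K' e
  bound_right : ∀ e : ℝ, b = (e : EReal) → EndpointBound Dm K' e

end Continuation

/-! ### Contours -/

/-- Convergence to the end point `e ∈ [-∞, ∞]` of the interval, where both `-∞` and `∞` stand for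
the point at infinity of the Riemann sphere. -/
def endFilter (e : EReal) : Filter ℂ :=
  if e = ⊥ ∨ e = ⊤ then Bornology.cobounded ℂ else 𝓝 ((e.toReal : ℝ) : ℂ)

/-- The parameter square of a deformation; its sides `s = 0` and `s = 1` correspond to the ends
of the curves and do not belong to it. -/
def paramSquare : Set (ℝ × ℝ) := Ioo 0 1 ×ˢ Icc 0 1

/-- `Γ`, parametrized by `γ` on `(0,1)`, originates from a continuous deformation of `(a,b)` with
the end points fixed: there is a homotopy `h (s, t)`, `0 ≤ t ≤ 1`, from a monotone parametrization
`h (·, 0)` of `(a,b)` to `γ = h (·, 1)`, which runs in `D` for `t > 0`, such that `h (s, t)` tends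
to the end points `a` and `b` as `s → 0` and `s → 1`, uniformly in `t`. Near infinity (relevant for
an unbounded interval only), `K'` has at most polynomial growth on the set swept by it. -/
def IsDeformation {V : Type*} [Norm V] (a b : EReal) (D : Set ℂ) (K' : ℂ → V) (γ : ℝ → ℂ) :
    Prop :=
  ∃ h : ℝ × ℝ → ℂ,
    ContinuousOn h paramSquare ∧
    (∃ x : ℝ → ℝ, StrictMonoOn x (Ioo 0 1) ∧
      ∀ s ∈ Ioo (0 : ℝ) 1, x s ∈ interval a b ∧ h (s, 0) = (x s : ℂ)) ∧
    (∀ s ∈ Ioo (0 : ℝ) 1, h (s, 1) = γ s) ∧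
    (∀ s ∈ Ioo (0 : ℝ) 1, ∀ t ∈ Ioc (0 : ℝ) 1, h (s, t) ∈ D) ∧
    Tendsto h (𝓝[>] 0 ×ˢ 𝓟 (Icc 0 1)) (endFilter a) ∧
    Tendsto h (𝓝[<] 1 ×ˢ 𝓟 (Icc 0 1)) (endFilter b) ∧
    ∃ (R C : ℝ) (N : ℕ), ∀ p ∈ paramSquare, R ≤ ‖h p‖ → ‖K' (h p)‖ ≤ C * ‖h p‖ ^ N

section Contour

variable {H₁ : Type*} [NormedAddCommGroup H₁] [InnerProductSpace ℂ H₁]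

/-- The variation `𝒱₀(B, Γ) = ∫_Γ |dμ| ‖K'(μ)‖` along the curve parametrized by `γ` on `(0,1)`. -/
def variation (K' : ℂ → H₁ →L[ℂ] H₁) (γ : ℝ → ℂ) : ℝ :=
  ∫ s in Ioo (0 : ℝ) 1, ‖deriv γ s‖ * ‖K' (γ s)‖

/-- Admissible contours in `D = D^l`: rectifiable Jordan curves in `D` (parametrized on `(0,1)`, the
end points not being part of the curve) that originate from a continuous deformation of `(a,b)` and
along which `K` has finite variation. Every rectifiable curve has a locally Lipschitz
parametrization. If the curve is unbounded, rectifiability means that its part in each ball has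
finite length. -/
structure IsAdmissible (a b : EReal) (D : Set ℂ) (K' : ℂ → H₁ →L[ℂ] H₁) (γ : ℝ → ℂ) : Prop where
  locallyLipschitz : LocallyLipschitzOn (Ioo 0 1) γ
  injOn : InjOn γ (Ioo 0 1)
  mapsTo : MapsTo γ (Ioo 0 1) D
  rectifiable : ∀ R : ℝ, IntegrableOn (fun s => ‖deriv γ s‖) (Ioo 0 1 ∩ {s | ‖γ s‖ < R})
  deformation : IsDeformation a b D K' γ
  finite_variation : IntegrableOn (fun s => ‖deriv γ s‖ * ‖K' (γ s)‖) (Ioo 0 1)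

/-- `d(Γ) = dist(σ(A₁), Γ)`. -/
def contourDist (A₁ : H₁ →L[ℂ] H₁) (γ : ℝ → ℂ) : ℝ :=
  sInf (image2 dist (spectrum ℂ A₁) (γ '' Ioo 0 1))

/-- `r_min(Γ) = d/2 - √(d²/4 - 𝒱₀)`. -/
def rMin (A₁ : H₁ →L[ℂ] H₁) (K' : ℂ → H₁ →L[ℂ] H₁) (γ : ℝ → ℂ) : ℝ :=
  contourDist A₁ γ / 2 - Real.sqrt (contourDist A₁ γ ^ 2 / 4 - variation K' γ)

/-- `r_max(Γ) = d - √𝒱₀`. -/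
def rMax (A₁ : H₁ →L[ℂ] H₁) (K' : ℂ → H₁ →L[ℂ] H₁) (γ : ℝ → ℂ) : ℝ :=
  contourDist A₁ γ - Real.sqrt (variation K' γ)

/-- `r₀(B)`: the infimum of `r_min(Γ)` over all admissible contours `Γ` in `D = D^l` with
`d(Γ)² - 4 𝒱₀(B, Γ) > 0`. (By reflection in the real axis, it does not depend on `l`.) -/
def rZero (a b : EReal) (D : Set ℂ) (A₁ : H₁ →L[ℂ] H₁) (K' : ℂ → H₁ →L[ℂ] H₁) : ℝ :=
  sInf {r | ∃ γ : ℝ → ℂ, IsAdmissible a b D K' γ ∧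
    0 < contourDist A₁ γ ^ 2 - 4 * variation K' γ ∧ r = rMin A₁ K' γ}

/-- `W₁(Z, Γ) = -∫_Γ dμ K'(μ) (Z - μ)⁻¹`. -/
def transformator (K' : ℂ → H₁ →L[ℂ] H₁) (γ : ℝ → ℂ) (Z : H₁ →L[ℂ] H₁) : H₁ →L[ℂ] H₁ :=
  -∫ s in Ioo (0 : ℝ) 1,
    deriv γ s • (K' (γ s) * Ring.inverse (Z - γ s • (1 : H₁ →L[ℂ] H₁)))

/-- `X` solves the basic equation `X = W₁(A₁ + X, Γ)` and belongs to one of the balls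
`‖X‖ ≤ r`, `r_min(Γ) ≤ r < r_max(Γ)`. -/
def IsBasicSolution (A₁ : H₁ →L[ℂ] H₁) (K' : ℂ → H₁ →L[ℂ] H₁) (γ : ℝ → ℂ)
    (X : H₁ →L[ℂ] H₁) : Prop :=
  (∃ r : ℝ, rMin A₁ K' γ ≤ r ∧ r < rMax A₁ K' γ ∧ ‖X‖ ≤ r) ∧
  Disjoint (spectrum ℂ (A₁ + X)) (γ '' Ioo 0 1) ∧
  X = transformator K' γ (A₁ + X)

end Contour

end

end BlockOp

/-! Suppose that Z = A₁ + X has a real eigenvalue t with eigenvector x. Since X = Z - A₁, the form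
⟨x, Xx⟩ is real. On the other hand the resolvent of Z acts on x as (t - μ)⁻¹, so the basic equation
turns -⟨x, Xx⟩ into the scalar Cauchy integral of ⟨x, K'(μ)x⟩ (t - μ)⁻¹ along Γ. Approach t by
points on the side of the real axis opposite to Γ. For these the contour can be moved onto Δ₀, where
the imaginary part becomes a Poisson integral of the nonnegative density ⟨x, K'x⟩; it stays away
from zero in the limit if the density is positive at t (`sign_mul_im_integral_pos`). This is a
contradiction.

Positivity is assumed only within r₀ of the spectrum of A₁. The spectrum of Z lies within ‖X‖ of it,
so ‖X‖ ≤ r₀ is needed, that is, ‖X‖ ≤ r_min(Γ') for every competing contour Γ' (`norm_le_rZero`).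
This follows because the equation has the same solution for all contours: the contour integrals of
A₁ + Y agree for small Y by an identity theorem in an auxiliary parameter (`resolventIntegral_eq`),
and Banach's fixed point theorem supplies existence and uniqueness.

Both arguments rest on Cauchy's theorem between Γ and Δ₀ (`IsAdmissible.integral_eq`). The
deformation is merely continuous and its ends are singular or infinite, so it is cut off near each
end along a continuum that it maps into a half circle of radius ρ (`exists_crossing`,
`norm_sub_le_of_circle`). The change of a primitive there is at most πρ times the bound of the
integrand. At a finite end this tends to zero because the endpoint exponent exceeds -1; at infinity
a mollifier enforces it and is removed afterwards by dominated convergence. -/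

namespace BlockOp

/-! ### Primitives of holomorphic functions along continuous maps of a rectangle -/

section Primitives

open Metric

theorem primitive_sub_eq_sub {g G₁ G₂ : ℂ → ℂ} {S : Set ℂ} (hS : IsOpen S) (hS' : Convex ℝ S)
    (h₁ : ∀ w ∈ S, HasDerivAt G₁ (g w) w) (h₂ : ∀ w ∈ S, HasDerivAt G₂ (g w) w)
    {u v : ℂ} (hu : u ∈ S) (hv : v ∈ S) : G₁ v - G₁ u = G₂ v - G₂ u := by
  have key : (fun w => G₁ w - G₂ w) v = (fun w => G₁ w - G₂ w) u := by
    refine hS.is_const_of_deriv_eq_zero hS'.isPreconnected (f := fun w => G₁ w - G₂ w)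
      (fun w hw => ((h₁ w hw).sub (h₂ w hw)).differentiableAt.differentiableWithinAt) ?_ hv hu
    intro w hw
    have := ((h₁ w hw).sub (h₂ w hw)).deriv
    rw [sub_self] at this
    exact this
  linear_combination key

/-- `Φ` is a primitive on `Q` of the pullback of the form `g dz` by `h`. -/
def IsPrimitiveAlong (g : ℂ → ℂ) (h : ℝ × ℝ → ℂ) (Q : Set (ℝ × ℝ)) (Φ : ℝ × ℝ → ℂ) : Prop :=
  ∀ p ∈ Q, ∃ G : ℂ → ℂ, ∃ r > 0, (∀ w ∈ ball (h p) r, HasDerivAt G (g w) w) ∧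
    ∀ᶠ q in 𝓝[Q] p, Φ q - Φ p = G (h q) - G (h p)

/-- Compactness gives balls of one radius around all points of the image, each carrying a primitive.
Their increments `e p q` satisfy a cocycle identity for nearby points, so they can be summed along
the segment from a base point to p. Convexity of Q plays the role of simple connectedness. -/
theorem exists_isPrimitiveAlong {g : ℂ → ℂ} {h : ℝ × ℝ → ℂ} {Q : Set (ℝ × ℝ)} {Ω : Set ℂ}
    (hΩ : IsOpen Ω) (hg : DifferentiableOn ℂ g Ω) (hQ : IsCompact Q) (hQc : Convex ℝ Q)
    (hh : ContinuousOn h Q) (hm : MapsTo h Q Ω) : ∃ Φ, IsPrimitiveAlong g h Q Φ := by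
  rcases Q.eq_empty_or_nonempty with rfl | ⟨p₀, hp₀⟩
  · exact ⟨0, fun p hp => hp.elim⟩
  obtain ⟨r, hr, hrΩ⟩ := (hQ.image_of_continuousOn hh).exists_thickening_subset_open hΩ
    hm.image_subset
  have hball : ∀ p ∈ Q, ball (h p) r ⊆ Ω := fun p hp =>
    (ball_subset_thickening (mem_image_of_mem h hp) r).trans hrΩ
  have hG : ∀ p, ∃ G : ℂ → ℂ, p ∈ Q → ∀ w ∈ ball (h p) r, HasDerivAt G (g w) w := by
    intro p
    by_cases hp : p ∈ Q
    · obtain ⟨G, hG⟩ := (hg.mono (hball p hp)).isExactOn_ball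
      exact ⟨G, fun _ => hG⟩
    · exact ⟨0, fun h => (hp h).elim⟩
  choose G hG using hG
  obtain ⟨δ, hδ, hδr⟩ := Metric.uniformContinuousOn_iff.1
    (hQ.uniformContinuousOn_of_continuous hh) r hr
  set e : ℝ × ℝ → ℝ × ℝ → ℂ := fun p q => G p (h q) - G p (h p) with he
  have cocycle : ∀ p ∈ Q, ∀ q ∈ Q, ∀ w ∈ Q, dist p q < δ → dist p w < δ → dist q w < δ →
      e p q + e q w = e p w := by
    intro p hp q hq w hw hpq hpw hqw
    have := primitive_sub_eq_sub (isOpen_ball.inter isOpen_ball)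
      ((convex_ball (h p) r).inter (convex_ball (h q) r))
      (fun z hz => hG p hp z hz.1) (fun z hz => hG q hq z hz.2)
      (u := h q) (v := h w)
      ⟨by rw [mem_ball, dist_comm]; exact hδr p hp q hq hpq, mem_ball_self hr⟩
      ⟨by rw [mem_ball, dist_comm]; exact hδr p hp w hw hpw,
       by rw [mem_ball, dist_comm]; exact hδr q hq w hw hqw⟩
    simp only [he]
    linear_combination -this
  obtain ⟨D, hD⟩ := hQ.isBounded.subset_closedBall p₀
  obtain ⟨n, hn⟩ := exists_nat_gt (D / (δ / 2))
  -- So many subdivisions that each step of a segment is shorter than δ/2; then the diagonals of the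
  -- cells between two neighbouring segments stay below δ, as `cocycle` requires.
  set N : ℕ := n + 1 with hN
  have hN0 : (0 : ℝ) < N := by positivity
  have hDN : D / N < δ / 2 := by
    rw [div_lt_iff₀ (by positivity)] at hn ⊢
    have : (N : ℝ) = n + 1 := by simp [hN]
    rw [this]
    nlinarith
  set m : ℝ × ℝ → ℕ → ℝ × ℝ := fun p k => p₀ + ((k : ℝ) / N) • (p - p₀) with hmdef
  have hmQ : ∀ p ∈ Q, ∀ k ≤ N, m p k ∈ Q := by
    intro p hp k hk
    refine hQc.add_smul_sub_mem hp₀ hp ⟨by positivity, ?_⟩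
    rw [div_le_one hN0]
    exact_mod_cast hk
  have hm1 : ∀ p ∈ Q, ∀ k, dist (m p k) (m p (k + 1)) < δ / 2 := by
    intro p hp k
    refine lt_of_le_of_lt ?_ hDN
    have h1 : m p k - m p (k + 1) = -((1 / (N : ℝ)) • (p - p₀)) := by
      simp only [hmdef]
      rw [add_sub_add_left_eq_sub, ← sub_smul, ← neg_smul]
      congr 1
      push_cast
      field_simp
      ring
    have h2 : ‖p - p₀‖ ≤ D := by simpa [dist_eq_norm] using hD hp
    rw [dist_eq_norm, h1, norm_neg, norm_smul, Real.norm_of_nonneg (by positivity), one_div,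
      div_eq_inv_mul]
    gcongr
  have hm2 : ∀ p q, ∀ k ≤ N, dist (m p k) (m q k) ≤ dist p q := by
    intro p q k hk
    have h1 : m p k - m q k = ((k : ℝ) / N) • (p - q) := by
      simp only [hmdef]
      rw [add_sub_add_left_eq_sub, ← smul_sub]
      congr 1
      abel
    rw [dist_eq_norm, h1, norm_smul, Real.norm_of_nonneg (by positivity), dist_eq_norm]
    refine mul_le_of_le_one_left (norm_nonneg _) ?_
    rw [div_le_one hN0]
    exact_mod_cast hk
  have hm0 : ∀ p, m p 0 = p₀ := by intro p; simp [hmdef]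
  have hmN : ∀ p, m p N = p := by
    intro p
    simp only [hmdef]
    rw [div_self hN0.ne']
    simp
  set Φ : ℝ × ℝ → ℂ := fun p => ∑ k ∈ Finset.range N, e (m p k) (m p (k + 1)) with hΦ
  have main : ∀ p ∈ Q, ∀ q ∈ Q, dist p q < δ / 2 → Φ q - Φ p = e p q := by
    intro p hp q hq hpq
    -- Ladder argument: each cell between the two chains is split into two triangles by a diagonal,
    -- and the cocycle identity on both moves the discrepancy from one rung to the next.
    have aux : ∀ n ≤ N, ∑ k ∈ Finset.range n, e (m q k) (m q (k + 1)) -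
        ∑ k ∈ Finset.range n, e (m p k) (m p (k + 1)) = e (m p n) (m q n) := by
      intro n
      induction n with
      | zero => intro _; simp [hm0, he]
      | succ n ih =>
        intro hn
        have hn' : n ≤ N := by omega
        rw [Finset.sum_range_succ, Finset.sum_range_succ]
        have d1 := hm1 p hp n
        have d2 := hm1 q hq n
        have d3 := lt_of_le_of_lt (hm2 p q n hn') hpq
        have d4 := lt_of_le_of_lt (hm2 p q (n + 1) hn) hpq
        have d5 : dist (m p n) (m q (n + 1)) < δ :=
          lt_of_le_of_lt (dist_triangle _ (m q n) _) (by linarith)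
        have c1 := cocycle _ (hmQ p hp n hn') _ (hmQ q hq n hn') _ (hmQ q hq (n + 1) hn)
          (by linarith) d5 (by linarith)
        have c2 := cocycle _ (hmQ p hp n hn') _ (hmQ p hp (n + 1) hn) _ (hmQ q hq (n + 1) hn)
          (by linarith) d5 (by linarith)
        linear_combination ih hn' + c1 - c2
    have := aux N le_rfl
    rwa [hmN, hmN] at this
  refine ⟨Φ, fun p hp => ⟨G p, r, hr, hG p hp, ?_⟩⟩
  have : ball p (δ / 2) ∈ 𝓝 p := ball_mem_nhds _ (by positivity)
  filter_upwards [self_mem_nhdsWithin, mem_nhdsWithin_of_mem_nhds this] with q hq hq'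
  exact main p hp q hq (by rwa [mem_ball, dist_comm] at hq')

/-- Φ - P is locally constant on the preconnected set C. The condition on P ranges over all local
primitives, so the one attached to Φ at a point can be inserted. -/
theorem IsPrimitiveAlong.sub_eq {g : ℂ → ℂ} {h : ℝ × ℝ → ℂ} {Q C : Set (ℝ × ℝ)}
    {Φ P : ℝ × ℝ → ℂ} (hΦ : IsPrimitiveAlong g h Q Φ) (hC : IsPreconnected C) (hCQ : C ⊆ Q)
    (hP : ∀ p ∈ C, ∀ (G : ℂ → ℂ) (r : ℝ), 0 < r → (∀ w ∈ ball (h p) r, HasDerivAt G (g w) w) →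
      ∀ᶠ q in 𝓝[C] p, P q - P p = G (h q) - G (h p))
    {p₁ p₂ : ℝ × ℝ} (h₁ : p₁ ∈ C) (h₂ : p₂ ∈ C) : Φ p₂ - Φ p₁ = P p₂ - P p₁ := by
  have hlc : IsLocallyConstant (fun p : C => Φ p - P p) := by
    rw [IsLocallyConstant.iff_eventually_eq]
    intro p
    obtain ⟨G, r, hr, hG, hΦp⟩ := hΦ p (hCQ p.2)
    have h3 := hP p p.2 G r hr hG
    have h4 := h3.and (hΦp.filter_mono (nhdsWithin_mono _ hCQ))
    rw [nhdsWithin_eq_map_subtype_coe p.2, eventually_map] at h4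
    filter_upwards [h4] with q hq
    linear_combination hq.2 - hq.1
  have : PreconnectedSpace C := isPreconnected_iff_preconnectedSpace.1 hC
  have := hlc.apply_eq_of_preconnectedSpace ⟨p₁, h₁⟩ ⟨p₂, h₂⟩
  simp only at this
  linear_combination -this

end Primitives

/-! ### Poincaré–Miranda in the plane and crossing continua -/

section PoincareMiranda

open Metric Complex

/-- A quarter turn that stays in the right half plane does not meet the branch cut. This is the
contribution of one corner to the winding number. -/
theorem log_I_mul_sub_log {w : ℂ} (h₁ : 0 < w.re) (h₂ : 0 < (I * w).re) :
    log (I * w) - log w = (Real.pi / 2 : ℝ) * I := by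
  have hw : w ≠ 0 := by rintro rfl; simp at h₁
  have hw' : arg w ∈ Ioo (-(Real.pi / 2)) (Real.pi / 2) := by
    have := abs_arg_lt_pi_div_two_iff.2 (Or.inl h₁)
    exact abs_lt.1 this
  have hI := arg_I
  rw [log_mul_eq_add_log_iff I_ne_zero hw |>.2, log_I]
  · push_cast; ring
  · rw [hI]
    constructor <;> linarith [hw'.1, hw'.2, Real.pi_pos]

theorem IsPrimitiveAlong.sub_eq_log {F : ℝ × ℝ → ℂ} {Q C : Set (ℝ × ℝ)}
    {Φ : ℝ × ℝ → ℂ} (hΦ : IsPrimitiveAlong (fun w => w⁻¹) F Q Φ) (hF : ContinuousOn F Q)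
    (hC : IsPreconnected C) (hCQ : C ⊆ Q) (u : ℂ) (hu : ∀ p ∈ C, 0 < (u * F p).re)
    {p₁ p₂ : ℝ × ℝ} (h₁ : p₁ ∈ C) (h₂ : p₂ ∈ C) :
    Φ p₂ - Φ p₁ = log (u * F p₂) - log (u * F p₁) := by
  refine hΦ.sub_eq (P := fun p => log (u * F p)) hC hCQ ?_ h₁ h₂
  intro p hp G r hr hG
  have hu0 : u ≠ 0 := by rintro rfl; simpa using hu p hp
  have hopen : IsOpen {w : ℂ | 0 < (u * w).re} :=
    isOpen_lt continuous_const (by fun_prop)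
  have hconv : Convex ℝ {w : ℂ | 0 < (u * w).re} := by
    intro x hx y hy a b ha hb hab
    simp only [mem_ofPred_eq, real_smul] at *
    have : (u * (a * x + b * y)).re = a * (u * x).re + b * (u * y).re := by
      simp; ring
    rw [this]
    rcases ha.eq_or_lt with rfl | ha
    · have : b = 1 := by linarith
      subst this; linarith
    · nlinarith [mul_pos ha hx, mul_nonneg hb hy.le]
  have hd : ∀ w ∈ {w : ℂ | 0 < (u * w).re}, HasDerivAt (fun w => log (u * w)) w⁻¹ w := by
    intro w hw
    have hw0 : w ≠ 0 := by rintro rfl; simp at hw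
    have h1 := ((hasDerivAt_id w).const_mul u).clog (Or.inl hw)
    have h2 : u * 1 / (u * id w) = w⁻¹ := by
      rw [id, mul_one, div_eq_mul_inv, mul_inv, ← mul_assoc, mul_inv_cancel₀ hu0, one_mul]
    rw [h2] at h1
    exact h1
  have hFp : ∀ᶠ q in 𝓝[C] p, F q ∈ ball (F p) r ∩ {w : ℂ | 0 < (u * w).re} :=
    ((hF p (hCQ hp)).mono hCQ).eventually ((isOpen_ball.inter hopen).mem_nhds
      ⟨mem_ball_self hr, hu p hp⟩)
  filter_upwards [hFp] with q hq
  exact primitive_sub_eq_sub (isOpen_ball.inter hopen) ((convex_ball _ _).inter hconv)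
    (fun w hw => hd w hw.2) (fun w hw => hG w hw.1) ⟨mem_ball_self hr, hu p hp⟩ hq

/-- Without a zero, dw/w has a primitive along F, and its total change around the boundary vanishes.
But the four sides are mapped into the lower, right, upper and left half planes, where the primitive
is a branch of the logarithm obtained by rotating with I, 1, -I, -1. Each change of branch at a
corner contributes iπ/2, so the total is 2πi up to sign. -/
theorem poincare_miranda {α β : ℝ} (hαβ : α ≤ β) {F : ℝ × ℝ → ℂ}
    (hF : ContinuousOn F (Icc α β ×ˢ Icc 0 1))
    (hl : ∀ t ∈ Icc (0 : ℝ) 1, (F (α, t)).re < 0) (hr : ∀ t ∈ Icc (0 : ℝ) 1, 0 < (F (β, t)).re)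
    (hb : ∀ s ∈ Icc α β, (F (s, 0)).im < 0) (ht : ∀ s ∈ Icc α β, 0 < (F (s, 1)).im) :
    ∃ p ∈ Icc α β ×ˢ Icc (0 : ℝ) 1, F p = 0 := by
  by_contra! hne
  obtain ⟨Φ, hΦ⟩ := exists_isPrimitiveAlong (g := fun w => w⁻¹) (h := F)
    (Q := Icc α β ×ˢ Icc (0 : ℝ) 1) (Ω := {0}ᶜ) isOpen_compl_singleton
    (fun w hw => (differentiableAt_inv hw).differentiableWithinAt)
    (isCompact_Icc.prod isCompact_Icc) ((convex_Icc _ _).prod (convex_Icc _ _)) hF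
    (fun p hp => hne p hp)
  have h0 : (0 : ℝ) ∈ Icc (0 : ℝ) 1 := by simp
  have h1 : (1 : ℝ) ∈ Icc (0 : ℝ) 1 := by simp
  have hα : α ∈ Icc α β := ⟨le_rfl, hαβ⟩
  have hβ : β ∈ Icc α β := ⟨hαβ, le_rfl⟩
  have e1 := hΦ.sub_eq_log hF (C := Icc α β ×ˢ {0})
    (isPreconnected_Icc.prod isPreconnected_singleton)
    (prod_mono le_rfl (by simp)) I
    (by rintro ⟨s, t⟩ ⟨hs, rfl⟩; simpa using hb s hs) (p₁ := (α, 0)) (p₂ := (β, 0))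
    ⟨hα, rfl⟩ ⟨hβ, rfl⟩
  have e2 := hΦ.sub_eq_log hF (C := {β} ×ˢ Icc 0 1)
    (isPreconnected_singleton.prod isPreconnected_Icc)
    (prod_mono (by simpa using hαβ) le_rfl) 1
    (by rintro ⟨s, t⟩ ⟨rfl, hs⟩; simpa using hr t hs) (p₁ := (β, 0)) (p₂ := (β, 1))
    ⟨rfl, h0⟩ ⟨rfl, h1⟩
  have e3 := hΦ.sub_eq_log hF (C := Icc α β ×ˢ {1})
    (isPreconnected_Icc.prod isPreconnected_singleton)
    (prod_mono le_rfl (by simp)) (-I)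
    (by rintro ⟨s, t⟩ ⟨hs, rfl⟩; simpa using ht s hs) (p₁ := (β, 1)) (p₂ := (α, 1))
    ⟨hβ, rfl⟩ ⟨hα, rfl⟩
  have e4 := hΦ.sub_eq_log hF (C := {α} ×ˢ Icc 0 1)
    (isPreconnected_singleton.prod isPreconnected_Icc)
    (prod_mono (by simpa using hαβ) le_rfl) (-1)
    (by rintro ⟨s, t⟩ ⟨rfl, hs⟩; simpa using hl t hs) (p₁ := (α, 1)) (p₂ := (α, 0))
    ⟨rfl, h1⟩ ⟨rfl, h0⟩
  have hb1 := hb α hα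
  have hb2 := hb β hβ
  have ht1 := ht α hα
  have ht2 := ht β hβ
  have hl0 := hl 0 h0
  have hl1 := hl 1 h1
  have hr0 := hr 0 h0
  have hr1 := hr 1 h1
  have l1 := log_I_mul_sub_log (w := F (β, 0)) hr0 (by simpa using hb2)
  have l2 := log_I_mul_sub_log (w := -I * F (β, 1)) (by simpa using ht2)
    (by rw [← mul_assoc]; simpa using hr1)
  have l3 := log_I_mul_sub_log (w := -1 * F (α, 1)) (by simpa using hl1)
    (by simpa using ht1)
  have l4 := log_I_mul_sub_log (w := I * F (α, 0)) (by simpa using hb1)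
    (by rw [← mul_assoc]; simpa using hl0)
  have x2 : I * (-I * F (β, 1)) = 1 * F (β, 1) := by linear_combination -F (β, 1) * I_mul_I
  have x3 : I * (-1 * F (α, 1)) = -I * F (α, 1) := by ring
  have x4 : I * (I * F (α, 0)) = -1 * F (α, 0) := by linear_combination F (α, 0) * I_mul_I
  rw [x2] at l2
  rw [x3] at l3
  rw [x4] at l4
  rw [one_mul] at l2
  rw [one_mul, one_mul] at e2
  have : (4 : ℂ) * ((Real.pi / 2 : ℝ) * I) = 0 := by
    linear_combination -(l1 + l2 + l3 + l4 + e1 + e2 + e3 + e4)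
  simp [Real.pi_ne_zero] at this

/-- In a compact Hausdorff space a component is the intersection of its clopen neighbourhoods.
Compactness of B separates a single point of A from B, and compactness of A then finishes. -/
theorem exists_isClopen_separating {Y : Type*} [TopologicalSpace Y] [CompactSpace Y] [T2Space Y]
    {A B : Set Y} (hA : IsClosed A) (hB : IsClosed B)
    (h : ∀ a ∈ A, ∀ b ∈ B, b ∉ connectedComponent a) :
    ∃ U : Set Y, IsClopen U ∧ A ⊆ U ∧ Disjoint U B := by
  have step : ∀ a ∈ A, ∃ U : Set Y, IsClopen U ∧ a ∈ U ∧ Disjoint U B := by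
    intro a ha
    have hemp : B ∩ ⋂ s : { s : Set Y // IsClopen s ∧ a ∈ s }, (s : Set Y) = ∅ := by
      rw [← connectedComponent_eq_iInter_isClopen]
      ext b
      simpa using fun hb => h a ha b hb
    obtain ⟨u, hu⟩ := hB.isCompact.elim_finite_subfamily_closed _ (fun s => s.2.1.1) hemp
    refine ⟨⋂ i ∈ u, (i : Set Y), isClopen_biInter_finset fun i _ => i.2.1, ?_, ?_⟩
    · simp only [mem_iInter]
      exact fun i _ => i.2.2
    · rw [disjoint_iff_inter_eq_empty, inter_comm]
      exact hu
  choose! U hU haU hUB using step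
  obtain ⟨t, htA, ht⟩ := hA.isCompact.elim_nhds_subcover U
    (fun a ha => (hU a ha).2.mem_nhds (haU a ha))
  refine ⟨⋃ x ∈ t, U x, isClopen_biUnion_finset fun x hx => hU x (htA x hx), ht, ?_⟩
  simp only [disjoint_iUnion_left]
  exact fun x hx => hUB x (htA x hx)

/-- A level set of a function on a rectangle that separates the left from the right side contains
a continuum which joins the bottom and the top. -/
theorem exists_crossing {α β ρ : ℝ} (hαβ : α ≤ β) {u : ℝ × ℝ → ℝ}
    (hu : ContinuousOn u (Icc α β ×ˢ Icc 0 1))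
    (hl : ∀ t ∈ Icc (0 : ℝ) 1, u (α, t) < ρ) (hr : ∀ t ∈ Icc (0 : ℝ) 1, ρ < u (β, t)) :
    ∃ C ⊆ Icc α β ×ˢ Icc (0 : ℝ) 1, IsPreconnected C ∧ (∀ p ∈ C, u p = ρ) ∧
      (∃ s, (s, (0 : ℝ)) ∈ C) ∧ ∃ s, (s, (1 : ℝ)) ∈ C := by
  set Q := Icc α β ×ˢ Icc (0 : ℝ) 1 with hQ
  have hQc : IsCompact Q := isCompact_Icc.prod isCompact_Icc
  set L : Set (ℝ × ℝ) := Q ∩ u ⁻¹' {ρ} with hL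
  have hLc : IsClosed L := hu.preimage_isClosed_of_isClosed hQc.isClosed isClosed_singleton
  have hLk : IsCompact L := hQc.of_isClosed_subset hLc inter_subset_left
  have : CompactSpace L := isCompact_iff_compactSpace.1 hLk
  by_contra! hcon
  -- If no component of the level set joins bottom and top, the level set splits into a clopen part
  -- containing its bottom points and a complementary part containing its top points.
  obtain ⟨U, hU, hAU, hUB⟩ := exists_isClopen_separating (Y := L)
    (A := {p | (p : ℝ × ℝ).2 = 0}) (B := {p | (p : ℝ × ℝ).2 = 1})
    (isClosed_eq (by fun_prop) continuous_const) (isClosed_eq (by fun_prop) continuous_const) (by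
      rintro ⟨⟨s, t⟩, ha⟩ (rfl : t = 0) ⟨⟨s', t'⟩, hb⟩ (rfl : t' = 1) hmem
      refine hcon (Subtype.val '' connectedComponent (⟨(s, 0), ha⟩ : L)) ?_
        (isPreconnected_connectedComponent.image _ continuous_subtype_val.continuousOn) ?_
        ⟨s, _, mem_connectedComponent, rfl⟩ s' ⟨_, hmem, rfl⟩
      · rintro _ ⟨p, -, rfl⟩
        exact p.2.1
      · rintro _ ⟨p, -, rfl⟩
        exact p.2.2)
  have hc1 : IsClosed ((Subtype.val '' U : Set (ℝ × ℝ)) ∪ {p | p.2 = 0}) :=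
    (hLc.isClosedMap_subtype_val _ hU.1).union
      (isClosed_eq continuous_snd continuous_const)
  have hc2 : IsClosed ((Subtype.val '' Uᶜ : Set (ℝ × ℝ)) ∪ {p | p.2 = 1}) :=
    (hLc.isClosedMap_subtype_val _ hU.compl.1).union
      (isClosed_eq continuous_snd continuous_const)
  have hdisj : Disjoint ((Subtype.val '' U : Set (ℝ × ℝ)) ∪ {p | p.2 = 0})
      ((Subtype.val '' Uᶜ : Set (ℝ × ℝ)) ∪ {p | p.2 = 1}) := by
    rw [Set.disjoint_left]
    rintro p (⟨x, hx, rfl⟩ | hp) (⟨y, hy, hxy⟩ | hp')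
    · rw [Subtype.val_inj] at hxy
      exact hy (hxy ▸ hx)
    · exact Set.disjoint_left.1 hUB hx hp'
    · subst hxy
      exact hy (hAU hp)
    · simp only [mem_ofPred_eq] at hp hp'
      rw [hp] at hp'
      exact zero_ne_one hp'
  obtain ⟨f, hf0, hf1, -⟩ := exists_continuous_zero_one_of_isClosed hc1 hc2 hdisj
  -- A zero of the real part lies on the level set, where the Urysohn function f is 0 or 1, so the
  -- imaginary part is ±1/2 there.
  obtain ⟨p, hpQ, hp⟩ := poincare_miranda hαβ
    (F := fun p => ((u p - ρ : ℝ) : ℂ) + ((f p - 1 / 2 : ℝ) : ℂ) * I)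
    (by
      refine ContinuousOn.add ?_ ?_
      · exact Complex.continuous_ofReal.comp_continuousOn (hu.sub continuousOn_const)
      · have : Continuous fun p : ℝ × ℝ => ((f p - 1 / 2 : ℝ) : ℂ) * I := by fun_prop
        exact this.continuousOn)
    (fun t ht => by simpa using hl t ht) (fun t ht => by simpa using hr t ht)
    (fun s hs => by
      have : f (s, 0) = 0 := hf0 (Or.inr rfl)
      simp [this])
    (fun s hs => by
      have : f (s, 1) = 1 := hf1 (Or.inr rfl)
      simp [this]; norm_num)
  have hre := congrArg Complex.re hp
  have him := congrArg Complex.im hp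
  simp only [add_re, ofReal_re, mul_re, I_re, mul_zero, ofReal_im, I_im, mul_one, sub_self,
    add_zero, zero_re, add_im, mul_im, zero_add, zero_im] at hre him
  have hpL : p ∈ L := ⟨hpQ, by simpa using sub_eq_zero.1 hre⟩
  by_cases hpU : (⟨p, hpL⟩ : L) ∈ U
  · have : f p = 0 := hf0 (Or.inl ⟨_, hpU, rfl⟩)
    rw [this] at him; norm_num at him
  · have : f p = 1 := hf1 (Or.inl ⟨_, hpU, rfl⟩)
    rw [this] at him; norm_num at him

end PoincareMiranda

/-! ### Increments of primitives along arcs and along Lipschitz curves -/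

section Arcs

open Metric

theorem IsPreconnected.uIcc_subset_image {X : Type*} [TopologicalSpace X] {C : Set X} {θ : X → ℝ}
    (hC : IsPreconnected C) (hθ : ContinuousOn θ C) {p₁ p₂ : X} (h₁ : p₁ ∈ C) (h₂ : p₂ ∈ C) :
    uIcc (θ p₁) (θ p₂) ⊆ θ '' C :=
  (hC.image θ hθ).ordConnected.uIcc_subset (mem_image_of_mem θ h₁) (mem_image_of_mem θ h₂)

/-- C may be a wild continuum, but if h factors on it through an arc, only the values of the arc
parameter at the two points matter: both sides are primitives along C. The image of C under the
parameter covers the interval of integration, so the integrand is continuous there. -/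
theorem IsPrimitiveAlong.sub_eq_integral {g : ℂ → ℂ} {h : ℝ × ℝ → ℂ} {Q C : Set (ℝ × ℝ)}
    {Φ : ℝ × ℝ → ℂ} (hΦ : IsPrimitiveAlong g h Q Φ) (hC : IsPreconnected C) (hCQ : C ⊆ Q)
    {θ : ℝ × ℝ → ℝ} (hθ : ContinuousOn θ C) {arc arc' : ℝ → ℂ}
    (harc : ∀ τ, HasDerivAt arc (arc' τ) τ) (harc' : Continuous arc')
    (heq : ∀ p ∈ C, h p = arc (θ p)) (hg : ContinuousOn g (h '' C))
    {p₁ p₂ : ℝ × ℝ} (h₁ : p₁ ∈ C) (h₂ : p₂ ∈ C) :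
    Φ p₂ - Φ p₁ = ∫ τ in θ p₁..θ p₂, arc' τ * g (arc τ) := by
  have hac : Continuous arc := continuous_iff_continuousAt.2 fun τ => (harc τ).continuousAt
  have hcont : ContinuousOn (fun τ => arc' τ * g (arc τ)) (θ '' C) := by
    refine harc'.continuousOn.mul (hg.comp hac.continuousOn ?_)
    rintro _ ⟨p, hp, rfl⟩
    rw [← heq p hp]
    exact mem_image_of_mem h hp
  have hint : ∀ p ∈ C, ∀ q ∈ C,
      IntervalIntegrable (fun τ => arc' τ * g (arc τ)) volume (θ p) (θ q) := fun p hp q hq =>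
    (hcont.mono (IsPreconnected.uIcc_subset_image hC hθ hp hq)).intervalIntegrable
  have := hΦ.sub_eq (P := fun p => ∫ τ in θ p₁..θ p, arc' τ * g (arc τ)) hC hCQ ?_ h₁ h₂
  · rw [this]
    simp
  intro p hp G r hr hG
  have hnear : ∀ᶠ τ in 𝓝 (θ p), arc τ ∈ ball (h p) r := by
    rw [heq p hp]
    exact hac.continuousAt.eventually (ball_mem_nhds _ hr)
  obtain ⟨δ, hδ, hball⟩ := Metric.eventually_nhds_iff_ball.1 hnear
  filter_upwards [self_mem_nhdsWithin, (hθ p hp).eventually (ball_mem_nhds (θ p) hδ)] with q hq hqδ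
  rw [intervalIntegral.integral_interval_sub_left (hint _ h₁ _ hq) (hint _ h₁ _ hp),
    heq q hq, heq p hp]
  refine intervalIntegral.integral_eq_sub_of_hasDerivAt (f := fun τ => G (arc τ)) ?_
    (hint p hp q hq)
  intro τ hτ
  have hτb : τ ∈ ball (θ p) δ :=
    (convex_ball (θ p) δ).ordConnected.uIcc_subset (mem_ball_self hδ) hqδ hτ
  exact (hG _ (hball τ hτb)).scomp τ (harc τ)

/-- On a half circle with real centre the angle is the continuous function arccos(Re(h - c)/ρ), with
values in [0, π]. Hence C counts at most as one arc of length πρ, however often it runs back and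
forth. -/
theorem norm_sub_le_of_circle {g : ℂ → ℂ} {h : ℝ × ℝ → ℂ} {Q C : Set (ℝ × ℝ)}
    {Φ : ℝ × ℝ → ℂ} (hΦ : IsPrimitiveAlong g h Q Φ) (hh : ContinuousOn h Q)
    (hC : IsPreconnected C) (hCQ : C ⊆ Q) (hg : ContinuousOn g (h '' C))
    {c ρ B σ : ℝ} (hσ : σ * σ = 1) (hρ : 0 < ρ) (hcirc : ∀ p ∈ C, ‖h p - c‖ = ρ)
    (hB : ∀ p ∈ C, ‖g (h p)‖ ≤ B) (him : ∀ p ∈ C, 0 ≤ σ * (h p).im)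
    {p₁ p₂ : ℝ × ℝ} (h₁ : p₁ ∈ C) (h₂ : p₂ ∈ C) :
    ‖Φ p₂ - Φ p₁‖ ≤ Real.pi * (B * ρ) := by
  set θ : ℝ × ℝ → ℝ := fun p => Real.arccos ((h p - c).re / ρ) with hθdef
  set arc : ℝ → ℂ := fun τ => c + ρ * Complex.exp (σ * τ * Complex.I) with harcdef
  have hθ : ContinuousOn θ C := by
    refine Real.continuous_arccos.comp_continuousOn ?_
    exact (Complex.continuous_re.comp_continuousOn
      ((hh.mono hCQ).sub continuousOn_const)).div_const _
  have harc : ∀ τ : ℝ, HasDerivAt arc (ρ * (Complex.exp (σ * τ * Complex.I) * (σ * Complex.I))) τ := by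
    intro τ
    have h1 : HasDerivAt (fun τ : ℝ => (σ : ℂ) * τ * Complex.I) (σ * Complex.I) τ := by
      have := ((HasDerivAt.ofReal_comp (hasDerivAt_id τ)).const_mul (σ : ℂ)).mul_const Complex.I
      simpa using this
    exact (h1.cexp.const_mul (ρ : ℂ)).const_add (c : ℂ)
  have heq : ∀ p ∈ C, h p = arc (θ p) := by
    intro p hp
    have hn : (h p - c).re ^ 2 + (h p - c).im ^ 2 = ρ ^ 2 := by
      rw [← hcirc p hp, ← Complex.normSq_eq_norm_sq, Complex.normSq_apply]
      ring
    have hre : |(h p - c).re / ρ| ≤ 1 := by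
      rw [abs_div, abs_of_pos hρ, div_le_one hρ, ← hcirc p hp]
      exact Complex.abs_re_le_norm _
    have hre' := abs_le.1 hre
    have hcos : Real.cos (θ p) = (h p - c).re / ρ := Real.cos_arccos hre'.1 hre'.2
    have hsin : Real.sin (θ p) = σ * (h p).im / ρ := by
      rw [hθdef]
      simp only
      rw [Real.sin_arccos, Real.sqrt_eq_iff_mul_self_eq]
      · have : (h p - c).im = (h p).im := by simp
        rw [this] at hn
        field_simp
        nlinarith
      · have := sq_le_one_iff_abs_le_one _ |>.2 hre
        linarith
      · exact div_nonneg (him p hp) hρ.le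
    have hexp : Complex.exp (σ * θ p * Complex.I) =
        ((h p - c).re / ρ : ℝ) + ((h p).im / ρ : ℝ) * Complex.I := by
      rw [Complex.exp_mul_I, ← Complex.ofReal_mul, ← Complex.ofReal_cos, ← Complex.ofReal_sin]
      have hs : σ = 1 ∨ σ = -1 := mul_self_eq_one_iff.1 hσ
      rcases hs with rfl | rfl
      · rw [one_mul, hcos, hsin, one_mul]
      · rw [neg_one_mul, Real.cos_neg, Real.sin_neg, hcos, hsin]
        congr 3
        ring
    rw [harcdef]
    simp only
    rw [hexp]
    have hρ' : (ρ : ℂ) ≠ 0 := by exact_mod_cast hρ.ne'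
    push_cast
    field_simp
    apply Complex.ext <;> simp
  have key := hΦ.sub_eq_integral hC hCQ hθ harc (by fun_prop) heq hg h₁ h₂
  rw [key]
  have hsub := IsPreconnected.uIcc_subset_image hC hθ h₁ h₂
  have hσ' : |σ| = 1 := by
    rcases mul_self_eq_one_iff.1 hσ with rfl | rfl <;> simp
  have hB0 : 0 ≤ B := (norm_nonneg _).trans (hB p₁ h₁)
  calc _ ≤ (B * ρ) * |θ p₂ - θ p₁| := by
        refine intervalIntegral.norm_integral_le_of_norm_le_const fun τ hτ => ?_
        obtain ⟨p, hp, rfl⟩ := hsub (uIoc_subset_uIcc hτ)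
        rw [← heq p hp, norm_mul, norm_mul, norm_mul, norm_mul]
        have : ‖Complex.exp (σ * θ p * Complex.I)‖ = 1 := by
          rw [← Complex.ofReal_mul]
          exact Complex.norm_exp_ofReal_mul_I _
        rw [this, Complex.norm_I, Complex.norm_real, Complex.norm_real, Real.norm_eq_abs,
          Real.norm_eq_abs, hσ', abs_of_pos hρ]
        have := hB p hp
        nlinarith
    _ ≤ (B * ρ) * Real.pi := by
        gcongr
        rw [abs_le]
        have a1 := Real.arccos_nonneg ((h p₁ - c).re / ρ)
        have a2 := Real.arccos_le_pi ((h p₁ - c).re / ρ)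
        have a3 := Real.arccos_nonneg ((h p₂ - c).re / ρ)
        have a4 := Real.arccos_le_pi ((h p₂ - c).re / ρ)
        constructor <;> simp only [hθdef] <;> linarith
    _ = _ := by ring

/-- Testing with real functionals reduces this to the fundamental theorem for absolutely continuous
real functions. -/
theorem integral_eq_sub_of_lipschitzOnWith {v w : ℝ → ℂ} {p q : ℝ} {K : NNReal}
    (hv : LipschitzOnWith K v (uIcc p q))
    (hd : ∀ᵐ s, s ∈ uIcc p q → HasDerivAt v (w s) s)
    (hw : IntervalIntegrable w volume p q) : ∫ s in p..q, w s = v q - v p := by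
  have key : ∀ L : ℂ →L[ℝ] ℝ, L (∫ s in p..q, w s) = L (v q) - L (v p) := by
    intro L
    have hL : LipschitzOnWith (‖L‖₊ * K) (fun s => L (v s)) (uIcc p q) :=
      L.lipschitz.comp_lipschitzOnWith hv
    rw [← hL.absolutelyContinuousOnInterval.integral_deriv_eq_sub,
      ← ContinuousLinearMap.intervalIntegral_comp_comm L hw]
    refine intervalIntegral.integral_congr_ae ?_
    filter_upwards [hd] with s hs hmem
    exact (L.hasFDerivAt.comp_hasDerivAt s (hs (uIoc_subset_uIcc hmem))).deriv.symm
  apply Complex.ext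
  · simpa using key Complex.reCLM
  · simpa using key Complex.imCLM

/-- Along the upper edge Φ is locally G ∘ γ plus a constant, hence Lipschitz on compact intervals,
and the chain rule holds at almost every point by Rademacher's theorem for γ. -/
theorem IsPrimitiveAlong.integral_path {g : ℂ → ℂ} {h : ℝ × ℝ → ℂ} {α β : ℝ} {Q : Set (ℝ × ℝ)}
    {Φ : ℝ × ℝ → ℂ} (hΦ : IsPrimitiveAlong g h Q Φ)
    {γ : ℝ → ℂ} (hγ : LocallyLipschitzOn (Ioo 0 1) γ) (hα : 0 < α) (hβ : β < 1)
    (hQ : ∀ s ∈ Icc α β, (s, (1 : ℝ)) ∈ Q) (hhγ : ∀ s ∈ Ioo (0 : ℝ) 1, h (s, 1) = γ s)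
    (hint : IntegrableOn (fun s => deriv γ s * g (γ s)) (Ioo 0 1))
    {s₁ s₂ : ℝ} (h₁ : s₁ ∈ Icc α β) (h₂ : s₂ ∈ Icc α β) :
    ∫ s in s₁..s₂, deriv γ s * g (γ s) = Φ (s₂, 1) - Φ (s₁, 1) := by
  have hsub : uIcc s₁ s₂ ⊆ Icc α β := ordConnected_Icc.uIcc_subset h₁ h₂
  have hsub' : Icc α β ⊆ Ioo 0 1 := fun s hs => ⟨hα.trans_le hs.1, hs.2.trans_lt hβ⟩
  have hloc : ∀ s ∈ Icc α β, ∃ G : ℂ → ℂ, ∃ r > 0,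
      (∀ w ∈ ball (γ s) r, HasDerivAt G (g w) w) ∧
      ∀ᶠ q in 𝓝[Icc α β] s, Φ (q, 1) - Φ (s, 1) = G (γ q) - G (γ s) := by
    intro s hs
    obtain ⟨G, r, hr, hG, hev⟩ := hΦ (s, 1) (hQ s hs)
    rw [hhγ s (hsub' hs)] at hG
    refine ⟨G, r, hr, hG, ?_⟩
    have ht : Tendsto (fun q : ℝ => (q, (1 : ℝ))) (𝓝[Icc α β] s) (𝓝[Q] (s, 1)) := by
      refine tendsto_nhdsWithin_iff.2 ⟨?_, ?_⟩
      · exact (Continuous.tendsto (by fun_prop) s).mono_left nhdsWithin_le_nhds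
      · filter_upwards [self_mem_nhdsWithin] with q hq using hQ q hq
    filter_upwards [ht.eventually hev, self_mem_nhdsWithin] with q hq hqm
    rwa [hhγ q (hsub' hqm), hhγ s (hsub' hs)] at hq
  have hLL : LocallyLipschitzOn (Icc α β) (fun s => Φ (s, 1)) := by
    intro s hs
    obtain ⟨G, r, hr, hG, hev⟩ := hloc s hs
    have hGd : DifferentiableOn ℂ G (ball (γ s) r) :=
      fun w hw => (hG w hw).differentiableAt.differentiableWithinAt
    have hstrict : HasStrictDerivAt G (deriv G (γ s)) (γ s) :=
      ((hGd.contDiffOn isOpen_ball).contDiffAt (ball_mem_nhds _ hr)).hasStrictDerivAt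
        (n := 1) (by norm_num)
    obtain ⟨K, t, ht, hK⟩ := hstrict.hasStrictFDerivAt.exists_lipschitzOnWith
    obtain ⟨K', t', ht', hK'⟩ := (hγ.mono hsub') hs
    have hcont : ContinuousWithinAt γ (Icc α β) s := (hγ.mono hsub').continuousOn s hs
    refine ⟨K * K', (t' ∩ γ ⁻¹' t) ∩
      {q | Φ (q, 1) - Φ (s, 1) = G (γ q) - G (γ s)}, inter_mem (inter_mem ht' (hcont ht)) hev, ?_⟩
    have hcomp : LipschitzOnWith (K * K') (G ∘ γ) (t' ∩ γ ⁻¹' t) :=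
      hK.comp (hK'.mono inter_subset_left) (fun q hq => hq.2)
    intro q hq q' hq'
    have e1 : Φ (q, 1) = (G ∘ γ) q - G (γ s) + Φ (s, 1) := by
      have := hq.2
      rw [mem_ofPred_eq] at this
      simp only [Function.comp]
      linear_combination this
    have e2 : Φ (q', 1) = (G ∘ γ) q' - G (γ s) + Φ (s, 1) := by
      have := hq'.2
      rw [mem_ofPred_eq] at this
      simp only [Function.comp]
      linear_combination this
    simp only
    rw [e1, e2, edist_add_right, edist_sub_right]
    exact hcomp hq.1 hq'.1
  obtain ⟨K, hK⟩ := (hLL.mono hsub).exists_lipschitzOnWith_of_compact isCompact_uIcc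
  obtain ⟨K', hK'⟩ := (hγ.mono hsub').exists_lipschitzOnWith_of_compact isCompact_Icc
  refine integral_eq_sub_of_lipschitzOnWith (v := fun s => Φ (s, 1)) hK ?_ ?_
  · have hne1 : ∀ᵐ s : ℝ, s ≠ α := by simp [ae_iff]
    have hne2 : ∀ᵐ s : ℝ, s ≠ β := by simp [ae_iff]
    filter_upwards [hK'.ae_differentiableWithinAt_of_mem_real, hne1, hne2] with s hs hs1 hs2 hmem
    have hs3 := hsub hmem
    have hnhds : Icc α β ∈ 𝓝 s :=
      Icc_mem_nhds (lt_of_le_of_ne hs3.1 hs1.symm) (lt_of_le_of_ne hs3.2 hs2)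
    have hγd : HasDerivAt γ (deriv γ s) s := ((hs hs3).differentiableAt hnhds).hasDerivAt
    obtain ⟨G, r, hr, hG, hev⟩ := hloc s hs3
    rw [nhdsWithin_eq_nhds.2 hnhds] at hev
    have h3 := ((hG (γ s) (mem_ball_self hr)).scomp s hγd).add_const (Φ (s, 1) - G (γ s))
    refine h3.congr_of_eventuallyEq ?_
    filter_upwards [hev] with q hq
    simp only [Function.comp]
    linear_combination hq
  · rw [intervalIntegrable_iff]
    exact hint.mono_set ((uIoc_subset_uIcc.trans hsub).trans hsub')

end Arcs

/-! ### Cauchy's theorem for deformations with small crosscuts at the ends -/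

section Deformation

/-- The growth of `g` on the set swept by `h` allows for short crosscuts near an end: on the circles
around some real point `c`, shrinking to `c` or blowing up to infinity, the product of
`‖g‖` and the radius tends to zero. -/
def EndControl (g : ℂ → ℂ) (h : ℝ × ℝ → ℂ) (F : Filter ℝ) : Prop :=
  ∃ (c : ℝ) (B : ℝ → ℝ) (L : Filter ℝ),
    (L = 𝓝[>] 0 ∧ (∀ p ∈ paramSquare, h p ≠ c) ∨ L = atTop) ∧
    Tendsto (fun p => ‖h p - c‖) (F ×ˢ 𝓟 (Icc 0 1)) L ∧
    (∀ᶠ ρ in L, ∀ p ∈ paramSquare, ‖h p - c‖ = ρ → ‖g (h p)‖ ≤ B ρ) ∧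
    Tendsto (fun ρ => B ρ * ρ) L (𝓝 0)

/-- A continuum in `S`, joining the sides `t = 0` and `t = 1`, that `h` maps to a circle on which
`‖g‖` is small compared to the inverse radius. -/
def IsCrosscut (g : ℂ → ℂ) (h : ℝ × ℝ → ℂ) (κ : ℝ) (C : Set (ℝ × ℝ)) : Prop :=
  IsPreconnected C ∧ (∃ s, (s, (0 : ℝ)) ∈ C) ∧ (∃ s, (s, (1 : ℝ)) ∈ C) ∧
    ∃ (c ρ B : ℝ), 0 < ρ ∧ B * ρ < κ ∧ ∀ p ∈ C, ‖h p - c‖ = ρ ∧ ‖g (h p)‖ ≤ B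

/-- By compactness ‖h - c‖ is bounded on the edge s = α₀, and bounded away from zero there if h
avoids c. A radius beyond that bound, on the side of the limit, separates this edge from an edge
close to the end, so `exists_crossing` applies to its level set. -/
theorem EndControl.exists_isCrosscut_left {g : ℂ → ℂ} {h : ℝ × ℝ → ℂ}
    (hE : EndControl g h (𝓝[>] 0)) (hh : ContinuousOn h paramSquare) {α₀ κ : ℝ}
    (hα₀ : α₀ ∈ Ioo (0 : ℝ) 1) (hκ : 0 < κ) :
    ∃ α ∈ Ioo 0 α₀, ∃ C ⊆ Icc α α₀ ×ˢ Icc (0 : ℝ) 1, IsCrosscut g h κ C := by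
  obtain ⟨c, B, L, hL, hlim, hB, hB0⟩ := hE
  set u : ℝ × ℝ → ℝ := fun p => ‖h p - c‖ with hu
  have hucont : ContinuousOn u paramSquare := (hh.sub continuousOn_const).norm
  have hedge : ContinuousOn (fun t => u (α₀, t)) (Icc 0 1) :=
    hucont.comp (by fun_prop) fun t ht => ⟨hα₀, ht⟩
  have hsmall : ∀ᶠ ρ in L, B ρ * ρ < κ := hB0.eventually_lt_const hκ
  have hmem : ∀ᶠ s in 𝓝[>] (0 : ℝ), s ∈ Ioo 0 α₀ := Ioo_mem_nhdsGT hα₀.1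
  have hsubQ : ∀ α ∈ Ioo 0 α₀, Icc α α₀ ×ˢ Icc (0 : ℝ) 1 ⊆ paramSquare := fun α hα =>
    prod_mono (fun s hs => ⟨hα.1.trans_le hs.1, hs.2.trans_lt hα₀.2⟩) le_rfl
  rcases hL with ⟨rfl, hne⟩ | rfl
  · obtain ⟨t₀, ht₀, hmin⟩ := isCompact_Icc.exists_isMinOn (nonempty_Icc.2 zero_le_one) hedge
    have hm : 0 < u (α₀, t₀) := norm_pos_iff.2 (sub_ne_zero.2 (hne _ ⟨hα₀, ht₀⟩))
    obtain ⟨ρ, ⟨hρB, hρκ⟩, hρ0, hρm⟩ :=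
      ((hB.and hsmall).and (Ioo_mem_nhdsGT hm)).exists
    have hev : ∀ᶠ s in 𝓝[>] (0 : ℝ), ∀ t ∈ Icc (0 : ℝ) 1, u (s, t) < ρ := by
      have h1 := (tendsto_nhdsWithin_iff.1 hlim).1.eventually_lt_const hρ0
      exact eventually_prod_principal_iff.1 h1
    obtain ⟨α, hα, hαmem⟩ := (hev.and hmem).exists
    obtain ⟨C, hCQ, hC, hCρ, hbot, htop⟩ := exists_crossing (u := u) (ρ := ρ) hαmem.2.le
      (hucont.mono (hsubQ α hαmem)) hα (fun t ht => hρm.trans_le (hmin ht))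
    exact ⟨α, hαmem, C, hCQ, hC, hbot, htop, c, ρ, B ρ, hρ0, hρκ,
      fun p hp => ⟨hCρ p hp, hρB p (hsubQ α hαmem (hCQ hp)) (hCρ p hp)⟩⟩
  · obtain ⟨t₀, ht₀, hmax⟩ := isCompact_Icc.exists_isMaxOn (nonempty_Icc.2 zero_le_one) hedge
    obtain ⟨ρ, ⟨hρB, hρκ⟩, hρm⟩ :=
      ((hB.and hsmall).and (eventually_gt_atTop (max (u (α₀, t₀)) 0))).exists
    have hev : ∀ᶠ s in 𝓝[>] (0 : ℝ), ∀ t ∈ Icc (0 : ℝ) 1, ρ < u (s, t) := by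
      have h1 := hlim.eventually (eventually_gt_atTop ρ)
      exact eventually_prod_principal_iff.1 h1
    obtain ⟨α, hα, hαmem⟩ := (hev.and hmem).exists
    -- At an infinite end the larger values lie on the left, so signs are reversed.
    obtain ⟨C, hCQ, hC, hCρ, hbot, htop⟩ := exists_crossing (u := fun p => -u p) (ρ := -ρ)
      hαmem.2.le (hucont.mono (hsubQ α hαmem)).neg (fun t ht => neg_lt_neg (hα t ht))
      (fun t ht => neg_lt_neg (((hmax ht).trans (le_max_left _ _)).trans_lt hρm))
    have hCρ' : ∀ p ∈ C, u p = ρ := fun p hp => neg_injective (hCρ p hp)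
    exact ⟨α, hαmem, C, hCQ, hC, hbot, htop, c, ρ, B ρ, (le_max_right _ _).trans_lt hρm, hρκ,
      fun p hp => ⟨hCρ' p hp, hρB p (hsubQ α hαmem (hCQ hp)) (hCρ' p hp)⟩⟩

theorem EndControl.exists_isCrosscut_right {g : ℂ → ℂ} {h : ℝ × ℝ → ℂ}
    (hE : EndControl g h (𝓝[<] 1)) (hh : ContinuousOn h paramSquare) {β₀ κ : ℝ}
    (hβ₀ : β₀ ∈ Ioo (0 : ℝ) 1) (hκ : 0 < κ) :
    ∃ β ∈ Ioo β₀ 1, ∃ C ⊆ Icc β₀ β ×ˢ Icc (0 : ℝ) 1, IsCrosscut g h κ C := by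
  -- Reflection in s exchanges the two ends.
  set R : ℝ × ℝ → ℝ × ℝ := fun p => (1 - p.1, p.2) with hR
  have hRc : Continuous R := by fun_prop
  have hRR : ∀ p, R (R p) = p := fun p => by simp [hR]
  have hRm : ∀ p ∈ paramSquare, R p ∈ paramSquare := by
    rintro ⟨s, t⟩ ⟨⟨h1, h2⟩, ht⟩
    exact ⟨⟨by simp only [hR]; linarith, by simp only [hR]; linarith⟩, ht⟩
  have hE' : EndControl g (h ∘ R) (𝓝[>] 0) := by
    obtain ⟨c, B, L, hL, hlim, hB, hB0⟩ := hE
    refine ⟨c, B, L, hL.imp_left fun hL => ⟨hL.1, fun p hp => hL.2 _ (hRm p hp)⟩, ?_, ?_, hB0⟩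
    · refine hlim.comp (f := R) ?_
      refine Tendsto.prodMap (f := fun s : ℝ => 1 - s) (g := id) ?_ tendsto_id
      refine tendsto_nhdsWithin_iff.2 ⟨?_, ?_⟩
      · exact (Continuous.tendsto' (by fun_prop) 0 1 (by simp)).mono_left nhdsWithin_le_nhds
      · filter_upwards [self_mem_nhdsWithin] with s hs
        simpa using hs
    · filter_upwards [hB] with ρ hρ p hp using hρ _ (hRm p hp)
  obtain ⟨α, hα, C, hCQ, hC, ⟨s₀, hs₀⟩, ⟨s₁, hs₁⟩, c, ρ, B, hρ, hB, hCB⟩ :=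
    hE'.exists_isCrosscut_left (α₀ := 1 - β₀) (κ := κ)
      (hh.comp hRc.continuousOn hRm) ⟨by linarith [hβ₀.2], by linarith [hβ₀.1]⟩ hκ
  refine ⟨1 - α, ⟨by linarith [hα.2], by linarith [hα.1]⟩, R '' C, ?_, hC.image R hRc.continuousOn,
    ⟨1 - s₀, _, hs₀, rfl⟩, ⟨1 - s₁, _, hs₁, rfl⟩, c, ρ, B, hρ, hB, ?_⟩
  · rintro _ ⟨p, hp, rfl⟩
    obtain ⟨h1, h2⟩ := hCQ hp
    exact ⟨⟨by simp only [hR]; linarith [h1.2], by simp only [hR]; linarith [h1.1]⟩, h2⟩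
  · rintro _ ⟨p, hp, rfl⟩
    exact hCB p hp

theorem tendsto_intervalIntegral_of_exhausts {J : Set ℝ} (hJ : MeasurableSet J) {f : ℝ → ℂ}
    (hf : IntegrableOn f J) {ι : Type*} {l : Filter ι} [l.IsCountablyGenerated] {y₀ y₁ : ι → ℝ}
    (hle : ∀ᶠ i in l, y₀ i ≤ y₁ i ∧ Ioc (y₀ i) (y₁ i) ⊆ J)
    (hex : ∀ y ∈ J, ∀ᶠ i in l, y ∈ Ioc (y₀ i) (y₁ i)) :
    Tendsto (fun i => ∫ y in y₀ i..y₁ i, f y) l (𝓝 (∫ y in J, f y)) := by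
  have hcov : AECover (volume.restrict J) l fun i => Ioc (y₀ i) (y₁ i) :=
    ⟨(ae_restrict_iff' hJ).2 (Eventually.of_forall hex), fun i => measurableSet_Ioc⟩
  refine (hcov.integral_tendsto_of_countably_generated hf).congr' ?_
  filter_upwards [hle] with i hi
  rw [intervalIntegral.integral_of_le hi.1, Measure.restrict_restrict measurableSet_Ioc,
    inter_eq_left.2 hi.2]

theorem measurableSet_interval (a b : EReal) : MeasurableSet (interval a b) :=
  (measurable_coe_real_ereal measurableSet_Ioi).inter
    (measurable_coe_real_ereal measurableSet_Iio)

theorem ordConnected_interval (a b : EReal) : (interval a b).OrdConnected :=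
  ⟨fun _ hx _ hy _ hz => ⟨hx.1.trans_le (EReal.coe_le_coe_iff.2 hz.1),
    (EReal.coe_le_coe_iff.2 hz.2).trans_lt hy.2⟩⟩

/-- A primitive along a compact rectangle containing both crosscuts has increments equal to the
truncated contour integral on top, to the truncated real integral at the bottom, and to something
small along the crosscuts. -/
theorem integral_eq_of_deformation {a b : EReal} {g : ℂ → ℂ} {h : ℝ × ℝ → ℂ} {Ω : Set ℂ}
    {γ : ℝ → ℂ} {x : ℝ → ℝ} {σ : ℝ} (hσ : σ * σ = 1) (hΩ : IsOpen Ω) (hg : DifferentiableOn ℂ g Ω)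
    (hh : ContinuousOn h paramSquare) (hm : MapsTo h paramSquare Ω)
    (him : ∀ p ∈ paramSquare, 0 ≤ σ * (h p).im)
    (hx : StrictMonoOn x (Ioo 0 1)) (hx₀ : ∀ s ∈ Ioo (0 : ℝ) 1, x s ∈ interval a b ∧ h (s, 0) = x s)
    (hxa : ∀ y ∈ interval a b, ∃ s ∈ Ioo (0 : ℝ) 1, x s < y)
    (hxb : ∀ y ∈ interval a b, ∃ s ∈ Ioo (0 : ℝ) 1, y < x s)
    (hγ : LocallyLipschitzOn (Ioo 0 1) γ) (hhγ : ∀ s ∈ Ioo (0 : ℝ) 1, h (s, 1) = γ s)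
    (hint : IntegrableOn (fun s => deriv γ s * g (γ s)) (Ioo 0 1))
    (hint₀ : IntegrableOn (fun y : ℝ => g y) (interval a b))
    (hl : EndControl g h (𝓝[>] 0)) (hr : EndControl g h (𝓝[<] 1)) :
    ∫ s in Ioo (0 : ℝ) 1, deriv γ s * g (γ s) = ∫ y in interval a b, g y := by
  set 𝓕 : Filter (ℝ × ℝ) := 𝓝[>] 0 ×ˢ 𝓝[<] 1 with h𝓕
  have hsmem : ∀ᶠ p in 𝓕, p.1 ∈ Ioo (0 : ℝ) (1 / 2) ∧ p.2 ∈ Ioo (1 / 2 : ℝ) 1 :=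
    Filter.Eventually.prod_mk (Ioo_mem_nhdsGT (by norm_num)) (Ioo_mem_nhdsLT (by norm_num))
  have hlt : ∀ s ∈ Ioo (0 : ℝ) 1, ∀ᶠ p in 𝓕, p.1 < s ∧ s < p.2 := fun s hs =>
    Filter.Eventually.prod_mk (nhdsWithin_le_nhds (Iio_mem_nhds hs.1))
      (nhdsWithin_le_nhds (Ioi_mem_nhds hs.2))
  have T₁ : Tendsto (fun p : ℝ × ℝ => ∫ s in p.1..p.2, deriv γ s * g (γ s)) 𝓕
      (𝓝 (∫ s in Ioo (0 : ℝ) 1, deriv γ s * g (γ s))) := by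
    refine tendsto_intervalIntegral_of_exhausts measurableSet_Ioo hint ?_ ?_
    · filter_upwards [hsmem] with p hp
      exact ⟨by linarith [hp.1.2, hp.2.1],
        fun s hs => ⟨hp.1.1.trans hs.1, hs.2.trans_lt hp.2.2⟩⟩
    · intro s hs
      filter_upwards [hlt s hs] with p hp using ⟨hp.1, hp.2.le⟩
  have T₂ : Tendsto (fun p : ℝ × ℝ => ∫ y in x p.1..x p.2, g y) 𝓕
      (𝓝 (∫ y in interval a b, g y)) := by
    refine tendsto_intervalIntegral_of_exhausts (measurableSet_interval a b) hint₀ ?_ ?_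
    · filter_upwards [hsmem] with p hp
      have h1 : p.1 ∈ Ioo (0 : ℝ) 1 := ⟨hp.1.1, by linarith [hp.1.2]⟩
      have h2 : p.2 ∈ Ioo (0 : ℝ) 1 := ⟨by linarith [hp.2.1], hp.2.2⟩
      refine ⟨(hx h1 h2 (by linarith [hp.1.2, hp.2.1])).le, ?_⟩
      exact Ioc_subset_Icc_self.trans
        ((ordConnected_interval a b).out (hx₀ _ h1).1 (hx₀ _ h2).1)
    · intro y hy
      obtain ⟨s, hs, hsy⟩ := hxa y hy
      obtain ⟨s', hs', hsy'⟩ := hxb y hy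
      filter_upwards [hsmem, hlt s hs, hlt s' hs'] with p hp h1 h2
      exact ⟨(hx ⟨hp.1.1, by linarith [hp.1.2]⟩ hs h1.1).trans hsy,
        (hsy'.trans (hx hs' ⟨by linarith [hp.2.1], hp.2.2⟩ h2.2)).le⟩
  set I₁ := ∫ s in Ioo (0 : ℝ) 1, deriv γ s * g (γ s)
  set I₂ := ∫ y in interval a b, g y
  by_contra hne
  have hpos : 0 < ‖I₁ - I₂‖ := norm_pos_iff.2 (sub_ne_zero.2 hne)
  -- Two truncation errors below κ and, since π < 4, two crosscuts below 4κ add up to less than 10κ.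
  set κ := ‖I₁ - I₂‖ / 10 with hκdef
  have hκ : 0 < κ := by positivity
  have E₁ := T₁.eventually (Metric.ball_mem_nhds _ hκ)
  have E₂ := T₂.eventually (Metric.ball_mem_nhds _ hκ)
  -- A crosscut may meet bottom and top at different s, so the truncation errors have to be small
  -- for all cut-off points in one neighbourhood of each end.
  obtain ⟨P₀, hP₀, P₁, hP₁, hPP⟩ := eventually_prod_iff.1 ((E₁.and E₂).and hsmem)
  obtain ⟨α₀, hα₀, hα₀P⟩ := (mem_nhdsGT_iff_exists_Ioc_subset).1 hP₀
  obtain ⟨β₀, hβ₀, hβ₀P⟩ := (mem_nhdsLT_iff_exists_Ico_subset).1 hP₁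
  rw [mem_Ioi] at hα₀
  rw [mem_Iio] at hβ₀
  have hα₀half := (hPP (hα₀P ⟨hα₀, le_rfl⟩) (hβ₀P ⟨le_rfl, hβ₀⟩)).2.1
  have hβ₀half := (hPP (hα₀P ⟨hα₀, le_rfl⟩) (hβ₀P ⟨le_rfl, hβ₀⟩)).2.2
  simp only at hα₀half hβ₀half
  obtain ⟨α, hα, Cl, hClQ, hCl, ⟨l₀, hl₀⟩, ⟨l₁, hl₁⟩, cl, ρl, Bl, hρl, hBl, hClB⟩ :=
    hl.exists_isCrosscut_left (α₀ := α₀) hh ⟨hα₀, by linarith [hα₀half.2]⟩ hκ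
  obtain ⟨β, hβ, Cr, hCrQ, hCr, ⟨r₀, hr₀⟩, ⟨r₁, hr₁⟩, cr, ρr, Br, hρr, hBr, hCrB⟩ :=
    hr.exists_isCrosscut_right (β₀ := β₀) hh ⟨by linarith [hβ₀half.1], hβ₀⟩ hκ
  set Q := Icc α β ×ˢ Icc (0 : ℝ) 1 with hQ
  have hQsub : Q ⊆ paramSquare :=
    prod_mono (fun s hs => ⟨hα.1.trans_le hs.1, hs.2.trans_lt hβ.2⟩) le_rfl
  have hClQ' : Cl ⊆ Q := hClQ.trans (prod_mono (Icc_subset_Icc le_rfl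
    (by linarith [hα₀half.2, hβ₀half.1, hβ.1])) le_rfl)
  have hCrQ' : Cr ⊆ Q := hCrQ.trans (prod_mono (Icc_subset_Icc
    (by linarith [hα₀half.2, hβ₀half.1, hα.2]) le_rfl) le_rfl)
  obtain ⟨Φ, hΦ⟩ := exists_isPrimitiveAlong hΩ hg (isCompact_Icc.prod isCompact_Icc)
    ((convex_Icc α β).prod (convex_Icc 0 1)) (hh.mono hQsub) (hm.mono_left hQsub)
  have hgc : ∀ C ⊆ Q, ContinuousOn g (h '' C) := fun C hC =>
    hg.continuousOn.mono (image_subset_iff.2 fun p hp => hm (hQsub (hC hp)))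
  have N₁ := norm_sub_le_of_circle hΦ (hh.mono hQsub) hCl hClQ' (hgc _ hClQ') hσ hρl
    (fun p hp => (hClB p hp).1) (fun p hp => (hClB p hp).2)
    (fun p hp => him p (hQsub (hClQ' hp))) hl₀ hl₁
  have N₂ := norm_sub_le_of_circle hΦ (hh.mono hQsub) hCr hCrQ' (hgc _ hCrQ') hσ hρr
    (fun p hp => (hCrB p hp).1) (fun p hp => (hCrB p hp).2)
    (fun p hp => him p (hQsub (hCrQ' hp))) hr₀ hr₁
  have J₁ := hΦ.integral_path hγ hα.1 hβ.2 (fun s hs => ⟨hs, by simp⟩) hhγ hint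
    (hClQ' hl₁).1 (hCrQ' hr₁).1
  have hbQ : Icc α β ×ˢ {(0 : ℝ)} ⊆ Q := prod_mono le_rfl (by simp)
  have hmemb : ∀ p ∈ Icc α β ×ˢ {(0 : ℝ)}, p.1 ∈ Ioo (0 : ℝ) 1 := fun p hp => (hQsub (hbQ hp)).1
  have J₂ := hΦ.sub_eq_integral (C := Icc α β ×ˢ {(0 : ℝ)}) (θ := fun p => x p.1)
    (arc := fun y => (y : ℂ)) (arc' := fun _ => 1)
    (isPreconnected_Icc.prod isPreconnected_singleton) hbQ
    (by
      have h1 : ContinuousOn (fun p => (h p).re) (Icc α β ×ˢ {(0 : ℝ)}) :=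
        Complex.continuous_re.comp_continuousOn (hh.mono (hbQ.trans hQsub))
      refine h1.congr fun p hp => ?_
      obtain ⟨s, t⟩ := p
      have ht : t = 0 := hp.2
      subst ht
      simp [(hx₀ s (hmemb _ hp)).2])
    (fun τ => by simpa using HasDerivAt.ofReal_comp (hasDerivAt_id τ)) continuous_const
    (by
      rintro ⟨s, t⟩ hp
      have ht : t = 0 := hp.2
      subst ht
      exact (hx₀ s (hmemb _ hp)).2) (hgc _ hbQ)
    (p₁ := (l₀, 0)) (p₂ := (r₀, 0)) ⟨(hClQ' hl₀).1, rfl⟩ ⟨(hCrQ' hr₀).1, rfl⟩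
  simp only [one_mul] at J₂
  have hPl : ∀ s t, (s, t) ∈ Cl → s ∈ Ioc 0 α₀ := fun s t hs =>
    ⟨hα.1.trans_le (hClQ hs).1.1, (hClQ hs).1.2⟩
  have hPr : ∀ s t, (s, t) ∈ Cr → s ∈ Ico β₀ 1 := fun s t hs =>
    ⟨(hCrQ hs).1.1, (hCrQ hs).1.2.trans_lt hβ.2⟩
  have D₁ := (hPP (hα₀P (hPl _ _ hl₁)) (hβ₀P (hPr _ _ hr₁))).1.1
  have D₂ := (hPP (hα₀P (hPl _ _ hl₀)) (hβ₀P (hPr _ _ hr₀))).1.2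
  rw [dist_eq_norm] at D₁ D₂
  simp only at D₁ D₂ J₁
  rw [J₁] at D₁
  rw [← J₂] at D₂
  have hpi := Real.pi_lt_four
  have hpi0 := Real.pi_pos
  have e : I₁ - I₂ = -(Φ (r₁, 1) - Φ (l₁, 1) - I₁) + (Φ (r₀, 0) - Φ (l₀, 0) - I₂) +
      (Φ (r₁, 1) - Φ (r₀, 0)) - (Φ (l₁, 1) - Φ (l₀, 0)) := by ring
  have hfin : ‖I₁ - I₂‖ ≤ ‖Φ (r₁, 1) - Φ (l₁, 1) - I₁‖ + ‖Φ (r₀, 0) - Φ (l₀, 0) - I₂‖ +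
      ‖Φ (r₁, 1) - Φ (r₀, 0)‖ + ‖Φ (l₁, 1) - Φ (l₀, 0)‖ := by
    conv_lhs => rw [e]
    refine (norm_sub_le _ _).trans (add_le_add_left ((norm_add_le _ _).trans
      (add_le_add_left ((norm_add_le _ _).trans ?_) _)) _)
    rw [norm_neg]
  have K₁ : Real.pi * (Bl * ρl) < 4 * κ := by nlinarith
  have K₂ : Real.pi * (Br * ρr) < 4 * κ := by nlinarith
  have : ‖I₁ - I₂‖ = 10 * κ := by rw [hκdef]; ring
  linarith

end Deformation

/-! ### Mollifiers and Cauchy's theorem for admissible contours -/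

section Cauchy

variable {H₁ : Type*} [NormedAddCommGroup H₁] [InnerProductSpace ℂ H₁]

theorem sign_mul_self (l : ℤˣ) : ((l : ℤ) : ℝ) * ((l : ℤ) : ℝ) = 1 := by
  rcases Int.units_eq_one_or l with rfl | rfl <;> simp

theorem IsContinuedDerivative.sign_mul_im_pos {a b : EReal} {Dm : Set ℂ} {K : ℝ → H₁ →L[ℂ] H₁}
    {K' : ℂ → H₁ →L[ℂ] H₁} (hK : IsContinuedDerivative a b Dm K K') {l : ℤˣ} {z : ℂ}
    (hz : z ∈ side Dm l) : 0 < ((l : ℤ) : ℝ) * z.im := by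
  rcases Int.units_eq_one_or l with rfl | rfl
  · have := hK.lower (starRingEnd ℂ z) (by simpa [side] using hz)
    simpa using this
  · have h1 : (-1 : ℤˣ) ≠ 1 := by decide
    have := hK.lower z (by simpa [side, h1] using hz)
    simpa using this

theorem side_subset_fullDomain (a b : EReal) (Dm : Set ℂ) (l : ℤˣ) :
    side Dm l ⊆ fullDomain a b Dm := by
  rcases Int.units_eq_one_or l with rfl | rfl
  · exact subset_union_right
  · exact subset_union_left.trans subset_union_left

theorem ofReal_mem_fullDomain {a b : EReal} (Dm : Set ℂ) {y : ℝ} (hy : y ∈ interval a b) :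
    (y : ℂ) ∈ fullDomain a b Dm :=
  Or.inl (Or.inr (mem_image_of_mem _ hy))

/-- The mollifying factor `(1 - iσεμ)⁻ᵐ`: it is bounded by one where `σ Im μ ≥ 0`, decays at
infinity, and tends to one as `ε → 0`. -/
noncomputable def mollifier (σ ε : ℝ) (m : ℕ) (μ : ℂ) : ℂ :=
  (1 - Complex.I * (σ * ε : ℝ) * μ)⁻¹ ^ m

theorem one_sub_re (σ ε : ℝ) (μ : ℂ) :
    (1 - Complex.I * (σ * ε : ℝ) * μ).re = 1 + ε * (σ * μ.im) := by
  simp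
  ring

theorem one_le_norm_one_sub {σ ε : ℝ} (hε : 0 ≤ ε) {μ : ℂ} (hμ : 0 ≤ σ * μ.im) :
    1 ≤ ‖1 - Complex.I * (σ * ε : ℝ) * μ‖ := by
  refine le_trans ?_ (Complex.re_le_norm _)
  rw [one_sub_re]
  nlinarith [mul_nonneg hε hμ]

theorem norm_mollifier_le_one {σ ε : ℝ} (hε : 0 ≤ ε) (m : ℕ) {μ : ℂ} (hμ : 0 ≤ σ * μ.im) :
    ‖mollifier σ ε m μ‖ ≤ 1 := by
  rw [mollifier, norm_pow, norm_inv]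
  exact pow_le_one₀ (by positivity) (inv_le_one_of_one_le₀ (one_le_norm_one_sub hε hμ))

theorem norm_mollifier_le {σ ε : ℝ} (hσ : σ * σ = 1) (hε : 0 < ε) (m : ℕ) {μ : ℂ}
    (hμ : 2 / ε ≤ ‖μ‖) : ‖mollifier σ ε m μ‖ ≤ (2 / (ε * ‖μ‖)) ^ m := by
  have hμ0 : 0 < ‖μ‖ := lt_of_lt_of_le (by positivity) hμ
  rw [mollifier, norm_pow, norm_inv]
  have h2 : 2 ≤ ε * ‖μ‖ := by rw [div_le_iff₀ hε] at hμ; linarith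
  have h3 : ‖Complex.I * (σ * ε : ℝ) * μ‖ = ε * ‖μ‖ := by
    have : |σ| = 1 := by rcases mul_self_eq_one_iff.1 hσ with rfl | rfl <;> simp
    rw [norm_mul, norm_mul, Complex.norm_I, Complex.norm_real, Real.norm_eq_abs, abs_mul, this,
      abs_of_pos hε]
    ring
  have h4 : ε * ‖μ‖ / 2 ≤ ‖1 - Complex.I * (σ * ε : ℝ) * μ‖ := by
    have := norm_sub_norm_le (Complex.I * (σ * ε : ℝ) * μ) 1
    rw [h3, norm_one, norm_sub_rev] at this
    linarith
  gcongr
  rw [← inv_div]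
  exact inv_anti₀ (by positivity) h4

theorem differentiableOn_mollifier {σ ε : ℝ} (hε : 0 < ε) (m : ℕ) :
    DifferentiableOn ℂ (mollifier σ ε m) {μ | -(1 / ε) < σ * μ.im} := by
  intro μ hμ
  have hne : 1 - Complex.I * (σ * ε : ℝ) * μ ≠ 0 := by
    intro h0
    have := one_sub_re σ ε μ
    rw [h0, Complex.zero_re] at this
    have h1 : -(1 / ε) < σ * μ.im := hμ
    have h2 : ε * -(1 / ε) < ε * (σ * μ.im) := mul_lt_mul_of_pos_left h1 hε
    have h3 : ε * -(1 / ε) = -1 := by field_simp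
    linarith
  have : DifferentiableAt ℂ (fun μ : ℂ => 1 - Complex.I * (σ * ε : ℝ) * μ) μ := by fun_prop
  exact ((this.inv hne).pow m).differentiableWithinAt

theorem tendsto_mollifier (σ : ℝ) (m : ℕ) (μ : ℂ) :
    Tendsto (fun n : ℕ => mollifier σ (1 / (n + 1)) m μ) atTop (𝓝 1) := by
  have h1 : Tendsto (fun n : ℕ => (1 / ((n : ℝ) + 1))) atTop (𝓝 0) :=
    tendsto_one_div_add_atTop_nhds_zero_nat
  have hc : ContinuousAt (fun ε : ℝ => mollifier σ ε m μ) 0 := by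
    have h2 : ContinuousAt (fun ε : ℝ => 1 - Complex.I * (σ * ε : ℝ) * μ) 0 := by fun_prop
    exact (h2.inv₀ (by simp)).pow m
  have := hc.tendsto.comp h1
  simpa [mollifier, Function.comp_def] using this

theorem endFilter_coe (e : ℝ) : endFilter (e : EReal) = 𝓝 (e : ℂ) := by
  simp [endFilter]

/-- At infinity the growth ρᴺ, the mollifier of order ρ^(-N-2) and the radius ρ leave ρ⁻¹; this
explains the exponent N + 2. At a finite end the radius turns the endpoint bound into ρ^(δ+1) with δ
> -1. -/
theorem endControl_mollifier {a b : EReal} {Dm : Set ℂ} {K : ℝ → H₁ →L[ℂ] H₁}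
    {K' : ℂ → H₁ →L[ℂ] H₁} (hK : IsContinuedDerivative a b Dm K K') {l : ℤˣ}
    {g : ℂ → ℂ} {h : ℝ × ℝ → ℂ} {x : ℝ → ℝ} {M R C ε : ℝ} {N : ℕ} (hM : 0 ≤ M)
    (hgK : ∀ z ∈ fullDomain a b Dm, 0 ≤ ((l : ℤ) : ℝ) * z.im → ‖g z‖ ≤ M * ‖K' z‖)
    (hh : ContinuousOn h paramSquare)
    (hx₀ : ∀ s ∈ Ioo (0 : ℝ) 1, x s ∈ interval a b ∧ h (s, 0) = x s)
    (hD : ∀ s ∈ Ioo (0 : ℝ) 1, ∀ t ∈ Ioc (0 : ℝ) 1, h (s, t) ∈ side Dm l)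
    (hgrow : ∀ p ∈ paramSquare, R ≤ ‖h p‖ → ‖K' (h p)‖ ≤ C * ‖h p‖ ^ N) (hε : 0 < ε)
    {e : EReal} (he : e = a ∨ e = b) {F : Filter ℝ}
    (hF : ∀ᶠ s in F, s ∈ Ioo (0 : ℝ) 1) (hlim : Tendsto h (F ×ˢ 𝓟 (Icc 0 1)) (endFilter e)) :
    EndControl (fun μ => g μ * mollifier ((l : ℤ) : ℝ) ε (N + 2) μ) h F := by
  set σ : ℝ := ((l : ℤ) : ℝ) with hσdef
  have hσ : σ * σ = 1 := sign_mul_self l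
  have hcase : ∀ p ∈ paramSquare, (p.2 = 0 ∧ x p.1 ∈ interval a b ∧ h p = x p.1) ∨
      h p ∈ side Dm l := by
    rintro ⟨s, t⟩ ⟨hs, ht⟩
    rcases ht.1.eq_or_lt with rfl | ht0
    · exact Or.inl ⟨rfl, hx₀ s hs⟩
    · exact Or.inr (hD s hs t ⟨ht0, ht.2⟩)
  have hfull : ∀ p ∈ paramSquare, h p ∈ fullDomain a b Dm := by
    intro p hp
    rcases hcase p hp with ⟨-, h1, h2⟩ | h1
    · rw [h2]; exact ofReal_mem_fullDomain Dm h1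
    · exact side_subset_fullDomain a b Dm l h1
  have him : ∀ p ∈ paramSquare, 0 ≤ σ * (h p).im := by
    intro p hp
    rcases hcase p hp with ⟨-, h1, h2⟩ | h1
    · rw [h2]; simp
    · exact (hK.sign_mul_im_pos h1).le
  have hgp : ∀ p ∈ paramSquare, ‖g (h p)‖ ≤ M * ‖K' (h p)‖ := fun p hp =>
    hgK _ (hfull p hp) (him p hp)
  by_cases hinf : e = ⊥ ∨ e = ⊤
  · rw [endFilter, if_pos hinf] at hlim
    refine ⟨0, fun ρ => M * (C * ρ ^ N) * (2 / (ε * ρ)) ^ (N + 2), atTop, Or.inr rfl, ?_, ?_, ?_⟩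
    · simp only [Complex.ofReal_zero, sub_zero]
      exact tendsto_norm_cobounded_atTop.comp hlim
    · filter_upwards [eventually_ge_atTop R, eventually_ge_atTop (2 / ε)] with ρ h1 h2 p hp hpρ
      simp only [Complex.ofReal_zero, sub_zero] at hpρ
      subst hpρ
      rw [norm_mul]
      have b1 := (hgp p hp).trans (mul_le_mul_of_nonneg_left (hgrow p hp h1) hM)
      exact mul_le_mul b1 (norm_mollifier_le hσ hε _ h2) (norm_nonneg _)
        ((norm_nonneg _).trans b1)
    · have : Tendsto (fun ρ : ℝ => M * C * (2 / ε) ^ (N + 2) * ρ⁻¹) atTop (𝓝 0) := by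
        simpa using tendsto_inv_atTop_zero.const_mul (M * C * (2 / ε) ^ (N + 2))
      refine this.congr' ?_
      filter_upwards [eventually_gt_atTop 0] with ρ hρ
      rw [div_pow, div_pow, mul_pow]
      field_simp
      ring
  · obtain ⟨e', rfl⟩ : ∃ e' : ℝ, e = e' := by
      push Not at hinf
      exact ⟨e.toReal, (EReal.coe_toReal hinf.2 hinf.1).symm⟩
    rw [endFilter_coe] at hlim
    have hbd : EndpointBound Dm K' e' := by
      rcases he with he | he
      · exact hK.bound_left e' he.symm
      · exact hK.bound_right e' he.symm
    have hnot : e' ∉ interval a b := by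
      rintro ⟨h1, h2⟩
      rcases he with rfl | rfl
      · exact lt_irrefl _ h1
      · exact lt_irrefl _ h2
    have hne : ∀ p ∈ paramSquare, h p ≠ e' := by
      intro p hp heq
      rcases hcase p hp with ⟨-, h1, h2⟩ | h1
      · rw [heq] at h2
        rw [← Complex.ofReal_inj.1 h2] at h1
        exact hnot h1
      · have := hK.sign_mul_im_pos h1
        rw [heq] at this
        simp at this
    obtain ⟨C', hC', δ, hδ, ρ₀, hρ₀, hbound⟩ := hbd
    -- The endpoint bound is assumed off the real axis only; the edge t = 0 is reached by continuity
    -- as t → 0.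
    have hbp : ∀ p ∈ paramSquare, ‖h p - e'‖ < ρ₀ → ‖K' (h p)‖ ≤ C' * ‖h p - e'‖ ^ δ := by
      rintro ⟨s, t⟩ ⟨hs, ht⟩ hp
      rcases ht.1.eq_or_lt with rfl | ht0
      · have hcont : ContinuousWithinAt (fun t => h (s, t)) (Icc 0 1) 0 :=
          (hh.comp (by fun_prop) fun t ht => ⟨hs, ht⟩ : ContinuousOn (fun t => h (s, t)) _) 0 ht
        have hmem : ∀ᶠ t in 𝓝[>] (0 : ℝ), t ∈ Ioc (0 : ℝ) 1 := Ioc_mem_nhdsGT zero_lt_one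
        have hle : 𝓝[>] (0 : ℝ) ≤ 𝓝[Icc 0 1] 0 := by
          rw [← nhdsWithin_Ioc_eq_nhdsGT (zero_lt_one' ℝ)]
          exact nhdsWithin_mono _ Ioc_subset_Icc_self
        have ht1 : Tendsto (fun t => h (s, t)) (𝓝[>] 0) (𝓝 (h (s, 0))) := hcont.tendsto.mono_left hle
        have hKc : ContinuousAt K' (h (s, 0)) :=
          (hK.analytic.differentiableAt (hK.isOpen_full.mem_nhds (hfull _ ⟨hs, ht⟩))).continuousAt
        have h1 : Tendsto (fun t => ‖K' (h (s, t))‖) (𝓝[>] 0) (𝓝 ‖K' (h (s, 0))‖) :=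
          (hKc.tendsto.comp ht1).norm
        have h2 : Tendsto (fun t => ‖h (s, t) - e'‖) (𝓝[>] 0) (𝓝 ‖h (s, 0) - e'‖) :=
          (ht1.sub tendsto_const_nhds).norm
        have h3 : Tendsto (fun t => C' * ‖h (s, t) - e'‖ ^ δ) (𝓝[>] 0)
            (𝓝 (C' * ‖h (s, 0) - e'‖ ^ δ)) :=
          (h2.rpow_const (Or.inl (norm_ne_zero_iff.2 (sub_ne_zero.2 (hne _ ⟨hs, ht⟩))))).const_mul C'
        refine le_of_tendsto_of_tendsto h1 h3 ?_
        filter_upwards [hmem, h2.eventually_lt_const hp] with t ht hlt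
        exact hbound l _ (hD s hs t ht) hlt
      · exact hbound l _ (hD s hs t ⟨ht0, ht.2⟩) hp
    refine ⟨e', fun ρ => M * (C' * ρ ^ δ), 𝓝[>] 0, Or.inl ⟨rfl, hne⟩, ?_, ?_, ?_⟩
    · refine tendsto_nhdsWithin_iff.2 ⟨?_, ?_⟩
      · have := (hlim.sub (tendsto_const_nhds (x := (e' : ℂ)))).norm
        simpa using this
      · refine eventually_prod_principal_iff.2 ?_
        filter_upwards [hF] with s hs t ht
        exact norm_pos_iff.2 (sub_ne_zero.2 (hne _ ⟨hs, ht⟩))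
    · filter_upwards [Ioo_mem_nhdsGT hρ₀] with ρ hρ p hp hpρ
      rw [norm_mul]
      have b1 := (hgp p hp).trans
        (mul_le_mul_of_nonneg_left (hbp p hp (by rw [hpρ]; exact hρ.2)) hM)
      rw [hpρ] at b1
      exact (mul_le_of_le_one_right (norm_nonneg _)
        (norm_mollifier_le_one hε.le _ (him p hp))).trans b1
    · have h1 : Tendsto (fun ρ : ℝ => M * C' * ρ ^ (δ + 1)) (𝓝[>] 0) (𝓝 0) := by
        have h2 : ContinuousAt (fun ρ : ℝ => ρ ^ (δ + 1)) 0 :=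
          Real.continuousAt_rpow_const _ _ (Or.inr (by linarith [hδ.1]))
        have h3 := (h2.tendsto.mono_left (nhdsWithin_le_nhds (s := Ioi 0))).const_mul (M * C')
        rwa [Real.zero_rpow (by linarith [hδ.1]), mul_zero] at h3
      refine h1.congr' ?_
      filter_upwards [self_mem_nhdsWithin] with ρ hρ
      rw [Real.rpow_add hρ, Real.rpow_one]
      ring

/-- The point at infinity does not distinguish -∞ from ∞. Monotonicity does: near s = 0 the values
stay below x(1/2), so a lower bound y would keep them bounded. -/
theorem exists_lt_of_tendsto_endFilter {a b : EReal} {x : ℝ → ℝ} (hx : StrictMonoOn x (Ioo 0 1))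
    (hx₀ : ∀ s ∈ Ioo (0 : ℝ) 1, x s ∈ interval a b)
    (hlim : Tendsto (fun s => (x s : ℂ)) (𝓝[>] 0) (endFilter a)) {y : ℝ} (hy : y ∈ interval a b) :
    ∃ s ∈ Ioo (0 : ℝ) 1, x s < y := by
  by_contra! hcon
  have hmem : ∀ᶠ s in 𝓝[>] (0 : ℝ), s ∈ Ioo (0 : ℝ) (1 / 2) := Ioo_mem_nhdsGT (by norm_num)
  by_cases hinf : a = ⊥ ∨ a = ⊤
  · rw [endFilter, if_pos hinf] at hlim
    have h1 := (tendsto_norm_cobounded_atTop.comp hlim).eventually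
      (eventually_gt_atTop (max |y| |x (1 / 2)|))
    obtain ⟨s, hs, hs'⟩ := (h1.and hmem).exists
    have h3 := hcon s ⟨hs'.1, by linarith [hs'.2]⟩
    have h4 := (hx ⟨hs'.1, by linarith [hs'.2]⟩ ⟨by norm_num, by norm_num⟩ hs'.2).le
    simp only [Function.comp, Complex.norm_real, Real.norm_eq_abs] at hs
    exact absurd hs (not_lt.2 (abs_le_max_abs_abs h3 h4))
  · obtain ⟨e', rfl⟩ : ∃ e' : ℝ, a = e' := by
      push Not at hinf
      exact ⟨a.toReal, (EReal.coe_toReal hinf.2 hinf.1).symm⟩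
    rw [endFilter_coe] at hlim
    have h1 : Tendsto x (𝓝[>] 0) (𝓝 e') := by
      simpa [Function.comp_def] using (Complex.continuous_re.tendsto _).comp hlim
    obtain ⟨s, hs, hs'⟩ := ((h1.eventually_lt_const (EReal.coe_lt_coe_iff.1 hy.1)).and hmem).exists
    exact absurd hs (not_lt.2 (hcon s ⟨hs'.1, by linarith [hs'.2]⟩))

theorem exists_gt_of_tendsto_endFilter {a b : EReal} {x : ℝ → ℝ} (hx : StrictMonoOn x (Ioo 0 1))
    (hx₀ : ∀ s ∈ Ioo (0 : ℝ) 1, x s ∈ interval a b)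
    (hlim : Tendsto (fun s => (x s : ℂ)) (𝓝[<] 1) (endFilter b)) {y : ℝ} (hy : y ∈ interval a b) :
    ∃ s ∈ Ioo (0 : ℝ) 1, y < x s := by
  by_contra! hcon
  have hmem : ∀ᶠ s in 𝓝[<] (1 : ℝ), s ∈ Ioo (1 / 2 : ℝ) 1 := Ioo_mem_nhdsLT (by norm_num)
  by_cases hinf : b = ⊥ ∨ b = ⊤
  · rw [endFilter, if_pos hinf] at hlim
    have h1 := (tendsto_norm_cobounded_atTop.comp hlim).eventually
      (eventually_gt_atTop (max |x (1 / 2)| |y|))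
    obtain ⟨s, hs, hs'⟩ := (h1.and hmem).exists
    have h3 := hcon s ⟨by linarith [hs'.1], hs'.2⟩
    have h4 := (hx ⟨by norm_num, by norm_num⟩ ⟨by linarith [hs'.1], hs'.2⟩ hs'.1).le
    simp only [Function.comp, Complex.norm_real, Real.norm_eq_abs] at hs
    exact absurd hs (not_lt.2 (abs_le_max_abs_abs h4 h3))
  · obtain ⟨e', rfl⟩ : ∃ e' : ℝ, b = e' := by
      push Not at hinf
      exact ⟨b.toReal, (EReal.coe_toReal hinf.2 hinf.1).symm⟩
    rw [endFilter_coe] at hlim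
    have h1 : Tendsto x (𝓝[<] 1) (𝓝 e') := by
      simpa [Function.comp_def] using (Complex.continuous_re.tendsto _).comp hlim
    obtain ⟨s, hs, hs'⟩ :=
      ((h1.eventually_const_lt (EReal.coe_lt_coe_iff.1 hy.2)).and hmem).exists
    exact absurd hs (not_lt.2 (hcon s ⟨by linarith [hs'.1], hs'.2⟩))

theorem tendsto_setIntegral_mollifier {J : Set ℝ} (hJ : MeasurableSet J) {f v : ℝ → ℂ} {σ : ℝ}
    (hf : IntegrableOn f J) (hv : ContinuousOn v J) (him : ∀ s ∈ J, 0 ≤ σ * (v s).im) (m : ℕ)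
    (hm : ∀ ε > 0, ContinuousOn (mollifier σ ε m) {μ | 0 ≤ σ * μ.im}) :
    (∀ ε > 0, IntegrableOn (fun s => f s * mollifier σ ε m (v s)) J) ∧
    Tendsto (fun n : ℕ => ∫ s in J, f s * mollifier σ (1 / (n + 1)) m (v s)) atTop
      (𝓝 (∫ s in J, f s)) := by
  have hmeas : ∀ ε > 0, AEStronglyMeasurable (fun s => f s * mollifier σ ε m (v s))
      (volume.restrict J) := fun ε hε =>
    hf.aestronglyMeasurable.mul (((hm ε hε).comp hv him).aestronglyMeasurable hJ)
  have hle : ∀ ε > 0, ∀ᵐ s ∂(volume.restrict J), ‖f s * mollifier σ ε m (v s)‖ ≤ ‖f s‖ := by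
    intro ε hε
    refine (ae_restrict_iff' hJ).2 (Eventually.of_forall fun s hs => ?_)
    rw [norm_mul]
    exact mul_le_of_le_one_right (norm_nonneg _) (norm_mollifier_le_one hε.le m (him s hs))
  refine ⟨fun ε hε => Integrable.mono hf (hmeas ε hε) (hle ε hε), ?_⟩
  refine tendsto_integral_of_dominated_convergence (fun s => ‖f s‖)
    (fun n => hmeas _ (by positivity)) hf.norm (fun n => hle _ (by positivity)) ?_
  refine Eventually.of_forall fun s => ?_
  simpa using (tendsto_mollifier σ m (v s)).const_mul (f s)

/-- **Cauchy's theorem for admissible contours.** -/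
theorem IsAdmissible.integral_eq {a b : EReal} {Dm : Set ℂ} {K : ℝ → H₁ →L[ℂ] H₁}
    {K' : ℂ → H₁ →L[ℂ] H₁} (hK : IsContinuedDerivative a b Dm K K') {l : ℤˣ} {γ : ℝ → ℂ}
    (hγ : IsAdmissible a b (side Dm l) K' γ)
    (hKint : IntegrableOn (fun y : ℝ => ‖K' y‖) (interval a b))
    {g : ℂ → ℂ} {η M : ℝ} (hη : 0 < η) (hM : 0 ≤ M)
    (hg : DifferentiableOn ℂ g (fullDomain a b Dm ∩ {z | -η < ((l : ℤ) : ℝ) * z.im}))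
    (hgK : ∀ z ∈ fullDomain a b Dm, 0 ≤ ((l : ℤ) : ℝ) * z.im → ‖g z‖ ≤ M * ‖K' z‖) :
    IntegrableOn (fun s => deriv γ s * g (γ s)) (Ioo 0 1) ∧
    IntegrableOn (fun y : ℝ => g y) (interval a b) ∧
    ∫ s in Ioo (0 : ℝ) 1, deriv γ s * g (γ s) = ∫ y in interval a b, g y := by
  obtain ⟨h, hh, ⟨x, hx, hx₀⟩, hhγ, hD, hl, hr, R, C, N, hgrow⟩ := hγ.deformation
  set σ : ℝ := ((l : ℤ) : ℝ) with hσdef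
  have hσ : σ * σ = 1 := sign_mul_self l
  have hsubD := side_subset_fullDomain a b Dm l
  have hopen : ∀ η : ℝ, IsOpen (fullDomain a b Dm ∩ {z | -η < σ * z.im}) := fun η =>
    hK.isOpen_full.inter (isOpen_lt continuous_const (by fun_prop))
  have hgcont : ContinuousOn g (fullDomain a b Dm ∩ {z | 0 ≤ σ * z.im}) :=
    hg.continuousOn.mono (inter_subset_inter_right _ fun z (hz : 0 ≤ σ * z.im) =>
      show -η < σ * z.im by linarith)
  have hγD : ∀ s ∈ Ioo (0 : ℝ) 1, γ s ∈ fullDomain a b Dm ∩ {z | 0 ≤ σ * z.im} := fun s hs =>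
    ⟨hsubD (hγ.mapsTo hs), (hK.sign_mul_im_pos (hγ.mapsTo hs)).le⟩
  have hyD : ∀ y ∈ interval a b, (y : ℂ) ∈ fullDomain a b Dm ∩ {z | 0 ≤ σ * z.im} := fun y hy =>
    ⟨ofReal_mem_fullDomain Dm hy, by simp⟩
  have hint : IntegrableOn (fun s => deriv γ s * g (γ s)) (Ioo 0 1) := by
    refine Integrable.mono (hγ.finite_variation.const_mul M) ?_ ?_
    · exact (measurable_deriv γ).aestronglyMeasurable.mul
        ((hgcont.comp hγ.locallyLipschitz.continuousOn hγD).aestronglyMeasurable measurableSet_Ioo)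
    · refine (ae_restrict_iff' measurableSet_Ioo).2 (Eventually.of_forall fun s hs => ?_)
      have := hgK _ (hγD s hs).1 (hγD s hs).2
      rw [norm_mul, Real.norm_of_nonneg (by positivity)]
      calc _ ≤ ‖deriv γ s‖ * (M * ‖K' (γ s)‖) := by gcongr
        _ = _ := by ring
  have hint₀ : IntegrableOn (fun y : ℝ => g y) (interval a b) := by
    refine Integrable.mono (hKint.const_mul M) ?_ ?_
    · exact (hgcont.comp Complex.continuous_ofReal.continuousOn hyD).aestronglyMeasurable
        (measurableSet_interval a b)
    · refine (ae_restrict_iff' (measurableSet_interval a b)).2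
        (Eventually.of_forall fun y hy => ?_)
      rw [Real.norm_of_nonneg (by positivity)]
      exact hgK _ (hyD y hy).1 (hyD y hy).2
  refine ⟨hint, hint₀, ?_⟩
  have hmc : ∀ ε > 0, ContinuousOn (mollifier σ ε (N + 2)) {μ | 0 ≤ σ * μ.im} := fun ε hε =>
    (differentiableOn_mollifier hε (N + 2)).continuousOn.mono fun μ (hμ : 0 ≤ σ * μ.im) =>
      show -(1 / ε) < σ * μ.im from lt_of_lt_of_le (by simpa using hε) hμ
  obtain ⟨I₁, T₁⟩ := tendsto_setIntegral_mollifier (σ := σ) measurableSet_Ioo hint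
    hγ.locallyLipschitz.continuousOn (fun s hs => (hγD s hs).2) (N + 2) hmc
  obtain ⟨I₂, T₂⟩ := tendsto_setIntegral_mollifier (σ := σ) (measurableSet_interval a b) hint₀
    Complex.continuous_ofReal.continuousOn (fun y hy => (hyD y hy).2) (N + 2) hmc
  -- Both integrals are limits of mollified ones, so a fixed ε suffices.
  refine tendsto_nhds_unique T₁ (T₂.congr fun n => ?_)
  set ε : ℝ := 1 / (n + 1) with hεdef
  have hε : 0 < ε := by positivity
  have hcase : ∀ p ∈ paramSquare, h p ∈ fullDomain a b Dm ∧ 0 ≤ σ * (h p).im := by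
    rintro ⟨s, t⟩ ⟨hs, ht⟩
    rcases ht.1.eq_or_lt with rfl | ht0
    · rw [(hx₀ s hs).2]
      exact hyD _ (hx₀ s hs).1
    · have := hD s hs t ⟨ht0, ht.2⟩
      exact ⟨hsubD this, (hK.sign_mul_im_pos this).le⟩
  have htend₀ : ∀ {F : Filter ℝ} {e : EReal}, (∀ᶠ s in F, s ∈ Ioo (0 : ℝ) 1) →
      Tendsto h (F ×ˢ 𝓟 (Icc 0 1)) (endFilter e) →
      Tendsto (fun s => (x s : ℂ)) F (endFilter e) := by
    intro F e hF hlim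
    have h1 : Tendsto (fun s : ℝ => (s, (0 : ℝ))) F (F ×ˢ 𝓟 (Icc 0 1)) :=
      tendsto_id.prodMk (tendsto_principal.2 (Eventually.of_forall fun _ => by simp))
    refine (hlim.comp h1).congr' ?_
    filter_upwards [hF] with s hs using (hx₀ s hs).2
  have hF₀ : ∀ᶠ s in 𝓝[>] (0 : ℝ), s ∈ Ioo (0 : ℝ) 1 := Ioo_mem_nhdsGT zero_lt_one
  have hF₁ : ∀ᶠ s in 𝓝[<] (1 : ℝ), s ∈ Ioo (0 : ℝ) 1 := Ioo_mem_nhdsLT zero_lt_one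
  -- The deformation starts on the real axis, so an open domain reaching slightly across it is
  -- needed: η is the margin for g and 1/ε that for the mollifier.
  have key := integral_eq_of_deformation (g := fun μ => g μ * mollifier σ ε (N + 2) μ) hσ
    ((hopen η).inter (hopen (1 / ε)))
    ((hg.mono inter_subset_left).mul ((differentiableOn_mollifier hε (N + 2)).mono
      (inter_subset_right.trans inter_subset_right))) hh
    (fun p hp => by
      obtain ⟨h1, h2⟩ := hcase p hp
      have h3 : (0 : ℝ) < 1 / ε := by positivity
      exact ⟨⟨h1, show -η < _ by linarith⟩, ⟨h1, show -(1 / ε) < _ by linarith⟩⟩)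
    (fun p hp => (hcase p hp).2) hx hx₀
    (fun y hy => exists_lt_of_tendsto_endFilter hx (fun s hs => (hx₀ s hs).1)
      (htend₀ hF₀ hl) hy)
    (fun y hy => exists_gt_of_tendsto_endFilter hx (fun s hs => (hx₀ s hs).1)
      (htend₀ hF₁ hr) hy)
    hγ.locallyLipschitz hhγ (by simpa only [mul_assoc] using I₁ ε hε) (I₂ ε hε)
    (endControl_mollifier hK hM hgK hh hx₀ hD hgrow hε (Or.inl rfl) hF₀ hl)
    (endControl_mollifier hK hM hgK hh hx₀ hD hgrow hε (Or.inr rfl) hF₁ hr)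
  rw [← key]
  simp only [mul_assoc]

end Cauchy

/-! ### The spectral function: monotonicity and quadratic forms -/

section SpectralFunction

variable {H₀ : Type*} [NormedAddCommGroup H₀] [InnerProductSpace ℂ H₀] [CompleteSpace H₀]

theorem ProjMeasure.norm_apply_mono (E : ProjMeasure H₀) (x : H₀) {s t : Set ℝ}
    (hs : MeasurableSet s) (ht : MeasurableSet t) (hst : s ⊆ t) :
    ‖E.toFun s x‖ ^ 2 ≤ ‖E.toFun t x‖ ^ 2 := by
  have h := measure_mono (μ := E.scalar x) hst
  rw [ProjMeasure.scalar, Measure.ofMeasurable_apply s hs, Measure.ofMeasurable_apply t ht] at h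
  exact (ENNReal.ofReal_le_ofReal_iff (by positivity)).1 h

theorem ProjMeasure.inner_eq_norm_sq (E : ProjMeasure H₀) {s : Set ℝ} (hs : MeasurableSet s)
    (x : H₀) : inner ℂ x (E.toFun s x) = ((‖E.toFun s x‖ ^ 2 : ℝ) : ℂ) := by
  have hP := E.isStarProjection s hs
  have h2 : E.toFun s (E.toFun s x) = E.toFun s x :=
    congrArg (fun T : H₀ →L[ℂ] H₀ => T x) hP.isIdempotentElem
  have h4 : ContinuousLinearMap.adjoint (E.toFun s) = E.toFun s := hP.isSelfAdjoint
  rw [← h2, ← ContinuousLinearMap.adjoint_inner_left, h4, h2, inner_self_eq_norm_sq_to_K]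
  norm_cast

end SpectralFunction

/-- For monotone k the integral of k' over [-n, n] is at most the increment of k, even without
absolute continuity. -/
theorem integrableOn_deriv_of_monotone_of_bounded {k : ℝ → ℝ} {M : ℝ} (hk : Monotone k)
    (h0 : ∀ y, 0 ≤ k y) (hM : ∀ y, k y ≤ M) : Integrable (deriv k) := by
  have hcov : AECover (volume : Measure ℝ) atTop fun n : ℕ => Ioc (-(n : ℝ)) n :=
    aecover_Ioc (tendsto_neg_atTop_atBot.comp tendsto_natCast_atTop_atTop)
      tendsto_natCast_atTop_atTop
  have hle : ∀ n : ℕ, -(n : ℝ) ≤ n := fun n => by linarith [n.cast_nonneg (α := ℝ)]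
  refine hcov.integrable_of_integral_bounded_of_nonneg_ae M (fun n => ?_)
    (Eventually.of_forall fun y => hk.deriv_nonneg) (Eventually.of_forall fun n => ?_)
  · exact (hk.monotoneOn (uIcc (-(n : ℝ)) n)).intervalIntegrable_deriv.1
  · have := (hk.monotoneOn (uIcc (-(n : ℝ)) n)).intervalIntegral_deriv_mem_uIcc
    rw [intervalIntegral.integral_of_le (hle n), uIcc_of_le (sub_nonneg.2 (hk (hle n)))] at this
    linarith [this.2, h0 (-(n : ℝ)), hM n]

theorem norm_le_sum_of_inner {V : Type*} [NormedAddCommGroup V] [InnerProductSpace ℂ V] {ι : Type*}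
    [Fintype ι] (e : OrthonormalBasis ι ℂ V)
    (T : V →L[ℂ] V) : ‖T‖ ≤ ∑ j, ∑ i, ‖inner ℂ (e i) (T (e j))‖ := by
  refine T.opNorm_le_bound (by positivity) fun v => ?_
  have h1 : ∀ w : V, ‖w‖ ≤ ∑ i, ‖inner ℂ (e i) w‖ := by
    intro w
    conv_lhs => rw [← e.sum_repr' w]
    refine (norm_sum_le _ _).trans (Finset.sum_le_sum fun i _ => ?_)
    rw [norm_smul, e.orthonormal.1 i, mul_one]
  have h2 : ∀ j, ‖inner ℂ (e j) v‖ ≤ ‖v‖ := fun j => by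
    simpa [e.orthonormal.1 j] using norm_inner_le_norm (𝕜 := ℂ) (e j) v
  conv_lhs => rw [← e.sum_repr' v]
  rw [map_sum, Finset.sum_mul]
  refine (norm_sum_le _ _).trans (Finset.sum_le_sum fun j _ => ?_)
  rw [map_smul, norm_smul, mul_comm]
  exact mul_le_mul (h1 _) (h2 j) (norm_nonneg _) (by positivity)

/-! ### Positivity and integrability of K' on the interval -/

section Derivative

variable {H₀ : Type*} [NormedAddCommGroup H₀] [InnerProductSpace ℂ H₀] [CompleteSpace H₀]
  {H₁ : Type*} [NormedAddCommGroup H₁] [InnerProductSpace ℂ H₁] [CompleteSpace H₁]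

/-- On the interval, the form of `K'` is real, nonnegative and integrable. -/
theorem IsContinuedDerivative.exists_integrable_form {E₀ : ProjMeasure H₀} {B : H₁ →L[ℂ] H₀}
    {a b : EReal} {Dm : Set ℂ} {K' : ℂ → H₁ →L[ℂ] H₁}
    (hK : IsContinuedDerivative a b Dm
      (fun μ => ContinuousLinearMap.adjoint B ∘L E₀.spectralFunction μ ∘L B) K') (x : H₁) :
    ∃ q : ℝ → ℝ, Integrable q ∧ (∀ y, 0 ≤ q y) ∧
      ∀ y ∈ interval a b, inner ℂ x (K' y x) = (q y : ℂ) := by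
  set k : ℝ → ℝ := fun y => ‖E₀.toFun (Iio y) (B x)‖ ^ 2 with hk
  have hmono : Monotone k := fun y z hyz =>
    E₀.norm_apply_mono (B x) measurableSet_Iio measurableSet_Iio (Iio_subset_Iio hyz)
  have hbd : ∀ y, k y ≤ ‖B x‖ ^ 2 := by
    intro y
    have := E₀.norm_apply_mono (B x) (measurableSet_Iio (a := y)) MeasurableSet.univ
      (subset_univ _)
    rwa [E₀.map_univ] at this
  refine ⟨deriv k, integrableOn_deriv_of_monotone_of_bounded hmono (fun y => by positivity) hbd,
    fun y => hmono.deriv_nonneg, fun y hy => ?_⟩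
  have h2 : HasDerivAt (fun μ : ℝ => inner ℂ x
      ((ContinuousLinearMap.adjoint B ∘L E₀.spectralFunction μ ∘L B) x)) (inner ℂ x (K' y x)) y :=
    (((innerSL ℂ x).comp (ContinuousLinearMap.apply ℂ H₁ x)).restrictScalars
      ℝ).hasFDerivAt.comp_hasDerivAt y (hK.hasDerivAt y hy)
  have h3 : (fun μ : ℝ => inner ℂ x
      ((ContinuousLinearMap.adjoint B ∘L E₀.spectralFunction μ ∘L B) x)) =
      fun μ => (k μ : ℂ) := by
    ext μ
    rw [ContinuousLinearMap.comp_apply, ContinuousLinearMap.comp_apply,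
      ContinuousLinearMap.adjoint_inner_right]
    exact E₀.inner_eq_norm_sq measurableSet_Iio (B x)
  rw [h3] at h2
  have h4 : HasDerivAt k (inner ℂ x (K' y x)).re y :=
    Complex.reCLM.hasFDerivAt.comp_hasDerivAt y h2
  rw [h4.deriv]
  have h5 := h4.ofReal_comp
  exact h2.unique h5

/-- Quadratic forms of K' are derivatives of bounded monotone functions, hence integrable.
Polarization passes to all matrix entries, and in finite dimension these dominate the norm. -/
theorem IsContinuedDerivative.integrableOn_norm [FiniteDimensional ℂ H₁] {E₀ : ProjMeasure H₀}
    {B : H₁ →L[ℂ] H₀} {a b : EReal} {Dm : Set ℂ} {K' : ℂ → H₁ →L[ℂ] H₁}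
    (hK : IsContinuedDerivative a b Dm
      (fun μ => ContinuousLinearMap.adjoint B ∘L E₀.spectralFunction μ ∘L B) K') :
    IntegrableOn (fun y : ℝ => ‖K' y‖) (interval a b) := by
  have hcont : ContinuousOn (fun y : ℝ => K' y) (interval a b) :=
    hK.analytic.continuousOn.comp Complex.continuous_ofReal.continuousOn
      fun y hy => ofReal_mem_fullDomain Dm hy
  have hquad : ∀ x : H₁, IntegrableOn (fun y : ℝ => inner ℂ x (K' y x)) (interval a b) := by
    intro x
    obtain ⟨q, hq, -, hqe⟩ := hK.exists_integrable_form x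
    exact (hq.ofReal.integrableOn (s := interval a b)).congr_fun (fun y hy => (hqe y hy).symm)
      (measurableSet_interval a b)
  have hform : ∀ u v : H₁, IntegrableOn (fun y : ℝ => inner ℂ u (K' y v)) (interval a b) := by
    intro u v
    have hc : ∀ x : H₁, IntegrableOn (fun y : ℝ => inner ℂ (K' y x) x) (interval a b) := by
      intro x
      have := (RCLike.conjCLE (K := ℂ)).toContinuousLinearMap.integrable_comp (hquad x)
      refine this.congr (Eventually.of_forall fun y => ?_)
      simp [inner_conj_symm]
    have hc' : IntegrableOn (fun y : ℝ => inner ℂ (K' y v) u) (interval a b) := by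
      have := ((((hc (u + v)).sub (hc (u - v))).add ((hc (u + Complex.I • v)).const_mul Complex.I)).sub
        ((hc (u - Complex.I • v)).const_mul Complex.I)).div_const 4
      refine this.congr (Eventually.of_forall fun y => ?_)
      exact (inner_map_polarization (K' y : H₁ →ₗ[ℂ] H₁) u v).symm
    have := (RCLike.conjCLE (K := ℂ)).toContinuousLinearMap.integrable_comp hc'
    refine this.congr (Eventually.of_forall fun y => ?_)
    simp [inner_conj_symm]
  set e := stdOrthonormalBasis ℂ H₁
  have hsum : IntegrableOn (fun y : ℝ => ∑ j, ∑ i, ‖inner ℂ (e i) (K' y (e j))‖) (interval a b) :=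
    integrable_finsetSum _ fun j _ => integrable_finsetSum _ fun i _ => (hform _ _).norm
  refine Integrable.mono hsum (hcont.norm.aestronglyMeasurable (measurableSet_interval a b))
    (Eventually.of_forall fun y => ?_)
  rw [Real.norm_of_nonneg (norm_nonneg _)]
  exact (norm_le_sum_of_inner e (K' y)).trans (le_abs_self _)

end Derivative

/-! ### Resolvent bounds in finite dimension -/

section Resolvent

variable {V : Type*} [NormedAddCommGroup V] [InnerProductSpace ℂ V] [CompleteSpace V]
  [FiniteDimensional ℂ V]

theorem mem_spectrum_iff_exists_eigenvector {T : V →L[ℂ] V} {z : ℂ} :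
    z ∈ spectrum ℂ T ↔ ∃ x, x ≠ 0 ∧ T x = z • x := by
  have hsurj : ∀ S : V →L[ℂ] V, IsUnit S ↔ Function.Injective S := fun S => by
    rw [ContinuousLinearMap.isUnit_iff_bijective]
    exact ⟨fun h => h.1, fun h => ⟨h, (LinearMap.injective_iff_surjective
      (f := (S : V →ₗ[ℂ] V))).1 h⟩⟩
  rw [spectrum.mem_iff, hsurj, injective_iff_map_eq_zero]
  push Not
  refine exists_congr fun x => ?_
  rw [and_comm]
  refine and_congr_right fun _ => ?_
  rw [sub_apply, sub_eq_zero, Algebra.algebraMap_eq_smul_one]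
  simp [eq_comm]

theorem isUnit_and_norm_inverse_le {T : V →L[ℂ] V} {c : ℝ} (hc : 0 < c)
    (hT : ∀ x, c * ‖x‖ ≤ ‖T x‖) : IsUnit T ∧ ‖Ring.inverse T‖ ≤ c⁻¹ := by
  have hinj : Function.Injective T := by
    rw [injective_iff_map_eq_zero]
    intro x hx
    have := hT x
    rw [hx, norm_zero] at this
    exact norm_le_zero_iff.1 (nonpos_of_mul_nonpos_right this hc)
  have hu : IsUnit T := ContinuousLinearMap.isUnit_iff_bijective.2
    ⟨hinj, (LinearMap.injective_iff_surjective (f := (T : V →ₗ[ℂ] V))).1 hinj⟩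
  refine ⟨hu, ContinuousLinearMap.opNorm_le_bound _ (by positivity) fun y => ?_⟩
  have h1 : T (Ring.inverse T y) = y :=
    congrArg (fun S : V →L[ℂ] V => S y) (Ring.mul_inverse_cancel T hu)
  have h2 := hT (Ring.inverse T y)
  rw [h1] at h2
  rw [inv_mul_eq_div, le_div_iff₀ hc]
  linarith

theorem mul_norm_le_norm_sub_apply {A : V →L[ℂ] V} (hA : IsSelfAdjoint A) {μ : ℂ} {d : ℝ}
    (hd0 : 0 ≤ d) (hd : ∀ z ∈ spectrum ℂ A, d ≤ dist z μ) (x : V) :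
    d * ‖x‖ ≤ ‖A x - μ • x‖ := by
  have hsym : (A : V →ₗ[ℂ] V).IsSymmetric := hA.isSymmetric
  set e := hsym.eigenvectorBasis rfl with he
  have hei : ∀ i, A (e i) = (hsym.eigenvalues rfl i : ℂ) • e i := fun i =>
    hsym.apply_eigenvectorBasis rfl i
  have hin : ∀ i, inner ℂ (e i) (A x - μ • x) =
      ((hsym.eigenvalues rfl i : ℂ) - μ) * inner ℂ (e i) x := by
    intro i
    have h1 : inner ℂ (e i) (A x) = (hsym.eigenvalues rfl i : ℂ) * inner ℂ (e i) x := by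
      have h2 : inner ℂ (A (e i)) x = inner ℂ (e i) (A x) := hsym (e i) x
      rw [← h2, hei, inner_smul_left]
      simp
    rw [inner_sub_right, inner_smul_right, h1]
    ring
  have hsq : (d * ‖x‖) ^ 2 ≤ ‖A x - μ • x‖ ^ 2 := by
    rw [mul_pow, ← e.sum_sq_norm_inner_right x, ← e.sum_sq_norm_inner_right (A x - μ • x),
      Finset.mul_sum]
    refine Finset.sum_le_sum fun i _ => ?_
    rw [hin, norm_mul, mul_pow]
    have hmem : (hsym.eigenvalues rfl i : ℂ) ∈ spectrum ℂ A :=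
      mem_spectrum_iff_exists_eigenvector.2 ⟨e i, e.orthonormal.ne_zero i, hei i⟩
    have := hd _ hmem
    rw [dist_eq_norm] at this
    gcongr
  exact le_of_sq_le_sq (a := d * ‖x‖) hsq (norm_nonneg _)

/-- For self-adjoint A the distance d to the spectrum bounds A - μ from below, and Y costs at most r
of it. -/
theorem isUnit_add_sub_and_norm_inverse_le {A Y : V →L[ℂ] V} (hA : IsSelfAdjoint A) {μ : ℂ}
    {d r : ℝ} (hd : ∀ z ∈ spectrum ℂ A, d ≤ dist z μ) (hY : ‖Y‖ ≤ r) (hr : r < d) :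
    IsUnit (A + Y - μ • (1 : V →L[ℂ] V)) ∧
      ‖Ring.inverse (A + Y - μ • (1 : V →L[ℂ] V))‖ ≤ (d - r)⁻¹ := by
  refine isUnit_and_norm_inverse_le (sub_pos.2 hr) fun x => ?_
  have h1 := mul_norm_le_norm_sub_apply hA (((norm_nonneg Y).trans hY).trans hr.le) hd x
  have h2 : ‖Y x‖ ≤ r * ‖x‖ := (Y.le_opNorm x).trans (by gcongr)
  have h3 : (A + Y - μ • (1 : V →L[ℂ] V)) x = (A x - μ • x) + Y x := by
    simp
    abel
  rw [h3]
  have h4 := norm_sub_le_norm_add (A x - μ • x) (Y x)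
  linarith

theorem dist_spectrum_le {A Y : V →L[ℂ] V} (hA : IsSelfAdjoint A) {z : ℂ}
    (hz : z ∈ spectrum ℂ (A + Y)) : ∃ w ∈ spectrum ℂ A, dist w z ≤ ‖Y‖ := by
  by_contra! hcon
  have hcpt : IsCompact (spectrum ℂ A) := spectrum.isCompact A
  obtain ⟨d, hd, hdY⟩ : ∃ d, (∀ w ∈ spectrum ℂ A, d ≤ dist w z) ∧ ‖Y‖ < d := by
    rcases (spectrum ℂ A).eq_empty_or_nonempty with h0 | hne
    · exact ⟨‖Y‖ + 1, by simp [h0], by linarith⟩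
    · obtain ⟨w, hw, hmin⟩ := hcpt.exists_isMinOn hne
        (f := fun w => dist w z) (by fun_prop)
      exact ⟨dist w z, fun v hv => hmin hv, hcon w hw⟩
  have := (isUnit_add_sub_and_norm_inverse_le hA hd le_rfl hdY).1
  refine spectrum.mem_iff.1 hz ?_
  rw [Algebra.algebraMap_eq_smul_one, ← neg_sub]
  exact this.neg

/-- If `σ Im Z ≤ -κ` then `Z - μ` is invertible for `σ Im μ > -κ`. -/
theorem isUnit_and_norm_inverse_le_of_im {Z : V →L[ℂ] V} {σ κ c : ℝ} (hσ : σ * σ = 1)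
    (hZ : ∀ x, σ * (inner ℂ x (Z x)).im ≤ -κ * ‖x‖ ^ 2) {μ : ℂ} (hc : 0 < c)
    (hμ : c - κ ≤ σ * μ.im) : IsUnit (Z - μ • (1 : V →L[ℂ] V)) ∧
      ‖Ring.inverse (Z - μ • (1 : V →L[ℂ] V))‖ ≤ c⁻¹ := by
  refine isUnit_and_norm_inverse_le hc fun x => ?_
  rcases eq_or_ne x 0 with rfl | hx
  · simp
  have hx0 : 0 < ‖x‖ := norm_pos_iff.2 hx
  have h1 : (inner ℂ x ((Z - μ • (1 : V →L[ℂ] V)) x)).im =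
      (inner ℂ x (Z x)).im - μ.im * ‖x‖ ^ 2 := by
    have h2 : inner ℂ x ((Z - μ • (1 : V →L[ℂ] V)) x) =
        inner ℂ x (Z x) - μ * ((‖x‖ ^ 2 : ℝ) : ℂ) := by
      rw [sub_apply, inner_sub_right, smul_apply,
        one_apply_eq_self, inner_smul_right, inner_self_eq_norm_sq_to_K]
      norm_cast
    rw [h2, Complex.sub_im, Complex.mul_im, Complex.ofReal_im, Complex.ofReal_re]
    ring
  have hσ' : |σ| = 1 := by rcases mul_self_eq_one_iff.1 hσ with rfl | rfl <;> simp
  have h3 : -(σ * (inner ℂ x ((Z - μ • (1 : V →L[ℂ] V)) x)).im) ≤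
      ‖x‖ * ‖(Z - μ • (1 : V →L[ℂ] V)) x‖ := by
    refine le_trans ?_ (norm_inner_le_norm (𝕜 := ℂ) x _)
    refine le_trans ?_ (Complex.abs_im_le_norm _)
    refine (neg_le_abs _).trans ?_
    rw [abs_mul, hσ', one_mul]
  rw [h1] at h3
  have h4 := hZ x
  have h5 : c * ‖x‖ ^ 2 ≤ (κ + σ * μ.im) * ‖x‖ ^ 2 := by
    gcongr
    linarith
  have h6 : ‖x‖ * (c * ‖x‖) ≤ ‖x‖ * ‖(Z - μ • (1 : V →L[ℂ] V)) x‖ := by nlinarith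
  exact le_of_mul_le_mul_left h6 hx0

end Resolvent

/-! ### The operator-valued contour integral -/

section ContourIntegral

theorem IsContinuedDerivative.continuousOn_comp {V : Type*} [NormedAddCommGroup V]
    [InnerProductSpace ℂ V] {a b : EReal}
    {Dm : Set ℂ} {K : ℝ → V →L[ℂ] V}
    {K' : ℂ → V →L[ℂ] V} (hK : IsContinuedDerivative a b Dm K K') {l : ℤˣ} {γ : ℝ → ℂ}
    (hγ : IsAdmissible a b (side Dm l) K' γ) : ContinuousOn (fun s => K' (γ s)) (Ioo 0 1) :=
  hK.analytic.continuousOn.comp hγ.locallyLipschitz.continuousOn fun _ hs =>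
    side_subset_fullDomain a b Dm l (hγ.mapsTo hs)

theorem continuousOn_inverse_sub {V : Type*} [NormedAddCommGroup V]
    [InnerProductSpace ℂ V] [CompleteSpace V] {γ : ℝ → ℂ} {J : Set ℝ}
    (hγ : ContinuousOn γ J) {Z : V →L[ℂ] V}
    (hZ : ∀ s ∈ J, IsUnit (Z - γ s • (1 : V →L[ℂ] V))) :
    ContinuousOn (fun s => Ring.inverse (Z - γ s • (1 : V →L[ℂ] V))) J := by
  intro s hs
  obtain ⟨u, hu⟩ := hZ s hs
  have h1 : ContinuousWithinAt (fun s => Z - γ s • (1 : V →L[ℂ] V)) J s :=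
    continuousWithinAt_const.sub ((hγ s hs).smul continuousWithinAt_const)
  have h2 := NormedRing.inverse_continuousAt u
  rw [hu] at h2
  exact ContinuousAt.comp_continuousWithinAt (g := Ring.inverse)
    (f := fun s => Z - γ s • (1 : V →L[ℂ] V)) h2 h1

variable {V : Type*} [NormedAddCommGroup V] [InnerProductSpace ℂ V] [CompleteSpace V]
  [FiniteDimensional ℂ V]

/-- `∫_Γ dμ K'(μ) (Z - μ)⁻¹`. -/
noncomputable def resolventIntegral (K' : ℂ → V →L[ℂ] V) (γ : ℝ → ℂ) (Z : V →L[ℂ] V) : V →L[ℂ] V :=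
  ∫ s in Ioo (0 : ℝ) 1, deriv γ s • (K' (γ s) * Ring.inverse (Z - γ s • (1 : V →L[ℂ] V)))

theorem integrableOn_resolvent {a b : EReal} {Dm : Set ℂ} {K : ℝ → V →L[ℂ] V}
    {K' : ℂ → V →L[ℂ] V} (hK : IsContinuedDerivative a b Dm K K') {l : ℤˣ} {γ : ℝ → ℂ}
    (hγ : IsAdmissible a b (side Dm l) K' γ) {Z : V →L[ℂ] V} {M : ℝ}
    (hZ : ∀ s ∈ Ioo (0 : ℝ) 1, IsUnit (Z - γ s • (1 : V →L[ℂ] V)) ∧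
      ‖Ring.inverse (Z - γ s • (1 : V →L[ℂ] V))‖ ≤ M) :
    IntegrableOn (fun s => deriv γ s • (K' (γ s) * Ring.inverse (Z - γ s • (1 : V →L[ℂ] V))))
      (Ioo 0 1) ∧ ‖resolventIntegral K' γ Z‖ ≤ M * variation K' γ := by
  have hinv := continuousOn_inverse_sub hγ.locallyLipschitz.continuousOn fun s hs => (hZ s hs).1
  have hbound : ∀ᵐ s ∂(volume.restrict (Ioo (0 : ℝ) 1)),
      ‖deriv γ s • (K' (γ s) * Ring.inverse (Z - γ s • (1 : V →L[ℂ] V)))‖ ≤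
        M * (‖deriv γ s‖ * ‖K' (γ s)‖) := by
    refine (ae_restrict_iff' measurableSet_Ioo).2 (Eventually.of_forall fun s hs => ?_)
    rw [norm_smul]
    calc _ ≤ ‖deriv γ s‖ * (‖K' (γ s)‖ * M) := by
          gcongr
          exact (norm_mul_le _ _).trans (by gcongr; exact (hZ s hs).2)
      _ = _ := by ring
  have hint := hγ.finite_variation.const_mul M
  refine ⟨Integrable.mono' hint ?_ hbound, ?_⟩
  · exact (measurable_deriv γ).aestronglyMeasurable.smul
      (((hK.continuousOn_comp hγ).mul hinv).aestronglyMeasurable measurableSet_Ioo)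
  · rw [variation, ← integral_const_mul]
    exact norm_integral_le_of_norm_le hint hbound

/-- If `σ Im Z < 0` then the contour of the resolvent integral can be moved to the interval. -/
theorem inner_resolventIntegral_eq {a b : EReal} {Dm : Set ℂ} {K : ℝ → V →L[ℂ] V}
    {K' : ℂ → V →L[ℂ] V} (hK : IsContinuedDerivative a b Dm K K')
    (hKint : IntegrableOn (fun y : ℝ => ‖K' y‖) (interval a b)) {l : ℤˣ} {γ : ℝ → ℂ}
    (hγ : IsAdmissible a b (side Dm l) K' γ) {Z : V →L[ℂ] V} {κ : ℝ} (hκ : 0 < κ)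
    (hZ : ∀ x, ((l : ℤ) : ℝ) * (inner ℂ x (Z x)).im ≤ -κ * ‖x‖ ^ 2) (u v : V) :
    inner ℂ u (resolventIntegral K' γ Z v) = ∫ y in interval a b,
      inner ℂ u ((K' y * Ring.inverse (Z - (y : ℂ) • (1 : V →L[ℂ] V))) v) := by
  set σ : ℝ := ((l : ℤ) : ℝ)
  have hσ : σ * σ = 1 := sign_mul_self l
  -- Giving away half of κ leaves a strip across the real axis with a uniform resolvent bound, as
  -- Cauchy's theorem demands.
  have hinv : ∀ μ : ℂ, -(κ / 2) < σ * μ.im → IsUnit (Z - μ • (1 : V →L[ℂ] V)) ∧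
      ‖Ring.inverse (Z - μ • (1 : V →L[ℂ] V))‖ ≤ (κ / 2)⁻¹ := fun μ hμ =>
    isUnit_and_norm_inverse_le_of_im hσ hZ (by positivity) (by linarith)
  have hint := (integrableOn_resolvent hK hγ fun s hs => hinv (γ s) (by
    have := hK.sign_mul_im_pos (hγ.mapsTo hs)
    change 0 < σ * (γ s).im at this
    linarith)).1
  set g : ℂ → ℂ := fun μ => inner ℂ u ((K' μ * Ring.inverse (Z - μ • (1 : V →L[ℂ] V))) v)
  have hgd : DifferentiableOn ℂ g (fullDomain a b Dm ∩ {z | -(κ / 2) < σ * z.im}) := by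
    rintro μ ⟨hμ, hμ'⟩
    have h1 : DifferentiableAt ℂ K' μ :=
      hK.analytic.differentiableAt (hK.isOpen_full.mem_nhds hμ)
    have h2 : DifferentiableAt ℂ (fun μ : ℂ => Z - μ • (1 : V →L[ℂ] V)) μ := by fun_prop
    have h3 : DifferentiableAt ℂ (fun μ : ℂ => Ring.inverse (Z - μ • (1 : V →L[ℂ] V))) μ :=
      DifferentiableAt.comp (g := Ring.inverse) (f := fun μ : ℂ => Z - μ • (1 : V →L[ℂ] V)) μ
        (differentiableAt_inverse (hinv μ hμ').1) h2
    exact (((innerSL ℂ u).comp (ContinuousLinearMap.apply ℂ V v)).differentiableAt.comp μ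
      (h1.mul h3)).differentiableWithinAt
  have hM : ∀ z ∈ fullDomain a b Dm, 0 ≤ σ * z.im →
      ‖g z‖ ≤ (‖u‖ * (κ / 2)⁻¹ * ‖v‖) * ‖K' z‖ := by
    intro z _ hz
    have h1 := (hinv z (by linarith)).2
    calc ‖g z‖ ≤ ‖u‖ * (‖K' z‖ * (κ / 2)⁻¹ * ‖v‖) := by
          refine (norm_inner_le_norm _ _).trans ?_
          gcongr
          refine (ContinuousLinearMap.le_opNorm _ _).trans ?_
          gcongr
          exact (norm_mul_le _ _).trans (by gcongr)
      _ = _ := by ring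
  have key := hγ.integral_eq hK hKint (half_pos hκ) (by positivity) hgd hM
  change _ = ∫ y in interval a b, g y
  rw [← key.2.2]
  have := ContinuousLinearMap.integral_comp_comm
    ((innerSL ℂ u).comp (ContinuousLinearMap.apply ℂ V v)) hint
  change _ = inner ℂ u (resolventIntegral K' γ Z v) at this
  rw [← this]
  refine integral_congr_ae (Eventually.of_forall fun s => ?_)
  simp [g]

end ContourIntegral

/-! ### Independence of the contour by analytic continuation in a parameter -/

section Independence

theorem im_inner_self_apply {V : Type*} [NormedAddCommGroup V] [InnerProductSpace ℂ V]
    [CompleteSpace V] {A : V →L[ℂ] V} (hA : IsSelfAdjoint A) (x : V) :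
    (inner ℂ x (A x)).im = 0 := by
  have h2 : inner ℂ (A x) x = inner ℂ x (A x) := hA.isSymmetric x x
  have h3 := inner_conj_symm (𝕜 := ℂ) x (A x)
  rw [h2] at h3
  exact Complex.conj_eq_iff_im.1 h3

theorem variation_nonneg {V : Type*} [NormedAddCommGroup V] [InnerProductSpace ℂ V]
    (K' : ℂ → V →L[ℂ] V) (γ : ℝ → ℂ) : 0 ≤ variation K' γ :=
  integral_nonneg fun _ => by positivity

variable {V : Type*} [NormedAddCommGroup V] [InnerProductSpace ℂ V] [CompleteSpace V]
  [FiniteDimensional ℂ V]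

theorem differentiableAt_resolventIntegral {a b : EReal} {Dm : Set ℂ} {K : ℝ → V →L[ℂ] V}
    {K' : ℂ → V →L[ℂ] V} (hK : IsContinuedDerivative a b Dm K K') {l : ℤˣ} {γ : ℝ → ℂ}
    (hγ : IsAdmissible a b (side Dm l) K' γ) {A : V →L[ℂ] V} (hA : IsSelfAdjoint A) {d : ℝ}
    (hd : ∀ z ∈ spectrum ℂ A, ∀ s ∈ Ioo (0 : ℝ) 1, d ≤ dist z (γ s)) (W₀ W₁ : V →L[ℂ] V) {w₀ : ℂ}
    (hw₀ : ‖W₀ + w₀ • W₁‖ < d) :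
    DifferentiableAt ℂ (fun w : ℂ => resolventIntegral K' γ (A + (W₀ + w • W₁))) w₀ := by
  -- The room between ‖W₀ + w₀W₁‖ and d gives the resolvent bound (d - r)⁻¹ for all w near w₀, which
  -- dominates the differentiated integrand.
  obtain ⟨r, hr₁, hr₂⟩ := exists_between hw₀
  set S : Set ℂ := {w | ‖W₀ + w • W₁‖ < r} with hS
  have hSo : IsOpen S := isOpen_lt (by fun_prop) continuous_const
  have hres : ∀ w ∈ S, ∀ s ∈ Ioo (0 : ℝ) 1,
      IsUnit (A + (W₀ + w • W₁) - γ s • (1 : V →L[ℂ] V)) ∧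
      ‖Ring.inverse (A + (W₀ + w • W₁) - γ s • (1 : V →L[ℂ] V))‖ ≤ (d - r)⁻¹ :=
    fun w hw s hs => isUnit_add_sub_and_norm_inverse_le hA (fun z hz => hd z hz s hs) hw.le hr₂
  have hint := fun w hw => (integrableOn_resolvent hK hγ (hres w hw)).1
  have hw₀S : w₀ ∈ S := hr₁
  have hdr : 0 < d - r := sub_pos.2 hr₂
  set Rv : ℂ → ℝ → V →L[ℂ] V :=
    fun w s => Ring.inverse (A + (W₀ + w • W₁) - γ s • (1 : V →L[ℂ] V)) with hRv
  have hRc : ContinuousOn (Rv w₀) (Ioo 0 1) :=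
    continuousOn_inverse_sub hγ.locallyLipschitz.continuousOn fun s hs => (hres w₀ hw₀S s hs).1
  refine (hasDerivAt_integral_of_dominated_loc_of_deriv_le (𝕜 := ℂ) (s := S)
    (F := fun w s => deriv γ s • (K' (γ s) * Rv w s))
    (F' := fun w s => deriv γ s • (K' (γ s) * -(Rv w s * W₁ * Rv w s)))
    (bound := fun s => ((d - r)⁻¹ * ‖W₁‖ * (d - r)⁻¹) * (‖deriv γ s‖ * ‖K' (γ s)‖))
    (hSo.mem_nhds hw₀S) ?_ (hint w₀ hw₀S) ?_ ?_
    (hγ.finite_variation.const_mul _) ?_).2.differentiableAt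
  · filter_upwards [hSo.mem_nhds hw₀S] with w hw using (hint w hw).aestronglyMeasurable
  · exact (measurable_deriv γ).aestronglyMeasurable.smul
      (((hK.continuousOn_comp hγ).mul ((hRc.mul continuousOn_const).mul
        hRc).neg).aestronglyMeasurable measurableSet_Ioo)
  · refine (ae_restrict_iff' measurableSet_Ioo).2 (Eventually.of_forall fun s hs w hw => ?_)
    have h1 := (hres w hw s hs).2
    rw [norm_smul]
    calc _ ≤ ‖deriv γ s‖ * (‖K' (γ s)‖ * ((d - r)⁻¹ * ‖W₁‖ * (d - r)⁻¹)) := by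
          gcongr
          refine (norm_mul_le _ _).trans ?_
          rw [norm_neg]
          gcongr
          refine (norm_mul_le _ _).trans ?_
          gcongr
          exact (norm_mul_le _ _).trans (by gcongr)
      _ = _ := by ring
  · refine (ae_restrict_iff' measurableSet_Ioo).2 (Eventually.of_forall fun s hs w hw => ?_)
    obtain ⟨u, hu⟩ := (hres w hw s hs).1
    have h1 : HasDerivAt (fun w : ℂ => A + (W₀ + w • W₁) - γ s • (1 : V →L[ℂ] V)) W₁ w := by
      have := (((hasDerivAt_id w).smul_const W₁).const_add W₀).const_add A
      simpa using this.sub_const (γ s • (1 : V →L[ℂ] V))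
    have h2 := hasFDerivAt_ringInverse (𝕜 := ℂ) u
    have hinv : ((u⁻¹ : (V →L[ℂ] V)ˣ) : V →L[ℂ] V) = Rv w s := by
      rw [hRv]
      simp only
      rw [← hu, Ring.inverse_unit]
    rw [hinv, hu] at h2
    have h3 : HasDerivAt (fun w => Rv w s) (-(Rv w s * W₁ * Rv w s)) w := by
      have := HasFDerivAt.comp_hasDerivAt (l := Ring.inverse)
        (f := fun w : ℂ => A + (W₀ + w • W₁) - γ s • (1 : V →L[ℂ] V)) w h2 h1
      exact this.congr_deriv (by simp)
    exact (h3.const_mul (K' (γ s))).const_smul (deriv γ s)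

/-- Join Y to the scalar -iστ by an affine family in w. For w near 0 the numerical range of the
operator lies strictly on the side opposite to the contours, and both integrals equal the one over
the interval. The identity theorem on the convex set where the perturbation has norm below d carries
the equality to w = 1. Nothing has to be known about the spectrum in the region between the
contours. -/
theorem resolventIntegral_eq {a b : EReal} {Dm : Set ℂ} {K : ℝ → V →L[ℂ] V}
    {K' : ℂ → V →L[ℂ] V} (hK : IsContinuedDerivative a b Dm K K')
    (hKint : IntegrableOn (fun y : ℝ => ‖K' y‖) (interval a b)) {l : ℤˣ} {γ₁ γ₂ : ℝ → ℂ}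
    (hγ₁ : IsAdmissible a b (side Dm l) K' γ₁) (hγ₂ : IsAdmissible a b (side Dm l) K' γ₂)
    {A : V →L[ℂ] V} (hA : IsSelfAdjoint A) {d : ℝ} (hd0 : 0 < d)
    (hd₁ : ∀ z ∈ spectrum ℂ A, ∀ s ∈ Ioo (0 : ℝ) 1, d ≤ dist z (γ₁ s))
    (hd₂ : ∀ z ∈ spectrum ℂ A, ∀ s ∈ Ioo (0 : ℝ) 1, d ≤ dist z (γ₂ s))
    {Y : V →L[ℂ] V} (hY : ‖Y‖ < d) :
    resolventIntegral K' γ₁ (A + Y) = resolventIntegral K' γ₂ (A + Y) := by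
  set σ : ℝ := ((l : ℤ) : ℝ) with hσdef
  have hσ : σ * σ = 1 := sign_mul_self l
  have hσ' : |σ| = 1 := by rcases mul_self_eq_one_iff.1 hσ with h | h <;> simp [h]
  -- Half of d keeps w = 0 inside the set U.
  set τ : ℝ := d / 2 with hτdef
  have hτ : 0 < τ := by positivity
  set W₀ : V →L[ℂ] V := (-(Complex.I * (σ * τ : ℝ))) • (1 : V →L[ℂ] V) with hW₀
  set W₁ : V →L[ℂ] V := Y - W₀ with hW₁
  have hW₀n : ‖W₀‖ ≤ τ := by
    rw [hW₀, norm_smul, norm_neg, norm_mul, Complex.norm_I, one_mul, Complex.norm_real,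
      Real.norm_eq_abs, abs_mul, hσ', one_mul, abs_of_pos hτ]
    exact mul_le_of_le_one_right hτ.le ContinuousLinearMap.norm_id_le
  set U : Set ℂ := {w | ‖W₀ + w • W₁‖ < d} with hU
  have hUo : IsOpen U := isOpen_lt (by fun_prop) continuous_const
  have hUc : Convex ℝ U := by
    intro x hx y hy p q hp hq hpq
    have h1 : W₀ + (p • x + q • y) • W₁ = (p : ℂ) • (W₀ + x • W₁) + (q : ℂ) • (W₀ + y • W₁) := by
      have h2 : (p : ℂ) + q = 1 := by exact_mod_cast hpq
      conv_lhs => rw [← one_smul ℂ W₀, ← h2]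
      simp only [smul_add, add_smul, smul_smul, Complex.real_smul]
      abel
    rw [hU, mem_ofPred_eq, h1]
    refine (norm_add_le _ _).trans_lt ?_
    rw [norm_smul, norm_smul, Complex.norm_real, Complex.norm_real, Real.norm_of_nonneg hp,
      Real.norm_of_nonneg hq]
    have hx' : ‖W₀ + x • W₁‖ < d := hx
    have hy' : ‖W₀ + y • W₁‖ < d := hy
    rcases hp.eq_or_lt with rfl | hp
    · have : q = 1 := by linarith
      subst this; linarith
    · have h3 : p * ‖W₀ + x • W₁‖ < p * d := mul_lt_mul_of_pos_left hx' hp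
      have h4 : q * ‖W₀ + y • W₁‖ ≤ q * d := mul_le_mul_of_nonneg_left hy'.le hq
      have h5 : p * d + q * d = d := by rw [← add_mul, hpq, one_mul]
      linarith
  have h0U : (0 : ℂ) ∈ U := by
    rw [hU, mem_ofPred_eq, zero_smul, add_zero]
    linarith
  have h1U : (1 : ℂ) ∈ U := by
    rw [hU, mem_ofPred_eq, one_smul, hW₁, add_sub_cancel]
    exact hY
  set f : ℂ → V →L[ℂ] V := fun w => resolventIntegral K' γ₁ (A + (W₀ + w • W₁)) -
    resolventIntegral K' γ₂ (A + (W₀ + w • W₁)) with hf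
  have hfd : DifferentiableOn ℂ f U := fun w hw =>
    ((differentiableAt_resolventIntegral hK hγ₁ hA hd₁ W₀ W₁ hw).sub
      (differentiableAt_resolventIntegral hK hγ₂ hA hd₂ W₀ W₁ hw)).differentiableWithinAt
  have hev : f =ᶠ[𝓝 0] 0 := by
    have hsmall : ∀ᶠ w in 𝓝 (0 : ℂ), ‖w • W₁‖ < τ / 2 := by
      have hc : ContinuousAt (fun w : ℂ => ‖w • W₁‖) 0 := by fun_prop
      exact hc.eventually_lt_const (by simpa using half_pos hτ)
    filter_upwards [hsmall] with w hw
    have him : ∀ x, σ * (inner ℂ x ((A + (W₀ + w • W₁)) x)).im ≤ -(τ / 2) * ‖x‖ ^ 2 := by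
      intro x
      have e1 : inner ℂ x ((A + (W₀ + w • W₁)) x) =
          inner ℂ x (A x) + (-(Complex.I * (σ * τ : ℝ))) * ((‖x‖ ^ 2 : ℝ) : ℂ) +
            inner ℂ x ((w • W₁) x) := by
        rw [add_apply, add_apply, inner_add_right, inner_add_right, hW₀, smul_apply,
          one_apply_eq_self, inner_smul_right, inner_self_eq_norm_sq_to_K]
        push_cast
        simp only [Complex.coe_algebraMap]
        ring
      have e2 : (-(Complex.I * (σ * τ : ℝ)) * ((‖x‖ ^ 2 : ℝ) : ℂ)).im = -(σ * τ) * ‖x‖ ^ 2 := by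
        rw [Complex.mul_im, Complex.ofReal_im, Complex.ofReal_re]
        simp
      rw [e1, Complex.add_im, Complex.add_im, im_inner_self_apply hA, e2]
      have e3 : σ * (inner ℂ x ((w • W₁) x)).im ≤ τ / 2 * ‖x‖ ^ 2 := by
        refine (le_abs_self _).trans ?_
        rw [abs_mul, hσ', one_mul]
        refine (Complex.abs_im_le_norm _).trans ((norm_inner_le_norm _ _).trans ?_)
        have := ((w • W₁).le_opNorm x).trans (mul_le_mul_of_nonneg_right hw.le (norm_nonneg x))
        calc ‖x‖ * ‖(w • W₁) x‖ ≤ ‖x‖ * (τ / 2 * ‖x‖) := by gcongr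
          _ = _ := by ring
      have e4 : σ * (0 + -(σ * τ) * ‖x‖ ^ 2 + (inner ℂ x ((w • W₁) x)).im) =
          -((σ * σ) * (τ * ‖x‖ ^ 2)) + σ * (inner ℂ x ((w • W₁) x)).im := by ring
      rw [e4, hσ]
      linarith
    rw [hf]
    simp only [Pi.zero_apply]
    rw [sub_eq_zero]
    ext v
    refine ext_inner_left ℂ fun u => ?_
    rw [inner_resolventIntegral_eq hK hKint hγ₁ (half_pos hτ) him,
      inner_resolventIntegral_eq hK hKint hγ₂ (half_pos hτ) him]
  have := (hfd.analyticOnNhd hUo).eqOn_zero_of_preconnected_of_eventuallyEq_zero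
    hUc.isPreconnected h0U hev h1U
  rw [hf] at this
  simp only [one_smul, Pi.zero_apply, hW₁, add_sub_cancel] at this
  exact sub_eq_zero.1 this

end Independence

/-! ### Existence, uniqueness and norm bounds for the basic equation -/

section FixedPoint

variable {V : Type*} [NormedAddCommGroup V] [InnerProductSpace ℂ V] [CompleteSpace V]
  [FiniteDimensional ℂ V]

theorem norm_resolventIntegral_le {a b : EReal} {Dm : Set ℂ} {K : ℝ → V →L[ℂ] V}
    {K' : ℂ → V →L[ℂ] V} (hK : IsContinuedDerivative a b Dm K K') {l : ℤˣ} {γ : ℝ → ℂ}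
    (hγ : IsAdmissible a b (side Dm l) K' γ) {A : V →L[ℂ] V} (hA : IsSelfAdjoint A) {d : ℝ}
    (hd : ∀ z ∈ spectrum ℂ A, ∀ s ∈ Ioo (0 : ℝ) 1, d ≤ dist z (γ s)) {Y : V →L[ℂ] V}
    (hY : ‖Y‖ < d) : ‖resolventIntegral K' γ (A + Y)‖ ≤ (d - ‖Y‖)⁻¹ * variation K' γ :=
  (integrableOn_resolvent hK hγ fun s hs =>
    isUnit_add_sub_and_norm_inverse_le hA (fun z hz => hd z hz s hs) le_rfl hY).2

theorem norm_resolventIntegral_sub_le {a b : EReal} {Dm : Set ℂ} {K : ℝ → V →L[ℂ] V}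
    {K' : ℂ → V →L[ℂ] V} (hK : IsContinuedDerivative a b Dm K K') {l : ℤˣ} {γ : ℝ → ℂ}
    (hγ : IsAdmissible a b (side Dm l) K' γ) {A : V →L[ℂ] V} (hA : IsSelfAdjoint A) {d r₁ r₂ : ℝ}
    (hd : ∀ z ∈ spectrum ℂ A, ∀ s ∈ Ioo (0 : ℝ) 1, d ≤ dist z (γ s)) {Y₁ Y₂ : V →L[ℂ] V}
    (hY₁ : ‖Y₁‖ ≤ r₁) (hr₁ : r₁ < d) (hY₂ : ‖Y₂‖ ≤ r₂) (hr₂ : r₂ < d) :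
    ‖resolventIntegral K' γ (A + Y₁) - resolventIntegral K' γ (A + Y₂)‖ ≤
      (d - r₁)⁻¹ * (d - r₂)⁻¹ * variation K' γ * ‖Y₁ - Y₂‖ := by
  have H₁ : ∀ s ∈ Ioo (0 : ℝ) 1, _ := fun s hs =>
    isUnit_add_sub_and_norm_inverse_le hA (fun z hz => hd z hz s hs) hY₁ hr₁
  have H₂ : ∀ s ∈ Ioo (0 : ℝ) 1, _ := fun s hs =>
    isUnit_add_sub_and_norm_inverse_le hA (fun z hz => hd z hz s hs) hY₂ hr₂
  have I₁ := (integrableOn_resolvent hK hγ H₁).1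
  have I₂ := (integrableOn_resolvent hK hγ H₂).1
  have hp₁ : 0 < d - r₁ := sub_pos.2 hr₁
  have hp₂ : 0 < d - r₂ := sub_pos.2 hr₂
  rw [resolventIntegral, resolventIntegral, ← integral_sub I₁ I₂]
  have hint := hγ.finite_variation.const_mul ((d - r₁)⁻¹ * (d - r₂)⁻¹ * ‖Y₁ - Y₂‖)
  refine (norm_integral_le_of_norm_le hint ?_).trans_eq ?_
  · refine (ae_restrict_iff' measurableSet_Ioo).2 (Eventually.of_forall fun s hs => ?_)
    obtain ⟨u₁, n₁⟩ := H₁ s hs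
    obtain ⟨u₂, n₂⟩ := H₂ s hs
    rw [← smul_sub, ← mul_sub, Ring.inverse_sub_inverse (iff_of_true u₁ u₂), norm_smul]
    have e : A + Y₂ - γ s • (1 : V →L[ℂ] V) - (A + Y₁ - γ s • 1) = -(Y₁ - Y₂) := by abel
    rw [e]
    calc _ ≤ ‖deriv γ s‖ * (‖K' (γ s)‖ * ((d - r₁)⁻¹ * ‖Y₁ - Y₂‖ * (d - r₂)⁻¹)) := by
          gcongr
          refine (norm_mul_le _ _).trans ?_
          gcongr
          refine (norm_mul_le _ _).trans ?_
          gcongr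
          refine (norm_mul_le _ _).trans ?_
          rw [norm_neg]
          gcongr
      _ = _ := by ring
  · rw [integral_const_mul, variation]
    ring

theorem sqrt_lt_half {d v : ℝ} (hd : 0 < d) (hvd : v < d ^ 2 / 4) :
    Real.sqrt v < d / 2 :=
  (Real.sqrt_lt' (by positivity)).2 (by linarith [show (d / 2) ^ 2 = d ^ 2 / 4 by ring])

/-- A fixed point in the large ball already belongs to the small one. -/
theorem le_half_sub_sqrt {d v t : ℝ} (hd : 0 < d) (hv : 0 ≤ v) (hvd : v < d ^ 2 / 4)
    (ht : t < d - Real.sqrt v) (htv : t * (d - t) ≤ v) :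
    t ≤ d / 2 - Real.sqrt (d ^ 2 / 4 - v) := by
  set q := Real.sqrt (d ^ 2 / 4 - v) with hq
  have hq0 : 0 ≤ q := Real.sqrt_nonneg _
  have hq2 : q ^ 2 = d ^ 2 / 4 - v := Real.sq_sqrt (by linarith)
  set p := Real.sqrt v
  have hp0 : 0 ≤ p := Real.sqrt_nonneg _
  have hp2 : p ^ 2 = v := Real.sq_sqrt hv
  have hp : p < d / 2 := sqrt_lt_half hd hvd
  by_contra! hcon
  -- The inequality t(d - t) ≤ v excludes the open interval between the roots d/2 ± q. This step
  -- places d - √v at or below the larger root, so t must lie at or below the smaller one.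
  have h1 : d / 2 - p ≤ q := by
    refine le_of_sq_le_sq ?_ hq0
    nlinarith
  have h2 : t < d / 2 + q := by linarith
  nlinarith

theorem half_sub_sqrt_spec {d v : ℝ} (hd : 0 < d) (hv : 0 ≤ v) (hvd : v < d ^ 2 / 4) :
    0 ≤ d / 2 - Real.sqrt (d ^ 2 / 4 - v) ∧ d / 2 - Real.sqrt (d ^ 2 / 4 - v) < d / 2 ∧
      (d / 2 - Real.sqrt (d ^ 2 / 4 - v)) * (d - (d / 2 - Real.sqrt (d ^ 2 / 4 - v))) = v := by
  set q := Real.sqrt (d ^ 2 / 4 - v) with hq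
  have hq0 : 0 < q := Real.sqrt_pos.2 (by linarith)
  have hq2 : q ^ 2 = d ^ 2 / 4 - v := Real.sq_sqrt (by linarith)
  refine ⟨?_, by linarith, by linear_combination -hq2⟩
  have : q ≤ d / 2 := le_of_sq_le_sq (by nlinarith) (by positivity)
  linarith

/-- Banach's theorem on the ball whose radius r is the smaller root of r(d - r) = v: this identity
makes the ball invariant, and the contraction constant v/(d - r)² = r/(d - r) is below 1 because r <
d/2. -/
theorem exists_solution {a b : EReal} {Dm : Set ℂ} {K : ℝ → V →L[ℂ] V}
    {K' : ℂ → V →L[ℂ] V} (hK : IsContinuedDerivative a b Dm K K') {l : ℤˣ} {γ : ℝ → ℂ}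
    (hγ : IsAdmissible a b (side Dm l) K' γ) {A : V →L[ℂ] V} (hA : IsSelfAdjoint A) {d : ℝ}
    (hd0 : 0 < d) (hd : ∀ z ∈ spectrum ℂ A, ∀ s ∈ Ioo (0 : ℝ) 1, d ≤ dist z (γ s))
    (hv : variation K' γ < d ^ 2 / 4) :
    ∃ Y : V →L[ℂ] V, ‖Y‖ ≤ d / 2 - Real.sqrt (d ^ 2 / 4 - variation K' γ) ∧
      Y = -resolventIntegral K' γ (A + Y) := by
  set v := variation K' γ
  have hv0 : 0 ≤ v := variation_nonneg K' γ
  obtain ⟨hr0, hrd, hrv⟩ := half_sub_sqrt_spec hd0 hv0 hv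
  set r := d / 2 - Real.sqrt (d ^ 2 / 4 - v)
  have hrd' : r < d := by linarith
  have hdr : 0 < d - r := by linarith
  set T : (V →L[ℂ] V) → V →L[ℂ] V := fun Y => -resolventIntegral K' γ (A + Y) with hT
  have hmaps : MapsTo T (Metric.closedBall 0 r) (Metric.closedBall 0 r) := by
    intro Y hY
    rw [mem_closedBall_zero_iff] at hY ⊢
    rw [hT]
    simp only
    rw [norm_neg]
    refine (norm_resolventIntegral_le hK hγ hA hd (hY.trans_lt hrd')).trans ?_
    rw [inv_mul_le_iff₀ (by linarith)]
    change v ≤ _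
    nlinarith
  set k : ℝ := (d - r)⁻¹ * (d - r)⁻¹ * v with hk
  have hk0 : 0 ≤ k := by positivity
  have hk1 : k < 1 := by
    rw [hk, ← mul_inv, inv_mul_lt_iff₀ (by positivity)]
    nlinarith
  have hcontr : ContractingWith ⟨k, hk0⟩ (hmaps.restrict T _ _) := by
    refine ⟨by exact_mod_cast hk1, LipschitzWith.of_dist_le_mul fun Y₁ Y₂ => ?_⟩
    have h1 := mem_closedBall_zero_iff.1 Y₁.2
    have h2 := mem_closedBall_zero_iff.1 Y₂.2
    rw [Subtype.dist_eq, Subtype.dist_eq, dist_eq_norm, dist_eq_norm]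
    change ‖T Y₁ - T Y₂‖ ≤ k * ‖(Y₁ : V →L[ℂ] V) - Y₂‖
    rw [hT]
    simp only
    rw [neg_sub_neg, norm_sub_rev]
    exact norm_resolventIntegral_sub_le hK hγ hA hd h1 hrd' h2 hrd'
  obtain ⟨Y, hYs, hY, -⟩ := hcontr.exists_fixedPoint' Metric.isClosed_closedBall.isComplete hmaps
    (x := 0) (by simpa using hr0) (edist_ne_top _ _)
  exact ⟨Y, mem_closedBall_zero_iff.1 hYs, hY.symm⟩

/-- Both factors d - ‖Yᵢ‖ exceed √v, so the Lipschitz constant from the resolvent identity is below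
1. -/
theorem solution_unique {a b : EReal} {Dm : Set ℂ} {K : ℝ → V →L[ℂ] V}
    {K' : ℂ → V →L[ℂ] V} (hK : IsContinuedDerivative a b Dm K K') {l : ℤˣ} {γ : ℝ → ℂ}
    (hγ : IsAdmissible a b (side Dm l) K' γ) {A : V →L[ℂ] V} (hA : IsSelfAdjoint A) {d : ℝ}
    (hd : ∀ z ∈ spectrum ℂ A, ∀ s ∈ Ioo (0 : ℝ) 1, d ≤ dist z (γ s)) {Y₁ Y₂ : V →L[ℂ] V}
    (h₁ : ‖Y₁‖ < d - Real.sqrt (variation K' γ)) (h₂ : ‖Y₂‖ < d - Real.sqrt (variation K' γ))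
    (e₁ : Y₁ = -resolventIntegral K' γ (A + Y₁)) (e₂ : Y₂ = -resolventIntegral K' γ (A + Y₂)) :
    Y₁ = Y₂ := by
  have hv0 : 0 ≤ variation K' γ := variation_nonneg K' γ
  set p := Real.sqrt (variation K' γ)
  have hp0 : 0 ≤ p := Real.sqrt_nonneg _
  have hp2 : p * p = variation K' γ := Real.mul_self_sqrt hv0
  have key := norm_resolventIntegral_sub_le hK hγ hA hd le_rfl (by linarith : ‖Y₁‖ < d) le_rfl
    (by linarith : ‖Y₂‖ < d)
  have e : ‖Y₁ - Y₂‖ =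
      ‖resolventIntegral K' γ (A + Y₁) - resolventIntegral K' γ (A + Y₂)‖ := by
    conv_lhs => rw [e₁, e₂]
    rw [neg_sub_neg, norm_sub_rev]
  rw [← e] at key
  have hp₁ : 0 < d - ‖Y₁‖ := by linarith
  have hp₂ : 0 < d - ‖Y₂‖ := by linarith
  have hlt : (d - ‖Y₁‖)⁻¹ * (d - ‖Y₂‖)⁻¹ * variation K' γ < 1 := by
    rw [← mul_inv, inv_mul_lt_iff₀ (by positivity)]
    nlinarith
  by_contra hne
  have : 0 < ‖Y₁ - Y₂‖ := norm_pos_iff.2 (sub_ne_zero.2 hne)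
  nlinarith

theorem norm_le_of_solution {a b : EReal} {Dm : Set ℂ} {K : ℝ → V →L[ℂ] V}
    {K' : ℂ → V →L[ℂ] V} (hK : IsContinuedDerivative a b Dm K K') {l : ℤˣ} {γ : ℝ → ℂ}
    (hγ : IsAdmissible a b (side Dm l) K' γ) {A : V →L[ℂ] V} (hA : IsSelfAdjoint A) {d : ℝ}
    (hd0 : 0 < d) (hd : ∀ z ∈ spectrum ℂ A, ∀ s ∈ Ioo (0 : ℝ) 1, d ≤ dist z (γ s))
    (hv : variation K' γ < d ^ 2 / 4) {Y : V →L[ℂ] V}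
    (hY : ‖Y‖ < d - Real.sqrt (variation K' γ)) (e : Y = -resolventIntegral K' γ (A + Y)) :
    ‖Y‖ ≤ d / 2 - Real.sqrt (d ^ 2 / 4 - variation K' γ) := by
  have hYd : ‖Y‖ < d := by linarith [Real.sqrt_nonneg (variation K' γ)]
  refine le_half_sub_sqrt hd0 (variation_nonneg K' γ) hv hY ?_
  have h1 := norm_resolventIntegral_le hK hγ hA hd hYd
  rw [← norm_neg, ← e, le_inv_mul_iff₀ (by linarith)] at h1
  linarith

/-- The solution of the basic equation does not depend on the contour. -/
theorem norm_le_of_solution_of_other {a b : EReal} {Dm : Set ℂ} {K : ℝ → V →L[ℂ] V}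
    {K' : ℂ → V →L[ℂ] V} (hK : IsContinuedDerivative a b Dm K K')
    (hKint : IntegrableOn (fun y : ℝ => ‖K' y‖) (interval a b)) {l : ℤˣ} {γ₁ γ₂ : ℝ → ℂ}
    (hγ₁ : IsAdmissible a b (side Dm l) K' γ₁) (hγ₂ : IsAdmissible a b (side Dm l) K' γ₂)
    {A : V →L[ℂ] V} (hA : IsSelfAdjoint A) {d₁ d₂ : ℝ} (hd₁0 : 0 < d₁) (hd₂0 : 0 < d₂)
    (hd₁ : ∀ z ∈ spectrum ℂ A, ∀ s ∈ Ioo (0 : ℝ) 1, d₁ ≤ dist z (γ₁ s))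
    (hd₂ : ∀ z ∈ spectrum ℂ A, ∀ s ∈ Ioo (0 : ℝ) 1, d₂ ≤ dist z (γ₂ s))
    (hv₁ : variation K' γ₁ < d₁ ^ 2 / 4) (hv₂ : variation K' γ₂ < d₂ ^ 2 / 4) {X : V →L[ℂ] V}
    (hX : ‖X‖ < d₁ - Real.sqrt (variation K' γ₁)) (e : X = -resolventIntegral K' γ₁ (A + X)) :
    ‖X‖ ≤ d₂ / 2 - Real.sqrt (d₂ ^ 2 / 4 - variation K' γ₂) := by
  have hs₁ := sqrt_lt_half hd₁0 hv₁
  have hs₂ := sqrt_lt_half hd₂0 hv₂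
  -- The two integrals are known to agree only for perturbations of norm below the smaller distance.
  -- If that is d₁, X itself solves the equation of γ₂. Otherwise the small solution for γ₂ is
  -- carried over to γ₁ and identified with X by uniqueness there.
  rcases le_total d₁ d₂ with h12 | h21
  · have hXd : ‖X‖ < d₁ / 2 := (norm_le_of_solution hK hγ₁ hA hd₁0 hd₁ hv₁ hX e).trans_lt
      (half_sub_sqrt_spec hd₁0 (variation_nonneg K' γ₁) hv₁).2.1
    refine norm_le_of_solution hK hγ₂ hA hd₂0 hd₂ hv₂ (by linarith) ?_
    rwa [resolventIntegral_eq hK hKint hγ₁ hγ₂ hA hd₁0 hd₁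
      (fun z hz s hs => h12.trans (hd₂ z hz s hs)) (by linarith)] at e
  · obtain ⟨Y, hY, eY⟩ := exists_solution hK hγ₂ hA hd₂0 hd₂ hv₂
    have hYd : ‖Y‖ < d₂ / 2 :=
      hY.trans_lt (half_sub_sqrt_spec hd₂0 (variation_nonneg K' γ₂) hv₂).2.1
    rw [← resolventIntegral_eq hK hKint hγ₁ hγ₂ hA hd₂0
      (fun z hz s hs => h21.trans (hd₁ z hz s hs)) hd₂ (by linarith)] at eY
    rwa [solution_unique hK hγ₁ hA hd₁ hX (by linarith) e eY]

end FixedPoint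

/-! ### Distances to the contour and boundary values of the Cauchy integral -/

section Eigenvalues

variable {V : Type*} [NormedAddCommGroup V] [InnerProductSpace ℂ V]

theorem contourDist_le {A : V →L[ℂ] V} {γ : ℝ → ℂ} {z : ℂ} (hz : z ∈ spectrum ℂ A) {s : ℝ}
    (hs : s ∈ Ioo (0 : ℝ) 1) : contourDist A γ ≤ dist z (γ s) :=
  csInf_le ⟨0, by rintro _ ⟨_, _, _, _, rfl⟩; exact dist_nonneg⟩
    ⟨z, hz, γ s, mem_image_of_mem γ hs, rfl⟩

theorem contourDist_pos {A : V →L[ℂ] V} {K' : ℂ → V →L[ℂ] V} {γ : ℝ → ℂ}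
    (h : variation K' γ < contourDist A γ ^ 2 / 4) : 0 < contourDist A γ := by
  have h0 : 0 ≤ contourDist A γ :=
    Real.sInf_nonneg (by rintro _ ⟨_, _, _, _, rfl⟩; exact dist_nonneg)
  have h1 := variation_nonneg K' γ
  refine lt_of_le_of_ne h0 fun h2 => ?_
  rw [← h2] at h
  linarith

/-- A contour is not farther from a point of the interval than the end points of the interval. -/
theorem mem_interval_of_dist_lt {a b : EReal} {D : Set ℂ} {K' : ℂ → V →L[ℂ] V} {γ : ℝ → ℂ}
    (hγ : IsAdmissible a b D K' γ) {y z d : ℝ} (hy : y ∈ interval a b)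
    (hd : ∀ s ∈ Ioo (0 : ℝ) 1, d ≤ dist (y : ℂ) (γ s)) (hz : |y - z| < d) : z ∈ interval a b := by
  obtain ⟨h, -, -, hhγ, -, hl, hr, -⟩ := hγ.deformation
  have hend : ∀ (e : ℝ) (F : Filter ℝ) [F.NeBot], (∀ᶠ s in F, s ∈ Ioo (0 : ℝ) 1) →
      Tendsto h (F ×ˢ 𝓟 (Icc 0 1)) (𝓝 (e : ℂ)) → d ≤ |y - e| := by
    intro e F _ hF hlim
    have h1 : Tendsto (fun s : ℝ => (s, (1 : ℝ))) F (F ×ˢ 𝓟 (Icc 0 1)) :=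
      tendsto_id.prodMk (tendsto_principal.2 (Eventually.of_forall fun _ => by simp))
    have h2 : Tendsto (fun s => dist (y : ℂ) (h (s, 1))) F (𝓝 (dist (y : ℂ) e)) :=
      tendsto_const_nhds.dist (hlim.comp h1)
    have h3 : dist (y : ℂ) e = |y - e| := by
      rw [dist_eq_norm, ← Complex.ofReal_sub, Complex.norm_real, Real.norm_eq_abs]
    rw [← h3]
    refine ge_of_tendsto h2 ?_
    filter_upwards [hF] with s hs
    rw [hhγ s hs]
    exact hd s hs
  have hz' := abs_lt.1 hz
  constructor
  · induction a with
    | bot => exact EReal.bot_lt_coe z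
    | top => exact absurd hy.1 not_top_lt
    | coe e =>
      rw [endFilter_coe] at hl
      have h1 := hend e _ (Ioo_mem_nhdsGT zero_lt_one) hl
      have h2 : e < y := EReal.coe_lt_coe_iff.1 hy.1
      rw [abs_of_pos (sub_pos.2 h2)] at h1
      exact EReal.coe_lt_coe_iff.2 (by linarith)
  · induction b with
    | top => exact EReal.coe_lt_top z
    | bot => exact absurd hy.2 not_lt_bot
    | coe e =>
      rw [endFilter_coe] at hr
      have h1 := hend e _ (Ioo_mem_nhdsLT zero_lt_one) hr
      have h2 : y < e := EReal.coe_lt_coe_iff.1 hy.2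
      rw [abs_of_neg (sub_neg.2 h2)] at h1
      exact EReal.coe_lt_coe_iff.2 (by linarith)

/-- The boundary values of the Cauchy integral along the contour have nonzero imaginary part where
the density is positive. -/
theorem sign_mul_im_integral_pos {a b : EReal} {Dm : Set ℂ} {K : ℝ → V →L[ℂ] V}
    {K' : ℂ → V →L[ℂ] V} (hK : IsContinuedDerivative a b Dm K K')
    (hKint : IntegrableOn (fun y : ℝ => ‖K' y‖) (interval a b)) {l : ℤˣ} {γ : ℝ → ℂ}
    (hγ : IsAdmissible a b (side Dm l) K' γ) {x : V} {q : ℝ → ℝ} (hq0 : ∀ y, 0 ≤ q y)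
    (hq : ∀ y ∈ interval a b, inner ℂ x (K' y x) = (q y : ℂ)) {z δ : ℝ} (hz : z ∈ interval a b)
    (hδ : 0 < δ) (hzγ : ∀ s ∈ Ioo (0 : ℝ) 1, δ ≤ dist (z : ℂ) (γ s)) (hqz : 0 < q z) :
    0 < ((l : ℤ) : ℝ) *
      (∫ s in Ioo (0 : ℝ) 1, deriv γ s * (inner ℂ x (K' (γ s) x) * ((z : ℂ) - γ s)⁻¹)).im := by
  set σ : ℝ := ((l : ℤ) : ℝ) with hσdef
  have hσ : σ * σ = 1 := sign_mul_self l
  have hσ' : |σ| = 1 := by rcases mul_self_eq_one_iff.1 hσ with h | h <;> simp [h]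
  set Q : ℂ → ℂ := fun μ => inner ℂ x (K' μ x) with hQ
  have hQd : DifferentiableOn ℂ Q (fullDomain a b Dm) := fun μ hμ =>
    (((innerSL ℂ x).comp (ContinuousLinearMap.apply ℂ V x)).differentiableAt.comp μ
      (hK.analytic.differentiableAt (hK.isOpen_full.mem_nhds hμ))).differentiableWithinAt
  have hQn : ∀ μ, ‖Q μ‖ ≤ ‖x‖ ^ 2 * ‖K' μ‖ := by
    intro μ
    refine (norm_inner_le_norm _ _).trans ?_
    calc ‖x‖ * ‖K' μ x‖ ≤ ‖x‖ * (‖K' μ‖ * ‖x‖) := by gcongr; exact (K' μ).le_opNorm x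
      _ = _ := by ring
  -- These points approach z from the side opposite to Γ, so moving the contour to the interval
  -- crosses no pole.
  set w : ℝ → ℂ := fun τ => z - Complex.I * (σ * τ : ℝ) with hw
  have hwim : ∀ τ μ, σ * (w τ - μ).im = -τ - σ * μ.im := by
    intro τ μ
    have : (w τ - μ).im = -(σ * τ) - μ.im := by simp [hw]
    rw [this]
    linear_combination (-τ) * hσ
  have hwn : ∀ τ μ, τ + σ * μ.im ≤ ‖w τ - μ‖ := by
    intro τ μ
    refine le_trans ?_ (Complex.abs_im_le_norm _)
    have h1 : |σ * (w τ - μ).im| = |(w τ - μ).im| := by rw [abs_mul, hσ', one_mul]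
    rw [← h1, hwim, ← abs_neg]
    refine le_trans ?_ (le_abs_self _)
    linarith
  have hcauchy : ∀ τ > 0,
      IntegrableOn (fun s => deriv γ s * (Q (γ s) * (w τ - γ s)⁻¹)) (Ioo 0 1) ∧
      IntegrableOn (fun y : ℝ => Q y * (w τ - y)⁻¹) (interval a b) ∧
      ∫ s in Ioo (0 : ℝ) 1, deriv γ s * (Q (γ s) * (w τ - γ s)⁻¹) =
        ∫ y in interval a b, Q y * (w τ - y)⁻¹ := by
    intro τ hτ
    refine hγ.integral_eq hK hKint (g := fun μ => Q μ * (w τ - μ)⁻¹) (half_pos hτ)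
      (M := ‖x‖ ^ 2 * τ⁻¹) (by positivity) ?_ ?_
    · rintro μ ⟨hμ, hμ'⟩
      have h1 : -(τ / 2) < σ * μ.im := hμ'
      have h2 : w τ - μ ≠ 0 := by
        have := hwn τ μ
        exact norm_pos_iff.1 (by linarith)
      have h3 : DifferentiableAt ℂ (fun μ => w τ - μ) μ := by fun_prop
      exact (((hQd μ hμ).differentiableAt (hK.isOpen_full.mem_nhds hμ)).mul
        (h3.inv h2)).differentiableWithinAt
    · intro μ _ hμ
      have h1 : τ ≤ ‖w τ - μ‖ := by
        have := hwn τ μ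
        have h2 : 0 ≤ σ * μ.im := hμ
        linarith
      rw [norm_mul, norm_inv]
      calc _ ≤ (‖x‖ ^ 2 * ‖K' μ‖) * τ⁻¹ := by gcongr; exact hQn μ
        _ = _ := by ring
  have hlim : Tendsto (fun τ => ∫ s in Ioo (0 : ℝ) 1, deriv γ s * (Q (γ s) * (w τ - γ s)⁻¹))
      (𝓝[>] 0) (𝓝 (∫ s in Ioo (0 : ℝ) 1, deriv γ s * (Q (γ s) * ((z : ℂ) - γ s)⁻¹))) := by
    refine tendsto_integral_filter_of_dominated_convergence
      (fun s => (‖x‖ ^ 2 * (δ / 2)⁻¹) * (‖deriv γ s‖ * ‖K' (γ s)‖)) ?_ ?_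
      (hγ.finite_variation.const_mul _) ?_
    · filter_upwards [self_mem_nhdsWithin] with τ hτ using (hcauchy τ hτ).1.aestronglyMeasurable
    · filter_upwards [Ioo_mem_nhdsGT (half_pos hδ)] with τ hτ
      refine (ae_restrict_iff' measurableSet_Ioo).2 (Eventually.of_forall fun s hs => ?_)
      have h1 : δ / 2 ≤ ‖w τ - γ s‖ := by
        have h2 := hzγ s hs
        rw [dist_eq_norm] at h2
        have h3 : (z : ℂ) - γ s = (w τ - γ s) + Complex.I * (σ * τ : ℝ) := by rw [hw]; ring
        have h4 : ‖Complex.I * (σ * τ : ℝ)‖ = τ := by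
          rw [norm_mul, Complex.norm_I, one_mul, Complex.norm_real, Real.norm_eq_abs, abs_mul, hσ',
            one_mul, abs_of_pos hτ.1]
        rw [h3] at h2
        have h5 := h2.trans (norm_add_le _ _)
        rw [h4] at h5
        linarith [hτ.2]
      rw [norm_mul, norm_mul, norm_inv]
      calc _ ≤ ‖deriv γ s‖ * ((‖x‖ ^ 2 * ‖K' (γ s)‖) * (δ / 2)⁻¹) := by
            gcongr
            exact hQn _
        _ = _ := by ring
    · refine (ae_restrict_iff' measurableSet_Ioo).2 (Eventually.of_forall fun s hs => ?_)
      have hne : (z : ℂ) - γ s ≠ 0 := by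
        have := hzγ s hs
        rw [dist_eq_norm] at this
        exact norm_pos_iff.1 (hδ.trans_le this)
      have hwc : Tendsto w (𝓝[>] 0) (𝓝 (z : ℂ)) := by
        have : Continuous w := by fun_prop
        exact (this.tendsto' 0 _ (by simp [hw])).mono_left nhdsWithin_le_nhds
      exact (((hwc.sub tendsto_const_nhds).inv₀ hne).const_mul _).const_mul _
  have hint_nhds : ∀ᶠ y in 𝓝 z, y ∈ interval a b ∧ q z / 2 < q y := by
    have h1 : ∀ᶠ y in 𝓝 z, y ∈ interval a b := by
      have : IsOpen (interval a b) :=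
        (isOpen_Ioi.preimage continuous_coe_real_ereal).inter
          (isOpen_Iio.preimage continuous_coe_real_ereal)
      exact this.mem_nhds hz
    have h2 : ContinuousAt (fun y : ℝ => (Q y).re) z := by
      have h3 : ContinuousAt Q z := ((hQd _ (ofReal_mem_fullDomain Dm hz)).differentiableAt
        (hK.isOpen_full.mem_nhds (ofReal_mem_fullDomain Dm hz))).continuousAt
      exact Complex.continuous_re.continuousAt.comp
        (ContinuousAt.comp (g := Q) h3 Complex.continuous_ofReal.continuousAt)
    have h4 : (Q z).re = q z := by rw [hQ]; simp only; rw [hq z hz, Complex.ofReal_re]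
    have h5 := h2.eventually (lt_mem_nhds (show q z / 2 < (Q z).re by rw [h4]; linarith))
    filter_upwards [h1, h5] with y hy hy'
    refine ⟨hy, ?_⟩
    have : (Q y).re = q y := by rw [hQ]; simp only; rw [hq y hy, Complex.ofReal_re]
    rwa [this] at hy'
  obtain ⟨ρ, hρ, hρball⟩ := Metric.eventually_nhds_iff_ball.1 hint_nhds
  -- The imaginary part is a Poisson integral of q. On the window |y - z| < τ of length 2τ the
  -- kernel is at least 1/(2τ) and q exceeds q(z)/2; the rest is nonnegative.
  have hlower : ∀ τ ∈ Ioo 0 ρ, q z / 2 ≤ σ * (∫ y in interval a b, Q y * (w τ - y)⁻¹).im := by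
    intro τ hτ
    obtain ⟨-, hI, -⟩ := hcauchy τ hτ.1
    have e1 : (∫ y in interval a b, Q y * (w τ - y)⁻¹).im =
        ∫ y in interval a b, (Q y * (w τ - y)⁻¹).im :=
      (Complex.imCLM.integral_comp_comm hI).symm
    rw [e1, ← integral_const_mul]
    have hIm : IntegrableOn (fun y : ℝ => σ * (Q y * (w τ - y)⁻¹).im) (interval a b) :=
      (Complex.imCLM.integrable_comp hI).const_mul σ
    have e2 : ∀ y ∈ interval a b, σ * (Q y * (w τ - y)⁻¹).im =
        q y * (τ / ((z - y) ^ 2 + τ ^ 2)) := by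
      intro y hy
      have h1 : Q y = q y := hq y hy
      have h2 : Complex.normSq (w τ - y) = (z - y) ^ 2 + τ ^ 2 := by
        rw [Complex.normSq_apply]
        simp only [hw, Complex.sub_re, Complex.sub_im, Complex.ofReal_re, Complex.ofReal_im,
          Complex.mul_re, Complex.mul_im, Complex.I_re, Complex.I_im]
        linear_combination τ ^ 2 * hσ
      rw [h1, Complex.im_ofReal_mul, Complex.inv_im, h2]
      have h3 := hwim τ y
      rw [Complex.ofReal_im, mul_zero, sub_zero] at h3
      linear_combination (-q y / ((z - y) ^ 2 + τ ^ 2)) * h3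
    have hsub : Ioo (z - τ) (z + τ) ⊆ interval a b := fun y hy =>
      (hρball y (by
        rw [Metric.mem_ball, Real.dist_eq, abs_lt]
        constructor <;> linarith [hy.1, hy.2, hτ.2])).1
    calc q z / 2 = ∫ y in Ioo (z - τ) (z + τ), q z / 2 * (1 / (2 * τ)) := by
          rw [setIntegral_const, Real.volume_real_Ioo_of_le (by linarith [hτ.1])]
          have := hτ.1.ne'
          simp only [smul_eq_mul]
          field_simp
          ring
      _ ≤ ∫ y in Ioo (z - τ) (z + τ), σ * (Q y * (w τ - y)⁻¹).im := by
          refine setIntegral_mono_on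
            (continuous_const.integrableOn_Icc.mono_set Ioo_subset_Icc_self) (hIm.mono_set hsub) measurableSet_Ioo fun y hy => ?_
          rw [e2 y (hsub hy)]
          have h1 := (hρball y (by
            rw [Metric.mem_ball, Real.dist_eq, abs_lt]
            constructor <;> linarith [hy.1, hy.2, hτ.2])).2
          have hτ0 := hτ.1
          have h2 : 1 / (2 * τ) ≤ τ / ((z - y) ^ 2 + τ ^ 2) := by
            rw [div_le_div_iff₀ (by positivity) (by positivity)]
            have : (z - y) ^ 2 ≤ τ ^ 2 := sq_le_sq' (by linarith [hy.2]) (by linarith [hy.1])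
            nlinarith
          exact mul_le_mul h1.le h2 (by positivity) (hq0 y)
      _ ≤ ∫ y in interval a b, σ * (Q y * (w τ - y)⁻¹).im := by
          refine setIntegral_mono_set hIm ?_ (LE.le.eventuallyLE hsub)
          refine (ae_restrict_iff' (measurableSet_interval a b)).2
            (Eventually.of_forall fun y hy => ?_)
          simp only [Pi.zero_apply]
          rw [e2 y hy]
          have hτ0 := hτ.1
          exact mul_nonneg (hq0 y) (by positivity)
  have hfin : q z / 2 ≤ σ *
      (∫ s in Ioo (0 : ℝ) 1, deriv γ s * (Q (γ s) * ((z : ℂ) - γ s)⁻¹)).im := by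
    refine ge_of_tendsto (((Complex.continuous_im.tendsto _).comp hlim).const_mul σ) ?_
    filter_upwards [Ioo_mem_nhdsGT hρ] with τ hτ
    rw [Function.comp, (hcauchy τ hτ.1).2.2]
    exact hlower τ hτ
  exact lt_of_lt_of_le (by positivity) hfin

end Eigenvalues

/-! ### Eigenvalues and the bound by r₀ -/

section Spectrum

variable {V : Type*} [NormedAddCommGroup V] [InnerProductSpace ℂ V] [CompleteSpace V]
  [FiniteDimensional ℂ V]

theorem hasEigenvalue_of_mem_spectrum {T : V →L[ℂ] V} {z : ℂ} (hz : z ∈ spectrum ℂ T) :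
    Module.End.HasEigenvalue T.toLinearMap z := by
  obtain ⟨x, hx, e⟩ := mem_spectrum_iff_exists_eigenvector.1 hz
  exact Module.End.hasEigenvalue_of_hasEigenvector ⟨Module.End.mem_eigenspace_iff.2 e, hx⟩

theorem finite_spectrum (T : V →L[ℂ] V) : (spectrum ℂ T).Finite :=
  (Module.End.finite_hasEigenvalue T.toLinearMap).subset fun _ => hasEigenvalue_of_mem_spectrum

/-- Norm bound by `r₀` for the solutions of the basic equation. -/
theorem norm_le_rZero {a b : EReal} {Dm : Set ℂ} {K : ℝ → V →L[ℂ] V}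
    {K' : ℂ → V →L[ℂ] V} (hK : IsContinuedDerivative a b Dm K K')
    (hKint : IntegrableOn (fun y : ℝ => ‖K' y‖) (interval a b)) {l : ℤˣ} {γ : ℝ → ℂ}
    (hγ : IsAdmissible a b (side Dm l) K' γ) {A : V →L[ℂ] V} (hA : IsSelfAdjoint A)
    (hv : variation K' γ < contourDist A γ ^ 2 / 4) {X : V →L[ℂ] V}
    (hX : ‖X‖ < rMax A K' γ) (e : X = transformator K' γ (A + X)) :
    ‖X‖ ≤ rZero a b (side Dm l) A K' := by
  refine le_csInf ⟨_, γ, hγ, by linarith, rfl⟩ ?_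
  rintro _ ⟨γ', hγ', hv', rfl⟩
  have hv'' : variation K' γ' < contourDist A γ' ^ 2 / 4 := by linarith
  exact norm_le_of_solution_of_other hK hKint hγ hγ' hA (contourDist_pos hv)
    (contourDist_pos hv'') (fun z hz s hs => contourDist_le hz hs)
    (fun z hz s hs => contourDist_le hz hs) hv hv'' hX e

/-- On an eigenvector the resolvent is multiplication by (z - μ)⁻¹, which makes the operator
integral a scalar Cauchy integral. -/
theorem inner_resolventIntegral_apply_of_eigenvector {a b : EReal} {Dm : Set ℂ}
    {K : ℝ → V →L[ℂ] V} {K' : ℂ → V →L[ℂ] V} (hK : IsContinuedDerivative a b Dm K K') {l : ℤˣ}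
    {γ : ℝ → ℂ} (hγ : IsAdmissible a b (side Dm l) K' γ) {Z : V →L[ℂ] V} {M : ℝ}
    (hZ : ∀ s ∈ Ioo (0 : ℝ) 1, IsUnit (Z - γ s • (1 : V →L[ℂ] V)) ∧
      ‖Ring.inverse (Z - γ s • (1 : V →L[ℂ] V))‖ ≤ M) {x : V} (hx : x ≠ 0) {z : ℂ}
    (hzx : Z x = z • x) :
    inner ℂ x (resolventIntegral K' γ Z x) =
      ∫ s in Ioo (0 : ℝ) 1, deriv γ s * (inner ℂ x (K' (γ s) x) * (z - γ s)⁻¹) := by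
  have h := ContinuousLinearMap.integral_comp_comm
    ((innerSL ℂ x).comp (ContinuousLinearMap.apply ℂ V x)) (integrableOn_resolvent hK hγ hZ).1
  change _ = inner ℂ x (resolventIntegral K' γ Z x) at h
  rw [← h]
  refine setIntegral_congr_fun measurableSet_Ioo fun s hs => ?_
  have hu := (hZ s hs).1
  have h1 : (Z - γ s • (1 : V →L[ℂ] V)) x = (z - γ s) • x := by
    rw [sub_smul, ← hzx]
    simp
  have hinv : ∀ v, Ring.inverse (Z - γ s • (1 : V →L[ℂ] V)) ((Z - γ s • (1 : V →L[ℂ] V)) v) = v :=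
    fun v => congrArg (fun S : V →L[ℂ] V => S v) (Ring.inverse_mul_cancel _ hu)
  have h2 := hinv x
  rw [h1, map_smul] at h2
  have hne : z - γ s ≠ 0 := by
    intro h0
    rw [h0, zero_smul] at h2
    exact hx h2.symm
  have h3 : Ring.inverse (Z - γ s • (1 : V →L[ℂ] V)) x = (z - γ s)⁻¹ • x := by
    conv_rhs => rw [← h2]
    rw [smul_smul, inv_mul_cancel₀ hne, one_smul]
  change inner ℂ x ((deriv γ s • (K' (γ s) * Ring.inverse (Z - γ s • (1 : V →L[ℂ] V)))) x) = _
  rw [smul_apply, mul_apply_eq_comp, h3, map_smul, inner_smul_right, inner_smul_right]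
  ring

end Spectrum

end BlockOp

/-! ### Conclusion: exclusion of real eigenvalues -/

theorem lemma5p2
    {H₀ : Type*} [NormedAddCommGroup H₀] [InnerProductSpace ℂ H₀] [CompleteSpace H₀]
    {H₁ : Type*} [NormedAddCommGroup H₁] [InnerProductSpace ℂ H₁] [CompleteSpace H₁]
    [FiniteDimensional ℂ H₁]
    -- the interval `Δ₀ = (a, b)`
    (a b : EReal) (hab : a < b)
    -- the self-adjoint operator `A₀` with purely absolutely continuous spectrum, equal to the
    -- closure of `Δ₀`, and its spectral measure
    (A₀ : H₀ →ₗ.[ℂ] H₀) (hA₀ : IsSelfAdjoint A₀)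
    (E₀ : BlockOp.ProjMeasure H₀) (hE₀ : E₀.IsSpectralMeasureOf A₀)
    (hσ₀ : BlockOp.opSpectrum A₀ = Complex.ofReal '' closure (BlockOp.interval a b))
    (hac : ∀ x : H₀, E₀.scalar x ≪ volume)
    -- the self-adjoint operator `A₁` with spectrum embedded in `Δ₀`, and the coupling `B`
    (A₁ : H₁ →L[ℂ] H₁) (hA₁ : IsSelfAdjoint A₁)
    (hσ₁ : spectrum ℂ A₁ ⊆ Complex.ofReal '' BlockOp.interval a b)
    (B : H₁ →L[ℂ] H₀)
    -- the derivative of `K_B(μ) = B* E⁰(μ) B` and its continuation to `D⁻` and `D⁺`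
    (Dm : Set ℂ) (K' : ℂ → H₁ →L[ℂ] H₁)
    (hK' : BlockOp.IsContinuedDerivative a b Dm
      (fun μ => ContinuousLinearMap.adjoint B ∘L E₀.spectralFunction μ ∘L B) K')
    -- an admissible contour `Γ^l` in `D^l` with `𝒱₀(B, Γ^l) < d(Γ^l)² / 4`
    (l : ℤˣ) (γ : ℝ → ℂ) (hγ : BlockOp.IsAdmissible a b (BlockOp.side Dm l) K' γ)
    (hbest : BlockOp.variation K' γ < 1 / 4 * BlockOp.contourDist A₁ γ ^ 2)
    -- uniform positivity of `K_B'` on `Δ₀ ∩ 𝒪_{r₀}(σ₁)`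
    (c₀ : ℝ) (hc₀ : 0 < c₀)
    (hpos : ∀ μ ∈ BlockOp.interval a b,
      (μ : ℂ) ∈ Metric.cthickening (BlockOp.rZero a b (BlockOp.side Dm l) A₁ K')
        (spectrum ℂ A₁) →
      ∀ x : H₁, c₀ * ‖x‖ ^ 2 ≤ (inner ℂ (K' (μ : ℂ) x) x).re)
    -- the solution `X^(l)` of the basic equation
    (X : H₁ →L[ℂ] H₁) (hX : BlockOp.IsBasicSolution A₁ K' γ X) :
    (spectrum ℂ (A₁ + X)).Finite ∧
    ∀ z ∈ spectrum ℂ (A₁ + X),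
      Module.End.HasEigenvalue (A₁ + X : H₁ →L[ℂ] H₁).toLinearMap z ∧
      (∃ ε > 0, Metric.ball z ε ∩ spectrum ℂ (A₁ + X) = {z}) ∧
      FiniteDimensional ℂ
        (Module.End.maxGenEigenspace (A₁ + X : H₁ →L[ℂ] H₁).toLinearMap z) ∧
      z.im ≠ 0 := by
  have hKint := hK'.integrableOn_norm
  have hv : BlockOp.variation K' γ < BlockOp.contourDist A₁ γ ^ 2 / 4 := by linarith
  have hd : ∀ w ∈ spectrum ℂ A₁, ∀ s ∈ Ioo (0 : ℝ) 1, BlockOp.contourDist A₁ γ ≤ dist w (γ s) :=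
    fun w hw s hs => BlockOp.contourDist_le hw hs
  obtain ⟨⟨r, -, hr, hXr⟩, -, e⟩ := hX
  have hXmax : ‖X‖ < BlockOp.rMax A₁ K' γ := hXr.trans_lt hr
  have hXd : ‖X‖ < BlockOp.contourDist A₁ γ :=
    hXmax.trans_le (sub_le_self _ (Real.sqrt_nonneg _))
  have hX₀ := BlockOp.norm_le_rZero hK' hKint hγ hA₁ hv hXmax e
  have hfin := BlockOp.finite_spectrum (A₁ + X)
  refine ⟨hfin, fun z hz => ⟨BlockOp.hasEigenvalue_of_mem_spectrum hz, ?_, inferInstance, ?_⟩⟩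
  · obtain ⟨ε, hε, hball⟩ := Metric.isOpen_iff.1
      (hfin.subset (sdiff_subset (t := {z}))).isClosed.isOpen_compl z (by simp)
    refine ⟨ε, hε, Subset.antisymm ?_ (singleton_subset_iff.2 ⟨Metric.mem_ball_self hε, hz⟩)⟩
    rintro w ⟨hw, hw'⟩
    by_contra hne
    exact hball hw ⟨hw', hne⟩
  · intro him
    obtain ⟨t, rfl⟩ : ∃ t : ℝ, (t : ℂ) = z := ⟨z.re, Complex.ext rfl (by simp [him])⟩
    obtain ⟨w, hw, hwt⟩ := BlockOp.dist_spectrum_le hA₁ hz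
    obtain ⟨y, hy, rfl⟩ := hσ₁ hw
    have hyt : |y - t| ≤ ‖X‖ := by
      rwa [dist_eq_norm, ← Complex.ofReal_sub, Complex.norm_real, Real.norm_eq_abs] at hwt
    -- The contour runs into the finite end points, so these are at least as far from y as the
    -- contour is, whereas ‖X‖ is smaller.
    have ht : t ∈ BlockOp.interval a b :=
      BlockOp.mem_interval_of_dist_lt hγ hy (hd _ hw) (hyt.trans_lt hXd)
    have htγ : ∀ s ∈ Ioo (0 : ℝ) 1,
        BlockOp.contourDist A₁ γ - ‖X‖ ≤ dist (t : ℂ) (γ s) := by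
      intro s hs
      have h1 := hd _ hw s hs
      have h2 := dist_triangle (y : ℂ) t (γ s)
      linarith
    obtain ⟨x, hx, hzx⟩ := BlockOp.mem_spectrum_iff_exists_eigenvector.1 hz
    obtain ⟨q, -, hq0, hq⟩ := hK'.exists_integrable_form x
    -- This is where ‖X‖ ≤ r₀ enters: t is close enough to the spectrum of A₁ for the positivity
    -- assumption.
    have hqt : 0 < q t := by
      have h1 := hpos t ht (Metric.mem_cthickening_of_dist_le _ _ _ _ hw
        (by rw [dist_comm]; exact hwt.trans hX₀)) x
      rw [← inner_conj_symm, Complex.conj_re, hq t ht, Complex.ofReal_re] at h1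
      have := norm_pos_iff.2 hx
      exact lt_of_lt_of_le (by positivity) h1
    have key := BlockOp.sign_mul_im_integral_pos hK' hKint hγ hq0 hq ht (sub_pos.2 hXd) htγ hqt
    rw [← BlockOp.inner_resolventIntegral_apply_of_eigenvector hK' hγ
      (fun s hs => BlockOp.isUnit_add_sub_and_norm_inverse_le hA₁ (fun w hw => hd w hw s hs)
        le_rfl hXd) hx hzx] at key
    have h1 : BlockOp.resolventIntegral K' γ (A₁ + X) = -X := by
      conv_rhs => rw [e]
      exact (neg_neg _).symm
    -- Xx = tx - A₁x with t real and A₁ self-adjoint, against the nonzero imaginary part in `key`.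
    have h2 : (inner ℂ x (X x)).im = 0 := by
      have h3 : X x = (t : ℂ) • x - A₁ x := by
        rw [← hzx]
        simp
      have h4 : inner ℂ x x = ((‖x‖ ^ 2 : ℝ) : ℂ) := by
        rw [inner_self_eq_norm_sq_to_K]
        norm_cast
      rw [h3, inner_sub_right, inner_smul_right, Complex.sub_im, BlockOp.im_inner_self_apply hA₁, h4,
        ← Complex.ofReal_mul, Complex.ofReal_im, sub_zero]
    rw [h1, neg_apply, inner_neg_right, Complex.neg_im, h2, neg_zero, mul_zero] at key
    exact lt_irrefl _ key
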